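/- **Notation.** Let $e\ge 0$, $\rho(f)=1+e\cos f$, and let the range of true anomalies be $I_e=\mathbb R$ if $e<1$ and $I_e=\{f:|f|<\pi,\ \rho(f)>0\}$ if $e\ge 1$. Let $L(f)=\int_0^f\rho(\theta)^{-2}\,d\theta$, $D=\sin f\,(2+e\cos f)/\rho^2$, $C=\frac14\tan\frac f2-\frac1{20}\tan^5\frac f2$, and $$\varphi_1=\rho\sin f,\quad \varphi_1'=\rho\cos f-e\sin^2 f,\quad S_1=-\cos f-\tfrac12e\cos^2 f,\quad \varphi_3'=2(\varphi_1'S_2-\varphi_2'S_1).$$ For $e\ne1$: $$\varphi_2=\tfrac{e\varphi_1}{1-e^2}(D-3eL)-\tfrac{\cos f}{\rho},\quad \varphi_3=-\tfrac{\varphi_1}{1-e^2}(D-3eL)-\tfrac{\cos^2f}{\rho}-\cos^2f,\quad \varphi_2'=\tfrac{e\varphi_1'}{1-e^2}(D-3eL)+\tfrac{e\sin f\cos f}{\rho^2}+\tfrac{\sin f}{\rho},$$ $$S_2=-\tfrac{\rho^2(D-3eL)}{2(1-e^2)},\quad S_3=\tfrac{e\sin f(2+e\cos f)}{1-e^2}-\tfrac{3\rho^2L}{1-e^2}.$$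 For $e=1$: $$\varphi_2=2\varphi_1C-\tfrac{\cos f}{\rho},\quad \varphi_3=-2\varphi_1C-\tfrac{\cos^2f}{\rho}-\cos^2f,\quad \varphi_2'=2\varphi_1'C+\tfrac{\sin f\cos f}{\rho^2}+\tfrac{\sin f}{\rho},\quad S_2=-\rho^2C,\quad S_3=2(\rho^2C-\sin f)-\sin f\cos f.$$ Put $$\phi=\begin{bmatrix}\varphi_1&\varphi_2&\varphi_3&0&0&0\\-2S_1&-2S_2&-S_3&1&0&0\\0&0&0&0&\cos f&\sin f\\ \varphi_1'&\varphi_2'&\varphi_3'&0&0&0\\-2\varphi_1&-2\varphi_2&-2\varphi_3-1&0&0&0\\0&0&0&0&-\sin f&\cos f\end{bmatrix},\quad \psi=\begin{bmatrix}4S_2+\varphi_2'&0&0&-\varphi_2&2S_2&0\\-4S_1-\varphi_1'&0&0&\varphi_1&-2S_1&0\\-2&0&0&0&-1&0\\-2S_3-\varphi_3'&1&0&\varphi_3&-S_3&0\\0&0&\cos f&0&0&-\sin f\\0&0&\sin f&0&0&\cos f\end{bmatrix},$$ $$A=\begin{bmatrix}0&0&0&1&0&0\\0&0&0&0&1&0\\0&0&0&0&0&1\\3/\rho&0&0&0&2&0\\0&0&0&-2&0&0\\0&0&-1&0&0&0\end{bmatrix},\qquad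 K(f)=\phi^{-1}(f)\,\mathrm{diag}(O_{3\times3},\rho(f)^{-6}I_{3\times3})\,\phi^{-\mathrm T}(f).$$ For $e<1$ let $E(f)=\operatorname{atan2}\!\big(\tfrac{\sqrt{1-e^2}\sin f}{\rho},\tfrac{\cos f+e}{\rho}\big)+f-\operatorname{atan2}(\sin f,\cos f)$; for $e>1$ let $H(f)=\operatorname{artanh}\big(\sqrt{e^2-1}\,\sin f/(e+\cos f)\big)$. Define a symmetric $6\times6$ matrix $J(f)$ by $J(f)=\hat J(E(f))$ if $e<1$, $J(f)$ as displayed if $e=1$, and $J(f)=\bar J(H(f))$ if $e>1$. In all cases $J_{15}=J_{16}=J_{25}=J_{26}=J_{35}=J_{36}=J_{45}=J_{46}=0$, and the other entries on and above the diagonal are as follows. *Elliptic, $0\le e<1$:* $$\hat J_{11}(E)=-\frac{3}{2\,(1-e^2)^{15/2}}\,(-((-\tfrac{2}{15}\,e^4-\tfrac{2}{15}\,e^2+\tfrac{2}{15})\,\sin E+e^3\,E)\,e^3\,\cos^{4} E-\tfrac{8}{3}\,((-\tfrac{5}{32}\,e^4-\tfrac{1}{16}\,e^2-\tfrac{5}{16})\,\sin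 E+e\,(1+e^2)\,E)\,e^2\,\cos^{3} E-2\,e\,((\tfrac{7}{9}-\tfrac{4}{45}\,e^6+(E^2-\tfrac{44}{45})\,e^4-\tfrac{7}{15}\,e^2)\,\sin E-\tfrac{13}{2}\,e^3\,E-4\,e\,E)\,\cos^{2} E+((1-\tfrac{49}{24}\,e^6+(3\,E^2-\tfrac{187}{12})\,e^4-\tfrac{85}{12}\,e^2)\,\sin E-8\,e\,(1+e^4)\,E)\,\cos E+(\tfrac{16}{45}\,e^7+(-4\,E^2+\tfrac{1016}{45})\,e^5+(\tfrac{126}{5}+6\,E^2)\,e^3+\tfrac{128}{9}\,e)\,\sin E+(-\tfrac{5}{3}-\tfrac{49}{24}\,e^6+(E^2-\tfrac{251}{12})\,e^4+(-\tfrac{63}{4}-2\,E^2)\,e^2)\,E)$$ $$\hat J_{12}(E)=\frac{1}{60\,(1-e^2)^6}\,(-12\,e^3\,\cos^{5} E+(-15\,e^6+45\,e^4+75\,e^2)\,\cos^{4} E+(-40\,e^5-100\,e^3-140\,e)\,\cos^{3} E+(-60\,e^3\,(e^2-2)\,E\,\sin E+150\,e^4+150\,e^2+90)\,\cos^{2}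 E+((90\,e^4\,E-360\,e^2\,E)\,\sin E-120\,e^5+240\,e^3+300\,e)\,\cos E+45\,((-e^3+4\,e)\,\sin^{2} E-\tfrac{8}{3}\,(e^4-\tfrac{7}{2}\,e^2-3)\,E\,\sin E+e\,(e^2-6)\,E^2)\,e)$$ $$\hat J_{13}(E)=\frac{1}{60\,(1-e^2)^6}\,(-12\,e^4\,\cos^{5} E+(30\,e^5+75\,e^3)\,\cos^{4} E+(-100\,e^4-180\,e^2)\,\cos^{3} E+(60\,e^4\,E\,\sin E+180\,e^3+210\,e)\,\cos^{2} E+(-270\,e^3\,E\,\sin E+120\,e^4+420\,e^2-120)\,\cos E+135\,e^3\,\sin^{2} E+(120\,e^4\,E+540\,e^2\,E)\,\sin E-135\,e^3\,E^2-90\,e\,E^2)$$ $$\hat J_{14}(E)=-\frac{3}{2\,(1-e^2)^{15/2}}\,(((-\tfrac{2}{15}\,e^4+\tfrac{4}{15}\,e^6)\,\sin E-e^5\,E)\,\cos^{4} E+\tfrac{4}{3}\,e^2\,((-\tfrac{1}{4}\,e^5+\tfrac{3}{16}\,e^3+\tfrac{9}{8}\,e)\,\sin E+E\,(e^4-4\,e^2-1))\,\cos^{3}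 E-2\,((\frac{e^7}{9}-\tfrac{8}{45}\,e^5+e^3\,(E^2-\tfrac{86}{45})+\tfrac{11}{9}\,e)\,\sin E+2\,(e^4-\tfrac{21}{4}\,e^2-1)\,E)\,e\,\cos^{2} E+((\tfrac{11}{6}\,e^7-\tfrac{13}{8}\,e^5+(3\,E^2-\tfrac{275}{12})\,e^3-e)\,\sin E-4\,E\,(1+e^2)^2)\,\cos E+(\tfrac{16}{3}-\tfrac{4}{9}\,e^8-\tfrac{298}{45}\,e^6+(\tfrac{1304}{45}-4\,E^2)\,e^4+(6\,E^2+\tfrac{316}{9})\,e^2)\,\sin E+e\,E\,(\tfrac{11}{6}\,e^6+\tfrac{41}{24}\,e^4+(E^2-\tfrac{129}{4})\,e^2-2\,E^2-\tfrac{35}{3}))$$ $$\hat J_{22}(E)=\frac{1}{2\,(1-e^2)^{11/2}}\,((-\tfrac{2}{5}\,e^3\,\cos^{4} E+\tfrac{5}{2}\,e^2\,\cos^{3} E-\tfrac{2}{3}\,e\,(e^6-5\,e^4+\tfrac{39}{5}\,e^2+7)\,\cos^{2} E+(e^6-9\,e^4+\tfrac{75}{4}\,e^2+3)\,\cos E-\tfrac{4}{3}\,e^7+\tfrac{26}{3}\,e^5-\tfrac{22}{5}\,e^3-\tfrac{82}{3}\,e)\,\sin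 E+E\,(e^6-11\,e^4+\tfrac{83}{4}\,e^2+5))$$ $$\hat J_{23}(E)=-\frac{3}{2\,(1-e^2)^{11/2}}\,((\tfrac{2}{15}\,e^4\,\cos^{4} E-\tfrac{5}{6}\,e^3\,\cos^{3} E+(-\tfrac{2}{9}\,e^6+\tfrac{28}{45}\,e^4+2\,e^2)\,\cos^{2} E+(e^5-\tfrac{13}{4}\,e^3-\tfrac{7}{3}\,e)\,\cos E-\tfrac{4}{9}\,e^6-\tfrac{34}{45}\,e^4+8\,e^2+\tfrac{4}{3})\,\sin E+e\,E\,(e^4-\tfrac{31}{12}\,e^2-\tfrac{11}{3}))$$ $$\hat J_{24}(E)=\frac{1}{60\,(1-e^2)^6}\,(-12\,e^4\,\cos^{5} E+(-30\,e^5+135\,e^3)\,\cos^{4} E+(40\,e^6-100\,e^4-220\,e^2)\,\cos^{3} E+(-60\,e^2\,(e^2-2)\,E\,\sin E-120\,e^5+465\,e^3-90\,e)\,\cos^{2} E+((90\,e^3\,E-360\,e\,E)\,\sin E-60\,e^2+480)\,\cos E-120\,(e^4-\tfrac{7}{2}\,e^2-3)\,E\,\sin E+45\,((E^2-1)\,e^2-6\,E^2+4)\,e)$$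 $$\hat J_{33}(E)=\frac{1}{120\,(1-e^2)^{11/2}}\,((-24\,e^5\,\cos^{4} E+150\,e^4\,\cos^{3} E+(-32\,e^5-400\,e^3)\,\cos^{2} E+(225\,e^4+600\,e^2)\,\cos E-64\,e^5-800\,e^3-600\,e)\,\sin E+225\,e^4\,E+600\,e^2\,E+120\,E)$$ $$\hat J_{34}(E)=\frac{1}{60\,(1-e^2)^6}\,(-12\,e^5\,\cos^{5} E+(-15\,e^6+120\,e^4)\,\cos^{4} E+(60\,e^5-340\,e^3)\,\cos^{3} E+(60\,e^3\,E\,\sin E-90\,e^4+345\,e^2)\,\cos^{2} E+(-270\,e^2\,E\,\sin E+180\,e^3+240\,e)\,\cos E+(120\,e^3\,E+540\,e\,E)\,\sin E+(-135\,E^2+135)\,e^2-90\,E^2)$$ $$\hat J_{44}(E)=\frac{3}{(1-e^2)^{15/2}}\,(e\,(-\tfrac{1}{15}\,e^6\,\cos^{4} E+(-\tfrac{1}{6}\,e^7+\tfrac{5}{4}\,e^5-\tfrac{43}{24}\,e^3)\,\cos^{3} E+e^2\,(-\tfrac{1}{9}\,e^6+\tfrac{17}{15}\,e^4+E^2-\tfrac{28}{9}\,e^2+\tfrac{4}{3})\,\cos^{2}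 E-\tfrac{3}{2}\,e\,(-\tfrac{7}{18}\,e^6+\tfrac{37}{12}\,e^4+E^2-\tfrac{287}{72}\,e^2-\tfrac{119}{18})\,\cos E-\tfrac{2}{9}\,e^8-\frac{e^6}{15}+\tfrac{103}{9}\,e^4+(2\,E^2-\tfrac{79}{3})\,e^2-3\,E^2-16)\,\sin E-\tfrac{1}{2}\,E\,(-e^4\,\cos^{4} E+(\tfrac{8}{3}\,e^5-8\,e^3)\,\cos^{3} E+(-8\,e^4+29\,e^2)\,\cos^{2} E-16\,e\,\cos E-\tfrac{7}{6}\,e^8+\tfrac{29}{4}\,e^6+\tfrac{27}{8}\,e^4+(-\tfrac{283}{6}+E^2)\,e^2-\tfrac{8}{3}-2\,E^2))$$ $$\hat J_{55}(E)=\frac{3}{8\,(1-e^2)^{9/2}}\,((\tfrac{8}{15}\,e^3\,\cos^{4} E-2\,e^2\,\cos^{3} E+(-\tfrac{8}{45}\,e^3+\tfrac{8}{3}\,e)\,\cos^{2} E+(e^2-\tfrac{4}{3})\,\cos E-\tfrac{16}{45}\,e^3-\tfrac{8}{3}\,e)\,\sin E+E\,(e^2+\tfrac{4}{3}))$$ $$\hat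 J_{56}(E)=\frac{\cos E}{4\,(1-e^2)^5}\,(-\tfrac{4}{5}\,e^3\,\cos^{4} E+(e^4+3\,e^2)\,\cos^{3} E+(-4\,e^3-4\,e)\,\cos^{2} E+(6\,e^2+2)\,\cos E-4\,e)$$ $$\hat J_{66}(E)=\frac{9}{4\,(1-e^2)^{11/2}}\,((-\tfrac{4}{45}\,e^3\,\cos^{4} E+(\tfrac{2}{9}\,e^4+\tfrac{1}{3}\,e^2)\,\cos^{3} E+(-\tfrac{4}{27}\,e^5-\tfrac{136}{135}\,e^3-\tfrac{4}{9}\,e)\,\cos^{2} E+(e^4+\tfrac{11}{6}\,e^2+\tfrac{2}{9})\,\cos E-\tfrac{8}{27}\,e^5-\tfrac{452}{135}\,e^3-\tfrac{16}{9}\,e)\,\sin E+E\,(e^4+\tfrac{41}{18}\,e^2+\tfrac{2}{9}))$$ *Parabolic, $e=1$:* $$J_{11}(f)=-\frac{\sin \tfrac f2}{144144000\,\cos^{15} \tfrac f2}\,(237568\,\cos^{14} \tfrac f2+118784\,\cos^{12} \tfrac f2+89088\,\cos^{10} \tfrac f2-1847680\,\cos^{8} \tfrac f2+185080\,\cos^{6}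 \tfrac f2+166572\,\cos^{4} \tfrac f2-72534\,\cos^{2} \tfrac f2-3003)$$ $$J_{12}(f)=\frac{1}{25\,(1+\cos f)^5}+\frac{3}{20\,(1+\cos f)^4}-\frac{4}{15\,(1+\cos f)^3}-\frac{1}{15\,(1+\cos f)^6}$$ $$J_{13}(f)=\frac{1}{10\,(1+\cos f)^4}+\frac{2}{25\,(1+\cos f)^5}-\frac{1}{15\,(1+\cos f)^6}$$ $$J_{14}(f)=-\frac{\sin \tfrac f2}{48048000\,\cos^{15} \tfrac f2}\,(51456\,\cos^{14} \tfrac f2+25728\,\cos^{12} \tfrac f2+19296\,\cos^{10} \tfrac f2+977040\,\cos^{8} \tfrac f2+104160\,\cos^{6} \tfrac f2-26376\,\cos^{4} \tfrac f2-24178\,\cos^{2} \tfrac f2-1001)$$ $$J_{22}(f)=\tfrac{1}{352}\,\tan^{11} \tfrac f2+\tfrac{5}{288}\,\tan^{9} \tfrac f2+\tfrac{1}{112}\,\tan^{7} \tfrac f2+\tfrac{1}{80}\,\tan^{5} \tfrac f2+\tfrac{13}{96}\,\tan^{3} \tfrac f2+\tfrac{9}{32}\,\tan \tfrac f2$$ $$J_{23}(f)=\tfrac{1}{352}\,\tan^{11}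 \tfrac f2+\tfrac{5}{288}\,\tan^{9} \tfrac f2+\tfrac{3}{112}\,\tan^{7} \tfrac f2-\tfrac{1}{80}\,\tan^{5} \tfrac f2-\tfrac{7}{96}\,\tan^{3} \tfrac f2-\tfrac{3}{32}\,\tan \tfrac f2$$ $$J_{24}(f)=-\frac{4}{25\,(1+\cos f)^5}-\frac{1}{10\,(1+\cos f)^4}+\frac{2}{5\,(1+\cos f)^3}-\frac{1}{15\,(1+\cos f)^6}$$ $$J_{33}(f)=\tfrac{1}{352}\,\tan^{11} \tfrac f2+\tfrac{5}{288}\,\tan^{9} \tfrac f2+\tfrac{5}{112}\,\tan^{7} \tfrac f2+\tfrac{1}{16}\,\tan^{5} \tfrac f2+\tfrac{5}{96}\,\tan^{3} \tfrac f2+\tfrac{1}{32}\,\tan \tfrac f2$$ $$J_{34}(f)=-\frac{3}{25\,(1+\cos f)^5}-\frac{3}{20\,(1+\cos f)^4}-\frac{1}{15\,(1+\cos f)^6}$$ $$J_{44}(f)=\frac{\sin \tfrac f2}{144144000\,\cos^{15} \tfrac f2}\,(1759232\,\cos^{14} \tfrac f2+879616\,\cos^{12} \tfrac f2+659712\,\cos^{10}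 \tfrac f2+4874080\,\cos^{8} \tfrac f2+1562120\,\cos^{6} \tfrac f2+324828\,\cos^{4} \tfrac f2+72534\,\cos^{2} \tfrac f2+3003)$$ $$J_{55}(f)=\tfrac{1}{72}\,\tan^{9} \tfrac f2+\tfrac{3}{56}\,\tan^{7} \tfrac f2+\tfrac{3}{40}\,\tan^{5} \tfrac f2+\tfrac{1}{24}\,\tan^{3} \tfrac f2$$ $$J_{56}(f)=\frac{1}{5\,(1+\cos f)^5}-\frac{1}{4\,(1+\cos f)^4}$$ $$J_{66}(f)=\tfrac{1}{352}\,\tan^{11} \tfrac f2+\tfrac{1}{288}\,\tan^{9} \tfrac f2-\tfrac{1}{112}\,\tan^{7} \tfrac f2-\tfrac{1}{80}\,\tan^{5} \tfrac f2+\tfrac{1}{96}\,\tan^{3} \tfrac f2+\tfrac{1}{32}\,\tan \tfrac f2$$ *Hyperbolic, $e>1$:* $$\bar J_{11}(H)=-\frac{3}{2\,(e^2-1)^{15/2}}\,(e^3\,((-\tfrac{2}{15}\,e^4-\tfrac{2}{15}\,e^2+\tfrac{2}{15})\,\sinh H+e^3\,H)\,\cosh^{4} H+\tfrac{8}{3}\,e^2\,((-\tfrac{5}{32}\,e^4-\tfrac{1}{16}\,e^2-\tfrac{5}{16})\,\sinh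 H+e\,(e^2+1)\,H)\,\cosh^{3} H-2\,e\,((-\tfrac{7}{9}+\tfrac{4}{45}\,e^6+(H^2+\tfrac{44}{45})\,e^4+\tfrac{7}{15}\,e^2)\,\sinh H+\tfrac{13}{2}\,e^3\,H+4\,e\,H)\,\cosh^{2} H+((-1+\tfrac{49}{24}\,e^6+(3\,H^2+\tfrac{187}{12})\,e^4+\tfrac{85}{12}\,e^2)\,\sinh H+8\,e\,(e^4+1)\,H)\,\cosh H+(-\tfrac{16}{45}\,e^7+(-4\,H^2-\tfrac{1016}{45})\,e^5+(6\,H^2-\tfrac{126}{5})\,e^3-\tfrac{128}{9}\,e)\,\sinh H+H\,(\tfrac{5}{3}+\tfrac{49}{24}\,e^6+(H^2+\tfrac{251}{12})\,e^4+(-2\,H^2+\tfrac{63}{4})\,e^2))$$ $$\bar J_{12}(H)=\frac{1}{60\,(e^2-1)^6}\,(-12\,e^3\,\cosh^{5} H+(-15\,e^6+45\,e^4+75\,e^2)\,\cosh^{4} H+(-40\,e^5-100\,e^3-140\,e)\,\cosh^{3} H+(60\,e^3\,(e^2-2)\,H\,\sinh H+195\,e^4-30\,e^2+90)\,\cosh^{2}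 H+((-90\,e^4\,H+360\,e^2\,H)\,\sinh H-120\,e^5+240\,e^3+300\,e)\,\cosh H-45\,e\,H\,((-\tfrac{8}{3}\,e^4+\tfrac{28}{3}\,e^2+8)\,\sinh H+e\,(e^2-6)\,H))$$ $$\bar J_{13}(H)=\frac{1}{60\,(e^2-1)^6}\,(-12\,e^4\,\cosh^{5} H+(30\,e^5+75\,e^3)\,\cosh^{4} H+(-100\,e^4-180\,e^2)\,\cosh^{3} H+(-60\,e^4\,H\,\sinh H+45\,e^3+210\,e)\,\cosh^{2} H+(270\,e^3\,H\,\sinh H+120\,e^4+420\,e^2-120)\,\cosh H+135\,e\,H\,((-\tfrac{8}{9}\,e^3-4\,e)\,\sinh H+H\,(e^2+\tfrac{2}{3})))$$ $$\bar J_{14}(H)=-\frac{3}{2\,(e^2-1)^{15/2}}\,(((-\tfrac{4}{15}\,e^6+\tfrac{2}{15}\,e^4)\,\sinh H+e^5\,H)\,\cosh^{4} H-\tfrac{4}{3}\,e^2\,((-\tfrac{1}{4}\,e^5+\tfrac{3}{16}\,e^3+\tfrac{9}{8}\,e)\,\sinh H+H\,(e^4-4\,e^2-1))\,\cosh^{3}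 H-2\,((-\frac{e^7}{9}+\tfrac{8}{45}\,e^5+(H^2+\tfrac{86}{45})\,e^3-\tfrac{11}{9}\,e)\,\sinh H-2\,H\,(e^4-\tfrac{21}{4}\,e^2-1))\,e\,\cosh^{2} H+((-\tfrac{11}{6}\,e^7+\tfrac{13}{8}\,e^5+(\tfrac{275}{12}+3\,H^2)\,e^3+e)\,\sinh H+4\,(e^2+1)^2\,H)\,\cosh H+(-\tfrac{16}{3}+\tfrac{4}{9}\,e^8+\tfrac{298}{45}\,e^6+(-4\,H^2-\tfrac{1304}{45})\,e^4+(-\tfrac{316}{9}+6\,H^2)\,e^2)\,\sinh H+e\,H\,(-\tfrac{11}{6}\,e^6-\tfrac{41}{24}\,e^4+(\tfrac{129}{4}+H^2)\,e^2+\tfrac{35}{3}-2\,H^2))$$ $$\bar J_{22}(H)=-\frac{1}{2\,(e^2-1)^{11/2}}\,((-\tfrac{2}{5}\,e^3\,\cosh^{4} H+\tfrac{5}{2}\,e^2\,\cosh^{3} H-\tfrac{2}{3}\,e\,(e^6-5\,e^4+\tfrac{39}{5}\,e^2+7)\,\cosh^{2} H+(e^6-9\,e^4+\tfrac{75}{4}\,e^2+3)\,\cosh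 H-\tfrac{4}{3}\,e^7+\tfrac{26}{3}\,e^5-\tfrac{22}{5}\,e^3-\tfrac{82}{3}\,e)\,\sinh H+H\,(e^6-11\,e^4+\tfrac{83}{4}\,e^2+5))$$ $$\bar J_{23}(H)=\frac{3}{2\,(e^2-1)^{11/2}}\,((\tfrac{2}{15}\,e^4\,\cosh^{4} H-\tfrac{5}{6}\,e^3\,\cosh^{3} H+(-\tfrac{2}{9}\,e^6+\tfrac{28}{45}\,e^4+2\,e^2)\,\cosh^{2} H+(e^5-\tfrac{13}{4}\,e^3-\tfrac{7}{3}\,e)\,\cosh H-\tfrac{4}{9}\,e^6-\tfrac{34}{45}\,e^4+8\,e^2+\tfrac{4}{3})\,\sinh H+e\,H\,(e^4-\tfrac{31}{12}\,e^2-\tfrac{11}{3}))$$ $$\bar J_{24}(H)=\frac{1}{60\,(e^2-1)^6}\,(-12\,e^4\,\cosh^{5} H+(-30\,e^5+135\,e^3)\,\cosh^{4} H+(40\,e^6-100\,e^4-220\,e^2)\,\cosh^{3} H+(60\,e^2\,(e^2-2)\,H\,\sinh H-120\,e^5+465\,e^3-90\,e)\,\cosh^{2} H+((-90\,e^3\,H+360\,e\,H)\,\sinh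 H-60\,e^2+480)\,\cosh H-45\,H\,((-\tfrac{8}{3}\,e^4+\tfrac{28}{3}\,e^2+8)\,\sinh H+e\,(e^2-6)\,H))$$ $$\bar J_{33}(H)=\frac{1}{120\,(e^2-1)^{11/2}}\,((24\,e^5\,\cosh^{4} H-150\,e^4\,\cosh^{3} H+(32\,e^5+400\,e^3)\,\cosh^{2} H+(-225\,e^4-600\,e^2)\,\cosh H+64\,e^5+800\,e^3+600\,e)\,\sinh H-225\,e^4\,H-600\,e^2\,H-120\,H)$$ $$\bar J_{34}(H)=\frac{1}{60\,(e^2-1)^6}\,(-12\,e^5\,\cosh^{5} H+(-15\,e^6+120\,e^4)\,\cosh^{4} H+(60\,e^5-340\,e^3)\,\cosh^{3} H+(-60\,e^3\,H\,\sinh H-90\,e^4+345\,e^2)\,\cosh^{2} H+(270\,e^2\,H\,\sinh H+180\,e^3+240\,e)\,\cosh H+135\,H\,((-\tfrac{8}{9}\,e^3-4\,e)\,\sinh H+H\,(e^2+\tfrac{2}{3})))$$ $$\bar J_{44}(H)=\frac{3}{(e^2-1)^{15/2}}\,(e\,(\tfrac{1}{15}\,e^6\,\cosh^{4} H+(\tfrac{1}{6}\,e^7-\tfrac{5}{4}\,e^5+\tfrac{43}{24}\,e^3)\,\cosh^{3}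 H+e^2\,(\tfrac{1}{9}\,e^6-\tfrac{17}{15}\,e^4+H^2+\tfrac{28}{9}\,e^2-\tfrac{4}{3})\,\cosh^{2} H-\tfrac{3}{2}\,e\,(\tfrac{7}{18}\,e^6-\tfrac{37}{12}\,e^4+H^2+\tfrac{287}{72}\,e^2+\tfrac{119}{18})\,\cosh H+\tfrac{2}{9}\,e^8+\frac{e^6}{15}-\tfrac{103}{9}\,e^4+(2\,H^2+\tfrac{79}{3})\,e^2-3\,H^2+16)\,\sinh H-\tfrac{1}{2}\,H\,(e^4\,\cosh^{4} H+(8\,e^3-\tfrac{8}{3}\,e^5)\,\cosh^{3} H+(8\,e^4-29\,e^2)\,\cosh^{2} H+16\,e\,\cosh H+\tfrac{7}{6}\,e^8-\tfrac{29}{4}\,e^6-\tfrac{27}{8}\,e^4+(H^2+\tfrac{283}{6})\,e^2+\tfrac{8}{3}-2\,H^2))$$ $$\bar J_{55}(H)=\frac{3}{8\,(e^2-1)^{9/2}}\,((\tfrac{8}{15}\,e^3\,\cosh^{4} H-2\,e^2\,\cosh^{3} H+(-\tfrac{8}{45}\,e^3+\tfrac{8}{3}\,e)\,\cosh^{2}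 H+(e^2-\tfrac{4}{3})\,\cosh H-\tfrac{16}{45}\,e^3-\tfrac{8}{3}\,e)\,\sinh H+H\,(e^2+\tfrac{4}{3}))$$ $$\bar J_{56}(H)=-\frac{\cosh H}{4\,(e^2-1)^5}\,(-\tfrac{4}{5}\,e^3\,\cosh^{4} H+(e^4+3\,e^2)\,\cosh^{3} H+(-4\,e^3-4\,e)\,\cosh^{2} H+(6\,e^2+2)\,\cosh H-4\,e)$$ $$\bar J_{66}(H)=-\frac{9}{4\,(e^2-1)^{11/2}}\,((-\tfrac{4}{45}\,e^3\,\cosh^{4} H+(\tfrac{2}{9}\,e^4+\tfrac{1}{3}\,e^2)\,\cosh^{3} H+(-\tfrac{4}{27}\,e^5-\tfrac{136}{135}\,e^3-\tfrac{4}{9}\,e)\,\cosh^{2} H+(e^4+\tfrac{11}{6}\,e^2+\tfrac{2}{9})\,\cosh H-\tfrac{8}{27}\,e^5-\tfrac{452}{135}\,e^3-\tfrac{16}{9}\,e)\,\sinh H+H\,(e^4+\tfrac{41}{18}\,e^2+\tfrac{2}{9}))$$ **Theorem.** 1. For all $e\ge0$ and $f\in I_e$: $\phi(f)$ is invertible with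 inverse $\psi(f)$, $\phi'(f)=A(f)\phi(f)$, and $$J'(f)=K(f)\quad\text{entrywise}.$$ 2. (Elliptic, $0\le e<1$.) For every real $f$, with $E=E(f)$: $|f-E|<2\pi$, $\sin f=\frac{\sqrt{1-e^2}\sin E}{1-e\cos E}$, $\cos f=\frac{\cos E-e}{1-e\cos E}$, $L(f)=\frac{E-e\sin E}{\sqrt{(1-e^2)^3}}$, $\frac{dE}{df}=\frac{1-e\cos E}{\sqrt{1-e^2}}$. Let $\hat K(E)$ be $\frac{\sqrt{1-e^2}}{1-e\cos E}$ times the matrix obtained from $K$ by replacing $\sin f,\cos f,L$ by these expressions in $E$. Then $\hat J'(E)=\hat K(E)$ for all real $E$, and for all real $f_1,f_2$ $$\int_{f_1}^{f_2}K(\theta)\,d\theta=\int_{E(f_1)}^{E(f_2)}\hat K(\vartheta)\,d\vartheta=\hat J(E(f_2))-\hat J(E(f_1)).$$ 3. (Parabolic, $e=1$.) $J'(f)=K(f)$ for $|f|<\pi$, directly in $f$. 4. (Hyperbolic, $e>1$.) For every $f\in I_e$, with $H=H(f)$: $\sin f=\frac{\sqrt{e^2-1}\sinh H}{e\cosh H-1}$,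 $\cos f=\frac{e-\cosh H}{e\cosh H-1}$, $L(f)=\frac{e\sinh H-H}{\sqrt{(e^2-1)^3}}$, $\frac{dH}{df}=\frac{e\cosh H-1}{\sqrt{e^2-1}}$. Let $\bar K(H)$ be $\frac{\sqrt{e^2-1}}{e\cosh H-1}$ times the matrix obtained from $K$ by replacing $\sin f,\cos f,L$ by these expressions. Then $\bar J'(H)=\bar K(H)$ for all real $H$, and for $f_1,f_2\in I_e$ $$\int_{f_1}^{f_2}K(\theta)\,d\theta=\int_{H(f_1)}^{H(f_2)}\bar K(\psi)\,d\psi=\bar J(H(f_2))-\bar J(H(f_1)).$$ 5. (Closed form of the strategy.) Let $e\ge0$, $\mu,p>0$, $n=\sqrt{\mu/p^3}$, $r_p,r_e\ne0$, $s_r\in\mathbb R$, $S=\mathrm{diag}(s_rI_{3\times3},O)$, $R_p=r_pI_{3\times3}$, $R_e=r_eI_{3\times3}$, $B=\frac1{n^2\rho^3}\begin{bmatrix}O\\I_{3\times3}\end{bmatrix}$, $Q=B(R_p^{-1}-R_e^{-1})B^{\mathrm T}$, and $$\Omega_{11}(f_2,f_1)=\phi(f_2)\phi^{-1}(f_1),\quad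 \Omega_{22}=\Omega_{11}^{-\mathrm T},\quad \Omega_{12}(f_2,f_1)=\int_{f_1}^{f_2}\Omega_{11}(f_2,\theta)\,(-Q(\theta))\,\Omega_{11}^{-\mathrm T}(\theta,f_1)\,d\theta .$$ For $f_1,f_2\in I_e$ the entries of $K$ are integrable between $f_1$ and $f_2$, $\int_{f_1}^{f_2}K\,d\theta=J(f_2)-J(f_1)$, and $$\Omega_{12}(f_2,f_1)=\frac1{n^4}\Big(\frac1{r_e}-\frac1{r_p}\Big)\phi(f_2)\,\big(J(f_2)-J(f_1)\big)\,\phi^{\mathrm T}(f_1).$$ For $f_f\in I_e$ put $P(f)=\big(\Omega_{22}(f_f,f)-S\,\Omega_{12}(f_f,f)\big)^{-1}S\,\Omega_{11}(f_f,f)$. Then $P(f_f)=S$, and at every $f\in I_e$ where the matrix in parentheses is invertible $$P'(f)=-A^{\mathrm T}P-PA+PQP .$$ -/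

import Mathlib

open Real

noncomputable section

namespace PursuitEvasion

/-- Six by six real matrices. -/
abbrev Mat6 := Matrix (Fin 6) (Fin 6) ℝ

/-- `ρ(f) = 1 + e cos f`. -/
def rho (e f : ℝ) : ℝ := 1 + e * cos f

/-- The true anomalies of the orbit of eccentricity `e`, counted from periapsis: every real
number (several revolutions) if `e < 1`, the open arc `|f| < π`, `ρ(f) > 0` if `e ≥ 1`. -/
def anomalyRange (e : ℝ) : Set ℝ := {f | e < 1 ∨ (|f| < π ∧ 0 < rho e f)}

/-- `L(f) = ∫ df / ρ²(f) = n t`, with the time `t` counted from periapsis. -/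
def meanL (e f : ℝ) : ℝ := ∫ θ in (0 : ℝ)..f, 1 / rho e θ ^ 2

/-! ### The fundamental matrix of the Tschauner–Hempel equations -/

/-- The numbers from which `φ` and its inverse are assembled at one point of the orbit:
`sin f`, `cos f`, `φ₁`, `φ₂`, `φ₃`, their derivatives, and the antiderivatives
`S₁ = S(φ₁)`, `S₂ = S(φ₂)`, `S₃ = S(2 φ₃ + 1)`. It carries no assumption. -/
structure FundData where
  (s c φ₁ φ₂ φ₃ dφ₁ dφ₂ dφ₃ S₁ S₂ S₃ : ℝ)

/-- The data for `e ≠ 1`, as a function of `e` and the values of `sin f`, `cos f`, `L(f)`. -/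
def fundData (e s c L : ℝ) : FundData :=
  let ρ := 1 + e * c
  let D := s * (2 + e * c) / ρ ^ 2
  let φ₁ := ρ * s
  let dφ₁ := ρ * c - e * s ^ 2
  let S₁ := -c - 1 / 2 * e * c ^ 2
  let φ₂ := e * φ₁ / (1 - e ^ 2) * (D - 3 * e * L) - c / ρ
  let φ₃ := -φ₁ / (1 - e ^ 2) * (D - 3 * e * L) - c ^ 2 / ρ - c ^ 2
  let dφ₂ := e * dφ₁ / (1 - e ^ 2) * (D - 3 * e * L) + e * s * c / ρ ^ 2 + s / ρ
  let S₂ := -(ρ ^ 2 * (D - 3 * e * L)) / (2 * (1 - e ^ 2))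
  let S₃ := e * s * (2 + e * c) / (1 - e ^ 2) - 3 * ρ ^ 2 * L / (1 - e ^ 2)
  ⟨s, c, φ₁, φ₂, φ₃, dφ₁, dφ₂, 2 * (dφ₁ * S₂ - dφ₂ * S₁), S₁, S₂, S₃⟩

/-- The data for `e = 1`. -/
def fundDataPar (f : ℝ) : FundData :=
  let s := sin f
  let c := cos f
  let ρ := 1 + c
  let C := 1 / 4 * tan (f / 2) - 1 / 20 * tan (f / 2) ^ 5
  let φ₁ := ρ * s
  let dφ₁ := ρ * c - s ^ 2
  let S₁ := -c - 1 / 2 * c ^ 2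
  let φ₂ := 2 * φ₁ * C - c / ρ
  let φ₃ := -2 * φ₁ * C - c ^ 2 / ρ - c ^ 2
  let dφ₂ := 2 * dφ₁ * C + s * c / ρ ^ 2 + s / ρ
  let S₂ := -(ρ ^ 2 * C)
  let S₃ := 2 * (ρ ^ 2 * C - s) - s * c
  ⟨s, c, φ₁, φ₂, φ₃, dφ₁, dφ₂, 2 * (dφ₁ * S₂ - dφ₂ * S₁), S₁, S₂, S₃⟩

/-- The matrix `φ`. -/
def FundData.mat (d : FundData) : Mat6 :=
  !![d.φ₁, d.φ₂, d.φ₃, 0, 0, 0;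
     -2 * d.S₁, -2 * d.S₂, -d.S₃, 1, 0, 0;
     0, 0, 0, 0, d.c, d.s;
     d.dφ₁, d.dφ₂, d.dφ₃, 0, 0, 0;
     -2 * d.φ₁, -2 * d.φ₂, -2 * d.φ₃ - 1, 0, 0, 0;
     0, 0, 0, 0, -d.s, d.c]

/-- The displayed closed form of `φ⁻¹`. That it is the inverse is claimed in the theorem. -/
def FundData.invMat (d : FundData) : Mat6 :=
  !![4 * d.S₂ + d.dφ₂, 0, 0, -d.φ₂, 2 * d.S₂, 0;
     -4 * d.S₁ - d.dφ₁, 0, 0, d.φ₁, -2 * d.S₁, 0;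
     -2, 0, 0, 0, -1, 0;
     -2 * d.S₃ - d.dφ₃, 1, 0, d.φ₃, -d.S₃, 0;
     0, 0, d.c, 0, 0, -d.s;
     0, 0, d.s, 0, 0, d.c]

/-- The data at the true anomaly `f`. -/
def fundAt (e f : ℝ) : FundData :=
  if e = 1 then fundDataPar f else fundData e (sin f) (cos f) (meanL e f)

/-- The fundamental matrix `φ(f)`. -/
def phi (e f : ℝ) : Mat6 := (fundAt e f).mat

/-! ### The game: system matrices, transition matrices, Riccati solution -/

/-- The system matrix `A` of the Tschauner–Hempel equations. -/
def sysA (e f : ℝ) : Mat6 :=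
  !![0, 0, 0, 1, 0, 0;
     0, 0, 0, 0, 1, 0;
     0, 0, 0, 0, 0, 1;
     3 / rho e f, 0, 0, 0, 2, 0;
     0, 0, 0, -2, 0, 0;
     0, 0, -1, 0, 0, 0]

/-- The mean rate `n = √(μ / p³)`. -/
def rate (μ p : ℝ) : ℝ := √(μ / p ^ 3)

/-- The control matrix `B = (β / ρ³) [O; I]`, with `β = 1 / n²`. -/
def sysB (n e f : ℝ) : Matrix (Fin 6) (Fin 3) ℝ :=
  (1 / n ^ 2 / rho e f ^ 3) •
    !![0, 0, 0; 0, 0, 0; 0, 0, 0; 1, 0, 0; 0, 1, 0; 0, 0, 1]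

/-- `B (R_p⁻¹ - R_e⁻¹) Bᵀ` with `R_p = r_p I`, `R_e = r_e I`. -/
def gameQ (n rp re e f : ℝ) : Mat6 :=
  sysB n e f * ((rp • (1 : Matrix (Fin 3) (Fin 3) ℝ))⁻¹ -
    (re • (1 : Matrix (Fin 3) (Fin 3) ℝ))⁻¹) * (sysB n e f).transpose

/-- The terminal weight `S = diag(s_r I, O)`. -/
def termS (sr : ℝ) : Mat6 := Matrix.diagonal ![sr, sr, sr, 0, 0, 0]

/-- Entrywise integral of a matrix function. -/
def matIntegral (a b : ℝ) (M : ℝ → Mat6) : Mat6 :=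
  Matrix.of fun i j => ∫ θ in a..b, M θ i j

/-- `Ω₁₁(f₂, f₁) = φ(f₂) φ⁻¹(f₁)`, with the matrix inverse. -/
def Omega11 (e f₂ f₁ : ℝ) : Mat6 := phi e f₂ * (phi e f₁)⁻¹

/-- `Ω₂₂ = Ω₁₁⁻ᵀ`. -/
def Omega22 (e f₂ f₁ : ℝ) : Mat6 := ((Omega11 e f₂ f₁)⁻¹).transpose

/-- `Ω₁₂(f₂, f₁) = ∫ Ω₁₁(f₂, θ) (-B (R_p⁻¹ - R_e⁻¹) Bᵀ) Ω₁₁⁻ᵀ(θ, f₁) dθ` over `[f₁, f₂]`. -/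
def Omega12 (n rp re e f₂ f₁ : ℝ) : Mat6 :=
  matIntegral f₁ f₂ fun θ => Omega11 e f₂ θ * (-gameQ n rp re e θ) * Omega22 e θ f₁

/-- The matrix `Ω₂₂(f_f, f) - S Ω₁₂(f_f, f)`. -/
def riccatiDen (n rp re sr e ff f : ℝ) : Mat6 :=
  Omega22 e ff f - termS sr * Omega12 n rp re e ff f

/-- The gain `P(f) = (Ω₂₂(f_f, f) - S Ω₁₂(f_f, f))⁻¹ S Ω₁₁(f_f, f)`. -/
def gainP (n rp re sr e ff f : ℝ) : Mat6 :=
  (riccatiDen n rp re sr e ff f)⁻¹ * (termS sr * Omega11 e ff f)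

/-! ### The integrand -/

/-- `φ⁻¹ diag(O, ρ⁻⁶ I) φ⁻ᵀ` at given data, where `ρ = 1 + e cos f`; the inverse is the matrix
inverse of `φ`. -/
def kernelOf (e : ℝ) (d : FundData) : Mat6 :=
  d.mat⁻¹ * Matrix.diagonal
    ![0, 0, 0, 1 / (1 + e * d.c) ^ 6, 1 / (1 + e * d.c) ^ 6, 1 / (1 + e * d.c) ^ 6] *
    (d.mat⁻¹).transpose

/-- The integrand `φ⁻¹(f) diag(O, ρ⁻⁶(f) I) φ⁻ᵀ(f)`. -/
def kernel (e f : ℝ) : Mat6 := kernelOf e (fundAt e f)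

/-! ### Anomalies -/

/-- `atan2(y, x)`, with values in `(-π, π]`. -/
def atan2 (y x : ℝ) : ℝ := Complex.arg ⟨x, y⟩

/-- The eccentric anomaly `E` as a function of `f`. -/
def eccAnomaly (e f : ℝ) : ℝ :=
  atan2 (√(1 - e ^ 2) * sin f / rho e f) ((cos f + e) / rho e f) + f - atan2 (sin f) (cos f)

/-- The hyperbolic anomaly `H` as a function of `f`. -/
def hypAnomaly (e f : ℝ) : ℝ := artanh (√(e ^ 2 - 1) * sin f / (e + cos f))

/-- `sin f`, `cos f` and `L` as functions of the eccentric anomaly, and the integrand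
after this change of variable, including the factor `df/dE`. -/
def sinOfE (e E : ℝ) : ℝ := √(1 - e ^ 2) * sin E / (1 - e * cos E)

def cosOfE (e E : ℝ) : ℝ := (cos E - e) / (1 - e * cos E)

def meanLOfE (e E : ℝ) : ℝ := (E - e * sin E) / √((1 - e ^ 2) ^ 3)

def kernelE (e E : ℝ) : Mat6 :=
  (√(1 - e ^ 2) / (1 - e * cos E)) •
    kernelOf e (fundData e (sinOfE e E) (cosOfE e E) (meanLOfE e E))

/-- The same for the hyperbolic anomaly. -/
def sinOfH (e H : ℝ) : ℝ := √(e ^ 2 - 1) * sinh H / (e * cosh H - 1)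

def cosOfH (e H : ℝ) : ℝ := (e - cosh H) / (e * cosh H - 1)

def meanLOfH (e H : ℝ) : ℝ := (e * sinh H - H) / √((e ^ 2 - 1) ^ 3)

def kernelH (e H : ℝ) : Mat6 :=
  (√(e ^ 2 - 1) / (e * cosh H - 1)) •
    kernelOf e (fundData e (sinOfH e H) (cosOfH e H) (meanLOfH e H))

/-! ### Components of `J`, elliptic case, in the eccentric anomaly

A half-integer power `x^(k/2)` is written `√x^k`. -/

def ellJ11 (e E : ℝ) : ℝ :=
  -3 / (2 * √(1 - e^2)^15) * (-((-2/15 * e^4 - 2/15 * e^2 + 2/15) * sin E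
    + e^3 * E) * e^3 * cos E^4 - 8/3 * ((-5/32 * e^4 - 1/16 * e^2 - 5/16) * sin E + e * (1
    + e^2) * E) * e^2 * cos E^3 - 2 * e * ((7/9 - 4/45 * e^6 + (E^2 - 44/45) * e^4
    - 7/15 * e^2) * sin E - 13/2 * e^3 * E - 4 * e * E) * cos E^2 + ((1 - 49/24 * e^6 + (3 * E^2
    - 187/12) * e^4 - 85/12 * e^2) * sin E - 8 * e * (1 + e^4) * E) * cos E + (16/45 * e^7
    + (-4 * E^2 + 1016/45) * e^5 + (126/5 + 6 * E^2) * e^3 + 128/9 * e) * sin E + (-5/3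
    - 49/24 * e^6 + (E^2 - 251/12) * e^4 + (-63/4 - 2 * E^2) * e^2) * E)

def ellJ12 (e E : ℝ) : ℝ :=
  1 / (60 * (1 - e^2)^6) * (-12 * e^3 * cos E^5 + (-15 * e^6 + 45 * e^4 + 75 * e^2) * cos E^4
    + (-40 * e^5 - 100 * e^3 - 140 * e) * cos E^3 + (-60 * e^3 * (e^2 - 2) * E * sin E
    + 150 * e^4 + 150 * e^2 + 90) * cos E^2 + ((90 * e^4 * E - 360 * e^2 * E) * sin E
    - 120 * e^5 + 240 * e^3 + 300 * e) * cos E + 45 * ((-e^3 + 4 * e) * sin E^2 - 8/3 * (e^4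
    - 7/2 * e^2 - 3) * E * sin E + e * (e^2 - 6) * E^2) * e)

def ellJ13 (e E : ℝ) : ℝ :=
  1 / (60 * (1 - e^2)^6) * (-12 * e^4 * cos E^5 + (30 * e^5 + 75 * e^3) * cos E^4 + (-100 * e^4
    - 180 * e^2) * cos E^3 + (60 * e^4 * E * sin E + 180 * e^3 + 210 * e) * cos E^2
    + (-270 * e^3 * E * sin E + 120 * e^4 + 420 * e^2 - 120) * cos E + 135 * e^3 * sin E^2
    + (120 * e^4 * E + 540 * e^2 * E) * sin E - 135 * e^3 * E^2 - 90 * e * E^2)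

def ellJ14 (e E : ℝ) : ℝ :=
  -3 / (2 * √(1 - e^2)^15) * (((-2/15 * e^4 + 4/15 * e^6) * sin E - e^5 * E) * cos E^4
    + 4/3 * e^2 * cos E^3 * ((-1/4 * e^5 + 3/16 * e^3 + 9/8 * e) * sin E + E * (e^4 - 4 * e^2
    - 1)) - 2 * ((e^7/9 - 8/45 * e^5 + e^3 * (E^2 - 86/45) + 11/9 * e) * sin E + 2 * (e^4
    - 21/4 * e^2 - 1) * E) * e * cos E^2 + ((11/6 * e^7 - 13/8 * e^5 + (3 * E^2 - 275/12) * e^3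
    - e) * sin E - 4 * E * (1 + e^2)^2) * cos E + (16/3 - 4/9 * e^8 - 298/45 * e^6 + (1304/45
    - 4 * E^2) * e^4 + (6 * E^2 + 316/9) * e^2) * sin E + e * E * (11/6 * e^6 + 41/24 * e^4
    + (E^2 - 129/4) * e^2 - 2 * E^2 - 35/3))

def ellJ22 (e E : ℝ) : ℝ :=
  1 / (2 * √(1 - e^2)^11) * ((-2/5 * e^3 * cos E^4 + 5/2 * e^2 * cos E^3 - 2/3 * e * (e^6
    - 5 * e^4 + 39/5 * e^2 + 7) * cos E^2 + (e^6 - 9 * e^4 + 75/4 * e^2 + 3) * cos E - 4/3 * e^7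
    + 26/3 * e^5 - 22/5 * e^3 - 82/3 * e) * sin E + E * (e^6 - 11 * e^4 + 83/4 * e^2 + 5))

def ellJ23 (e E : ℝ) : ℝ :=
  -3 / (2 * √(1 - e^2)^11) * ((2/15 * e^4 * cos E^4 - 5/6 * e^3 * cos E^3 + (-2/9 * e^6
    + 28/45 * e^4 + 2 * e^2) * cos E^2 + (e^5 - 13/4 * e^3 - 7/3 * e) * cos E - 4/9 * e^6
    - 34/45 * e^4 + 8 * e^2 + 4/3) * sin E + e * E * (e^4 - 31/12 * e^2 - 11/3))

def ellJ24 (e E : ℝ) : ℝ :=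
  1 / (60 * (1 - e^2)^6) * (-12 * e^4 * cos E^5 + (-30 * e^5 + 135 * e^3) * cos E^4 + (40 * e^6
    - 100 * e^4 - 220 * e^2) * cos E^3 + (-60 * e^2 * (e^2 - 2) * E * sin E - 120 * e^5
    + 465 * e^3 - 90 * e) * cos E^2 + ((90 * e^3 * E - 360 * e * E) * sin E - 60 * e^2
    + 480) * cos E - 120 * (e^4 - 7/2 * e^2 - 3) * E * sin E + 45 * ((E^2 - 1) * e^2 - 6 * E^2
    + 4) * e)

def ellJ33 (e E : ℝ) : ℝ :=
  1 / (120 * √(1 - e^2)^11) * ((-24 * e^5 * cos E^4 + 150 * e^4 * cos E^3 + (-32 * e^5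
    - 400 * e^3) * cos E^2 + (225 * e^4 + 600 * e^2) * cos E - 64 * e^5 - 800 * e^3
    - 600 * e) * sin E + 225 * e^4 * E + 600 * e^2 * E + 120 * E)

def ellJ34 (e E : ℝ) : ℝ :=
  1 / (60 * (1 - e^2)^6) * (-12 * e^5 * cos E^5 + (-15 * e^6 + 120 * e^4) * cos E^4 + (60 * e^5
    - 340 * e^3) * cos E^3 + (60 * e^3 * E * sin E - 90 * e^4 + 345 * e^2) * cos E^2
    + (-270 * e^2 * E * sin E + 180 * e^3 + 240 * e) * cos E + (120 * e^3 * E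
    + 540 * e * E) * sin E + (-135 * E^2 + 135) * e^2 - 90 * E^2)

def ellJ44 (e E : ℝ) : ℝ :=
  3 / √(1 - e^2)^15 * (e * (-1/15 * e^6 * cos E^4 + (-1/6 * e^7 + 5/4 * e^5
    - 43/24 * e^3) * cos E^3 + e^2 * (-1/9 * e^6 + 17/15 * e^4 + E^2 - 28/9 * e^2
    + 4/3) * cos E^2 - 3/2 * e * (-7/18 * e^6 + 37/12 * e^4 + E^2 - 287/72 * e^2
    - 119/18) * cos E - 2/9 * e^8 - e^6/15 + 103/9 * e^4 + (2 * E^2 - 79/3) * e^2 - 3 * E^2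
    - 16) * sin E - 1/2 * E * (-e^4 * cos E^4 + (8/3 * e^5 - 8 * e^3) * cos E^3 + (-8 * e^4
    + 29 * e^2) * cos E^2 - 16 * e * cos E - 7/6 * e^8 + 29/4 * e^6 + 27/8 * e^4 + (-283/6
    + E^2) * e^2 - 8/3 - 2 * E^2))

def ellJ55 (e E : ℝ) : ℝ :=
  3 / (8 * √(1 - e^2)^9) * ((8/15 * e^3 * cos E^4 - 2 * e^2 * cos E^3 + (-8/45 * e^3
    + 8/3 * e) * cos E^2 + (e^2 - 4/3) * cos E - 16/45 * e^3 - 8/3 * e) * sin E + E * (e^2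
    + 4/3))

def ellJ56 (e E : ℝ) : ℝ :=
  cos E / (4 * (1 - e^2)^5) * (-4/5 * e^3 * cos E^4 + (e^4 + 3 * e^2) * cos E^3 + (-4 * e^3
    - 4 * e) * cos E^2 + (6 * e^2 + 2) * cos E - 4 * e)

def ellJ66 (e E : ℝ) : ℝ :=
  9 / (4 * √(1 - e^2)^11) * ((-4/45 * e^3 * cos E^4 + (2/9 * e^4 + 1/3 * e^2) * cos E^3
    + (-4/27 * e^5 - 136/135 * e^3 - 4/9 * e) * cos E^2 + (e^4 + 11/6 * e^2 + 2/9) * cos E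
    - 8/27 * e^5 - 452/135 * e^3 - 16/9 * e) * sin E + E * (e^4 + 41/18 * e^2 + 2/9))

/-- The matrix `J` of the elliptic case as a function of `E`. -/
def ellJ (e E : ℝ) : Mat6 :=
  !![ellJ11 e E, ellJ12 e E, ellJ13 e E, ellJ14 e E, 0, 0;
     ellJ12 e E, ellJ22 e E, ellJ23 e E, ellJ24 e E, 0, 0;
     ellJ13 e E, ellJ23 e E, ellJ33 e E, ellJ34 e E, 0, 0;
     ellJ14 e E, ellJ24 e E, ellJ34 e E, ellJ44 e E, 0, 0;
     0, 0, 0, 0, ellJ55 e E, ellJ56 e E;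
     0, 0, 0, 0, ellJ56 e E, ellJ66 e E]

/-! ### Components of `J`, parabolic case, in the true anomaly -/

def parJ11 (f : ℝ) : ℝ :=
  -sin (f / 2) / (144144000 * cos (f / 2)^15) * (237568 * cos (f / 2)^14
    + 118784 * cos (f / 2)^12 + 89088 * cos (f / 2)^10 - 1847680 * cos (f / 2)^8
    + 185080 * cos (f / 2)^6 + 166572 * cos (f / 2)^4 - 72534 * cos (f / 2)^2 - 3003)

def parJ12 (f : ℝ) : ℝ :=
  1 / (25 * (1 + cos f)^5) + 3 / (20 * (1 + cos f)^4) - 4 / (15 * (1 + cos f)^3) - 1 / (15 * (1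
    + cos f)^6)

def parJ13 (f : ℝ) : ℝ :=
  1 / (10 * (1 + cos f)^4) + 2 / (25 * (1 + cos f)^5) - 1 / (15 * (1 + cos f)^6)

def parJ14 (f : ℝ) : ℝ :=
  -sin (f / 2) / (48048000 * cos (f / 2)^15) * (51456 * cos (f / 2)^14 + 25728 * cos (f / 2)^12
    + 19296 * cos (f / 2)^10 + 977040 * cos (f / 2)^8 + 104160 * cos (f / 2)^6
    - 26376 * cos (f / 2)^4 - 24178 * cos (f / 2)^2 - 1001)

def parJ22 (f : ℝ) : ℝ :=
  1/352 * tan (f / 2)^11 + 5/288 * tan (f / 2)^9 + 1/112 * tan (f / 2)^7 + 1/80 * tan (f / 2)^5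
    + 13/96 * tan (f / 2)^3 + 9/32 * tan (f / 2)

def parJ23 (f : ℝ) : ℝ :=
  1/352 * tan (f / 2)^11 + 5/288 * tan (f / 2)^9 + 3/112 * tan (f / 2)^7 - 1/80 * tan (f / 2)^5
    - 7/96 * tan (f / 2)^3 - 3/32 * tan (f / 2)

def parJ24 (f : ℝ) : ℝ :=
  -4 / (25 * (1 + cos f)^5) - 1 / (10 * (1 + cos f)^4) + 2 / (5 * (1 + cos f)^3) - 1 / (15 * (1
    + cos f)^6)

def parJ33 (f : ℝ) : ℝ :=
  1/352 * tan (f / 2)^11 + 5/288 * tan (f / 2)^9 + 5/112 * tan (f / 2)^7 + 1/16 * tan (f / 2)^5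
    + 5/96 * tan (f / 2)^3 + 1/32 * tan (f / 2)

def parJ34 (f : ℝ) : ℝ :=
  -3 / (25 * (1 + cos f)^5) - 3 / (20 * (1 + cos f)^4) - 1 / (15 * (1 + cos f)^6)

def parJ44 (f : ℝ) : ℝ :=
  sin (f / 2) / (144144000 * cos (f / 2)^15) * (1759232 * cos (f / 2)^14
    + 879616 * cos (f / 2)^12 + 659712 * cos (f / 2)^10 + 4874080 * cos (f / 2)^8
    + 1562120 * cos (f / 2)^6 + 324828 * cos (f / 2)^4 + 72534 * cos (f / 2)^2 + 3003)

def parJ55 (f : ℝ) : ℝ :=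
  1/72 * tan (f / 2)^9 + 3/56 * tan (f / 2)^7 + 3/40 * tan (f / 2)^5 + 1/24 * tan (f / 2)^3

def parJ56 (f : ℝ) : ℝ :=
  1 / (5 * (1 + cos f)^5) - 1 / (4 * (1 + cos f)^4)

def parJ66 (f : ℝ) : ℝ :=
  1/352 * tan (f / 2)^11 + 1/288 * tan (f / 2)^9 - 1/112 * tan (f / 2)^7 - 1/80 * tan (f / 2)^5
    + 1/96 * tan (f / 2)^3 + 1/32 * tan (f / 2)

/-- The matrix `J` of the parabolic case as a function of `f`. -/
def parJ (f : ℝ) : Mat6 :=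
  !![parJ11 f, parJ12 f, parJ13 f, parJ14 f, 0, 0;
     parJ12 f, parJ22 f, parJ23 f, parJ24 f, 0, 0;
     parJ13 f, parJ23 f, parJ33 f, parJ34 f, 0, 0;
     parJ14 f, parJ24 f, parJ34 f, parJ44 f, 0, 0;
     0, 0, 0, 0, parJ55 f, parJ56 f;
     0, 0, 0, 0, parJ56 f, parJ66 f]

/-! ### Components of `J`, hyperbolic case, in the hyperbolic anomaly -/

def hypJ11 (e H : ℝ) : ℝ :=
  -3 / (2 * √(e^2 - 1)^15) * (e^3 * ((-2/15 * e^4 - 2/15 * e^2 + 2/15) * sinh H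
    + e^3 * H) * cosh H^4 + 8/3 * e^2 * cosh H^3 * ((-5/32 * e^4 - 1/16 * e^2 - 5/16) * sinh H
    + e * (e^2 + 1) * H) - 2 * e * ((-7/9 + 4/45 * e^6 + (H^2 + 44/45) * e^4
    + 7/15 * e^2) * sinh H + 13/2 * e^3 * H + 4 * e * H) * cosh H^2 + ((-1 + 49/24 * e^6
    + (3 * H^2 + 187/12) * e^4 + 85/12 * e^2) * sinh H + 8 * e * (e^4 + 1) * H) * cosh H
    + (-16/45 * e^7 + (-4 * H^2 - 1016/45) * e^5 + (6 * H^2 - 126/5) * e^3 - 128/9 * e) * sinh H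
    + H * (5/3 + 49/24 * e^6 + (H^2 + 251/12) * e^4 + (-2 * H^2 + 63/4) * e^2))

def hypJ12 (e H : ℝ) : ℝ :=
  1 / (60 * (e^2 - 1)^6) * (-12 * e^3 * cosh H^5 + (-15 * e^6 + 45 * e^4 + 75 * e^2) * cosh H^4
    + (-40 * e^5 - 100 * e^3 - 140 * e) * cosh H^3 + (60 * e^3 * (e^2 - 2) * H * sinh H
    + 195 * e^4 - 30 * e^2 + 90) * cosh H^2 + ((-90 * e^4 * H + 360 * e^2 * H) * sinh H
    - 120 * e^5 + 240 * e^3 + 300 * e) * cosh H - 45 * e * H * ((-8/3 * e^4 + 28/3 * e^2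
    + 8) * sinh H + e * (e^2 - 6) * H))

def hypJ13 (e H : ℝ) : ℝ :=
  1 / (60 * (e^2 - 1)^6) * (-12 * e^4 * cosh H^5 + (30 * e^5 + 75 * e^3) * cosh H^4
    + (-100 * e^4 - 180 * e^2) * cosh H^3 + (-60 * e^4 * H * sinh H + 45 * e^3
    + 210 * e) * cosh H^2 + (270 * e^3 * H * sinh H + 120 * e^4 + 420 * e^2 - 120) * cosh H
    + 135 * e * H * ((-8/9 * e^3 - 4 * e) * sinh H + H * (e^2 + 2/3)))

def hypJ14 (e H : ℝ) : ℝ :=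
  -3 / (2 * √(e^2 - 1)^15) * (((-4/15 * e^6 + 2/15 * e^4) * sinh H + e^5 * H) * cosh H^4
    - 4/3 * e^2 * cosh H^3 * ((-1/4 * e^5 + 3/16 * e^3 + 9/8 * e) * sinh H + H * (e^4 - 4 * e^2
    - 1)) - 2 * ((-e^7/9 + 8/45 * e^5 + (H^2 + 86/45) * e^3 - 11/9 * e) * sinh H - 2 * H * (e^4
    - 21/4 * e^2 - 1)) * e * cosh H^2 + ((-11/6 * e^7 + 13/8 * e^5 + (275/12 + 3 * H^2) * e^3
    + e) * sinh H + 4 * (e^2 + 1)^2 * H) * cosh H + (-16/3 + 4/9 * e^8 + 298/45 * e^6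
    + (-4 * H^2 - 1304/45) * e^4 + (-316/9 + 6 * H^2) * e^2) * sinh H + e * H * (-11/6 * e^6
    - 41/24 * e^4 + (129/4 + H^2) * e^2 + 35/3 - 2 * H^2))

def hypJ22 (e H : ℝ) : ℝ :=
  -1 / (2 * √(e^2 - 1)^11) * ((-2/5 * e^3 * cosh H^4 + 5/2 * e^2 * cosh H^3
    - 2/3 * e * cosh H^2 * (e^6 - 5 * e^4 + 39/5 * e^2 + 7) + (e^6 - 9 * e^4 + 75/4 * e^2
    + 3) * cosh H - 4/3 * e^7 + 26/3 * e^5 - 22/5 * e^3 - 82/3 * e) * sinh H + H * (e^6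
    - 11 * e^4 + 83/4 * e^2 + 5))

def hypJ23 (e H : ℝ) : ℝ :=
  3 / (2 * √(e^2 - 1)^11) * ((2/15 * e^4 * cosh H^4 - 5/6 * e^3 * cosh H^3 + (-2/9 * e^6
    + 28/45 * e^4 + 2 * e^2) * cosh H^2 + (e^5 - 13/4 * e^3 - 7/3 * e) * cosh H - 4/9 * e^6
    - 34/45 * e^4 + 8 * e^2 + 4/3) * sinh H + e * H * (e^4 - 31/12 * e^2 - 11/3))

def hypJ24 (e H : ℝ) : ℝ :=
  1 / (60 * (e^2 - 1)^6) * (-12 * e^4 * cosh H^5 + (-30 * e^5 + 135 * e^3) * cosh H^4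
    + (40 * e^6 - 100 * e^4 - 220 * e^2) * cosh H^3 + (60 * e^2 * (e^2 - 2) * H * sinh H
    - 120 * e^5 + 465 * e^3 - 90 * e) * cosh H^2 + ((-90 * e^3 * H + 360 * e * H) * sinh H
    - 60 * e^2 + 480) * cosh H - 45 * H * ((-8/3 * e^4 + 28/3 * e^2 + 8) * sinh H + e * (e^2
    - 6) * H))

def hypJ33 (e H : ℝ) : ℝ :=
  1 / (120 * √(e^2 - 1)^11) * ((24 * e^5 * cosh H^4 - 150 * e^4 * cosh H^3 + (32 * e^5
    + 400 * e^3) * cosh H^2 + (-225 * e^4 - 600 * e^2) * cosh H + 64 * e^5 + 800 * e^3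
    + 600 * e) * sinh H - 225 * e^4 * H - 600 * e^2 * H - 120 * H)

def hypJ34 (e H : ℝ) : ℝ :=
  1 / (60 * (e^2 - 1)^6) * (-12 * e^5 * cosh H^5 + (-15 * e^6 + 120 * e^4) * cosh H^4
    + (60 * e^5 - 340 * e^3) * cosh H^3 + (-60 * e^3 * H * sinh H - 90 * e^4
    + 345 * e^2) * cosh H^2 + (270 * e^2 * H * sinh H + 180 * e^3 + 240 * e) * cosh H
    + 135 * H * ((-8/9 * e^3 - 4 * e) * sinh H + H * (e^2 + 2/3)))

def hypJ44 (e H : ℝ) : ℝ :=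
  3 / √(e^2 - 1)^15 * (e * (1/15 * e^6 * cosh H^4 + (1/6 * e^7 - 5/4 * e^5
    + 43/24 * e^3) * cosh H^3 + e^2 * (1/9 * e^6 - 17/15 * e^4 + H^2 + 28/9 * e^2
    - 4/3) * cosh H^2 - 3/2 * e * (7/18 * e^6 - 37/12 * e^4 + H^2 + 287/72 * e^2
    + 119/18) * cosh H + 2/9 * e^8 + e^6/15 - 103/9 * e^4 + (2 * H^2 + 79/3) * e^2 - 3 * H^2
    + 16) * sinh H - 1/2 * H * (e^4 * cosh H^4 + (8 * e^3 - 8/3 * e^5) * cosh H^3 + (8 * e^4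
    - 29 * e^2) * cosh H^2 + 16 * e * cosh H + 7/6 * e^8 - 29/4 * e^6 - 27/8 * e^4 + (H^2
    + 283/6) * e^2 + 8/3 - 2 * H^2))

def hypJ55 (e H : ℝ) : ℝ :=
  3 / (8 * √(e^2 - 1)^9) * ((8/15 * e^3 * cosh H^4 - 2 * e^2 * cosh H^3 + (-8/45 * e^3
    + 8/3 * e) * cosh H^2 + (e^2 - 4/3) * cosh H - 16/45 * e^3 - 8/3 * e) * sinh H + H * (e^2
    + 4/3))

def hypJ56 (e H : ℝ) : ℝ :=
  -cosh H / (4 * (e^2 - 1)^5) * (-4/5 * e^3 * cosh H^4 + (e^4 + 3 * e^2) * cosh H^3 + (-4 * e^3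
    - 4 * e) * cosh H^2 + (6 * e^2 + 2) * cosh H - 4 * e)

def hypJ66 (e H : ℝ) : ℝ :=
  -9 / (4 * √(e^2 - 1)^11) * ((-4/45 * e^3 * cosh H^4 + (2/9 * e^4 + 1/3 * e^2) * cosh H^3
    + (-4/27 * e^5 - 136/135 * e^3 - 4/9 * e) * cosh H^2 + (e^4 + 11/6 * e^2 + 2/9) * cosh H
    - 8/27 * e^5 - 452/135 * e^3 - 16/9 * e) * sinh H + H * (e^4 + 41/18 * e^2 + 2/9))

/-- The matrix `J` of the hyperbolic case as a function of `H`. -/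
def hypJ (e H : ℝ) : Mat6 :=
  !![hypJ11 e H, hypJ12 e H, hypJ13 e H, hypJ14 e H, 0, 0;
     hypJ12 e H, hypJ22 e H, hypJ23 e H, hypJ24 e H, 0, 0;
     hypJ13 e H, hypJ23 e H, hypJ33 e H, hypJ34 e H, 0, 0;
     hypJ14 e H, hypJ24 e H, hypJ34 e H, hypJ44 e H, 0, 0;
     0, 0, 0, 0, hypJ55 e H, hypJ56 e H;
     0, 0, 0, 0, hypJ56 e H, hypJ66 e H]

/-- The matrix `J(f)`. -/
def matJ (e f : ℝ) : Mat6 :=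
  if e < 1 then ellJ e (eccAnomaly e f)
  else if e = 1 then parJ f
  else hypJ e (hypAnomaly e f)

end PursuitEvasion

end

open PursuitEvasion

noncomputable section

namespace PursuitEvasion

/-! The argument has four ingredients.

The fundamental matrix. Let `U` be an antiderivative of `cos f / ρ³`: it is `C` for `e = 1` and `(D
- 3eL) / (2(1 - e²))` otherwise. In terms of `U` the data take one form for all eccentricities
(`fundOf`). The functions `φ₁`, `φ₂` solve `y'' = (3/ρ - 4) y` with Wronskian 1, and variation of
parameters gives the solution `φ₃ = 2(φ₁ S₂ - φ₂ S₁)` of the same equation with right-hand side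
`-2`. The Wronskian, the formulas for `φ₃` and `φ₃'`, and `sin² + cos² = 1` make `ψ` the inverse of
`φ` (`FundData.IsFundamental`). The derivatives along the orbit follow from `U' = cos f / ρ³`
(`hasDerivAt_auxU`, `hasDerivAt_fundAt`).

The integrand. The factor `diag(O, ρ⁻⁶ I)` keeps only the last three columns of `φ⁻¹`. In the
eccentric or hyperbolic anomaly `ρ` is a constant over `W = ±(1 - e cos E)` (with `cosh H` in the
hyperbolic case), and these columns have denominators of order at most `W²`. So `ρ⁻⁶`, the Jacobian
and the columns combine to a polynomial in the anomaly and its trigonometric or hyperbolic functions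
(`kernelE_eq`, `kernelH_eq`). For `e = 1` the variable `t = tan (f/2)` does the same
(`kernel_one_eq`). That `J` is an antiderivative is then a finite set of polynomial identities,
modulo `sin² + cos² = 1` or `cosh² - sinh² = 1`.

The anomalies. The branch jumps of the two `atan2` terms in `E(f)` cancel, because `E(f) = f - 2
arctan (b sin f / (1 + b cos f))` with `b = e / (1 + √(1 - e²))` (`eccAnomaly_eq`). This formula
gives `dE/df`; in the hyperbolic case `artanh` is differentiated directly. The chain rule gives `J'
= K` (`hasDerivAt_matJ`), and the integrals follow by the fundamental theorem of calculus.

The game. The integrand of `Ω₁₂(f₂, f₁)` is a scalar multiple of `φ(f₂) K(θ) φᵀ(f₁)`, so its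
integral involves only `J(f₂) - J(f₁)`. Differentiating `Ω₁₁`, `Ω₂₂`, `Ω₁₂` in the initial anomaly
gives a linear system. The Riccati equation is the quotient rule for `P = (Ω₂₂ - S Ω₁₂)⁻¹ S Ω₁₁`. -/

/-! ### The integrand in the eccentric anomaly -/

/-- `1 - e cos E = r (1 - e²) / p`. -/
def ellW (e E : ℝ) : ℝ := 1 - e * cos E

/-- `√(1 - e²)³ (D - 3 e L)` in the eccentric anomaly. -/
def ellX (e E : ℝ) : ℝ := sin E * (2 + 2 * e ^ 2 - e * cos E) - 3 * e * E

/-- A multiple of `S₃ / ρ²` in the eccentric anomaly. -/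
def ellY (e E : ℝ) : ℝ := e * sin E * (5 - e * cos E - e ^ 2) - 3 * E

/-- A multiple of `φ₂ / ρ²` in the eccentric anomaly. -/
def ellA (e E : ℝ) : ℝ := (cos E - e) * ellW e E ^ 2 - e * sin E * ellX e E

/-- A multiple of `S₁ / ρ²` in the eccentric anomaly. -/
def ellB (e E : ℝ) : ℝ := (cos E - e) * (2 - e * cos E - e ^ 2)

/-- A multiple of `φ₃ / ρ²` in the eccentric anomaly. -/
def ellC (e E : ℝ) : ℝ := -sin E * ellX e E - (cos E - e) ^ 2 * (2 - e * cos E - e ^ 2)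

/-- The entries of the integrand as polynomials in the anomaly and its trigonometric functions. -/
def ellK (e E : ℝ) : Mat6 :=
  let k₁₁ := ellW e E * (ellA e E ^ 2 + (1 - e ^ 2) * ellX e E ^ 2) / √(1 - e ^ 2) ^ 15
  let k₁₂ := ellW e E * ((1 - e ^ 2) * (ellA e E * sin E) - ellX e E * ellB e E) / (1 - e ^ 2) ^ 6
  let k₁₃ := ellW e E * (ellX e E * ellW e E ^ 2) / (1 - e ^ 2) ^ 6
  let k₁₄ := ellW e E * (ellA e E * ellC e E +
      (1 - e ^ 2) * (ellX e E * ellY e E)) / √(1 - e ^ 2) ^ 15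
  let k₂₂ := ellW e E * ((1 - e ^ 2) ^ 3 * sin E ^ 2 + ellB e E ^ 2) / √(1 - e ^ 2) ^ 11
  let k₂₃ := ellW e E * (-(ellB e E * ellW e E ^ 2)) / √(1 - e ^ 2) ^ 11
  let k₂₄ := ellW e E * ((1 - e ^ 2) * (sin E * ellC e E) - ellB e E * ellY e E) / (1 - e ^ 2) ^ 6
  let k₃₃ := ellW e E * ellW e E ^ 4 / √(1 - e ^ 2) ^ 11
  let k₃₄ := ellW e E * (ellW e E ^ 2 * ellY e E) / (1 - e ^ 2) ^ 6
  let k₄₄ := ellW e E * (ellC e E ^ 2 + (1 - e ^ 2) * ellY e E ^ 2) / √(1 - e ^ 2) ^ 15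
  let k₅₅ := ellW e E * (sin E * ellW e E) ^ 2 / √(1 - e ^ 2) ^ 9
  let k₅₆ := ellW e E * (-(sin E * ellW e E * ((cos E - e) * ellW e E))) / (1 - e ^ 2) ^ 5
  let k₆₆ := ellW e E * ((cos E - e) * ellW e E) ^ 2 / √(1 - e ^ 2) ^ 11
  !![k₁₁, k₁₂, k₁₃, k₁₄, 0, 0;
     k₁₂, k₂₂, k₂₃, k₂₄, 0, 0;
     k₁₃, k₂₃, k₃₃, k₃₄, 0, 0;
     k₁₄, k₂₄, k₃₄, k₄₄, 0, 0;
     0, 0, 0, 0, k₅₅, k₅₆;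
     0, 0, 0, 0, k₅₆, k₆₆]

/-- Both sides are polynomials in `E`, `sin E`, `cos E` with matching constant denominators, so the
claim holds for every `e`: no relation between the square root and `1 - e²` is needed. -/
theorem hasDerivAt_ellJ_entries (e E : ℝ) :
    HasDerivAt (ellJ11 e) (ellK e E 0 0) E ∧
    HasDerivAt (ellJ12 e) (ellK e E 0 1) E ∧
    HasDerivAt (ellJ13 e) (ellK e E 0 2) E ∧
    HasDerivAt (ellJ14 e) (ellK e E 0 3) E ∧
    HasDerivAt (ellJ22 e) (ellK e E 1 1) E ∧
    HasDerivAt (ellJ23 e) (ellK e E 1 2) E ∧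
    HasDerivAt (ellJ24 e) (ellK e E 1 3) E ∧
    HasDerivAt (ellJ33 e) (ellK e E 2 2) E ∧
    HasDerivAt (ellJ34 e) (ellK e E 2 3) E ∧
    HasDerivAt (ellJ44 e) (ellK e E 3 3) E ∧
    HasDerivAt (ellJ55 e) (ellK e E 4 4) E ∧
    HasDerivAt (ellJ56 e) (ellK e E 4 5) E ∧
    HasDerivAt (ellJ66 e) (ellK e E 5 5) E := by
  have h := sin_sq_add_cos_sq E
  unfold ellJ11 ellJ12 ellJ13 ellJ14 ellJ22 ellJ23 ellJ24 ellJ33 ellJ34 ellJ44 ellJ55 ellJ56 ellJ66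
  -- The derivative is first a metavariable, assembled by the differentiation rules, and only then
  -- compared with the entry of `ellK`.
  refine ⟨?_, ?_, ?_, ?_, ?_, ?_, ?_, ?_, ?_, ?_, ?_, ?_,
      ?_⟩ <;> apply HasDerivAt.congr_deriv <;> try
    repeat' with_reducible first
      | exact hasDerivAt_const _ _
      | exact hasDerivAt_id' _
      | exact hasDerivAt_sin _
      | exact hasDerivAt_cos _
      | apply HasDerivAt.const_mul
      | apply HasDerivAt.div_const
      | apply HasDerivAt.fun_add
      | apply HasDerivAt.fun_sub
      | apply HasDerivAt.fun_neg
      | apply HasDerivAt.fun_pow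
      | apply HasDerivAt.fun_mul
  all_goals
    simp only [ellK, ellW, ellX, ellY, ellA, ellB, ellC, Matrix.of_apply, Matrix.cons_val]
    generalize √(1 - e ^ 2) = r at *
    generalize sin E = s at *
    generalize cos E = c at *
    push_cast
    simp only [div_eq_mul_inv, mul_inv]
    generalize ((1 - e ^ 2) ^ 6)⁻¹ = q₆
    generalize ((1 - e ^ 2) ^ 5)⁻¹ = q₅
  -- In each goal the long factor is the polynomial cofactor of `s² + c² - 1` in the difference of
  -- the two sides. The (5,6) entry needs none: its antiderivative involves `cos E` alone.
  · linear_combination (-5/2 + 22/3*e*c - 181/8*e^2 - 4*e^2*s^2 - 45/4*e^2*c^2 + 12*e^3*s*E +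
      164/5*e^3*c + 8*e^3*c*s^2 + 51/5*e^3*c^3 - 251/8*e^4 - 9/2*e^4*E^2 - 8*e^4*s^2 -
      18*e^4*c*s*E - 101/4*e^4*c^2 - 5*e^4*c^2*s^2 - 5*e^4*c^4 + 12*e^5*s*E + 328/15*e^5*c +
      3*e^5*c*E^2 + 12*e^5*c*s^2 + 6*e^5*c^2*s*E + 54/5*e^5*c^3 + e^5*c^3*s^2 + e^5*c^5 -
      49/16*e^6 - 4*e^6*s^2 - 12*e^6*c*s*E - 49/8*e^6*c^2 - 4*e^6*c^2*s^2 - 2*e^6*c^4 + 8/15*e^7*c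
      + 4*e^7*c*s^2 + 4/5*e^7*c^3) / r ^ 15 * h
  · linear_combination (2*e*s + 3*e^2*E - 3*e^2*c*s - e^3*c*E + e^3*c^2*s + 3/2*e^4*E + e^4*c*s -
      2*e^5*s - e^5*c*E - e^5*c^2*s + 2*e^6*c*s) * q₆ * h
  · linear_combination (9/2*e^3*E - 2*e^4*c*E) * q₆ * h
  · linear_combination (2*c - 35/2*e - 4*e*s^2 - 7*e*c^2 + 12*e^2*s*E + 104/3*e^2*c + 8*e^2*c*s^2
      + 9*e^2*c^3 - 371/8*e^3 - 9/2*e^3*E^2 - 8*e^3*s^2 - 18*e^3*c*s*E - 125/4*e^3*c^2 -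
      5*e^3*c^2*s^2 - 5*e^3*c^4 + 12*e^4*s*E + 502/15*e^4*c + 3*e^4*c*E^2 + 12*e^4*c*s^2 +
      6*e^4*c^2*s*E + 66/5*e^4*c^3 + e^4*c^3*s^2 + e^4*c^5 + 25/16*e^5 - 4*e^5*s^2 - 12*e^5*c*s*E
      - 55/8*e^5*c^2 - 4*e^5*c^2*s^2 - 2*e^5*c^4 - 104/15*e^6*c + 4*e^6*c*s^2 - 2/5*e^6*c^3 +
      11/4*e^7 + 5/2*e^7*c^2 - 2/3*e^8*c) / r ^ 15 * h
  · linear_combination (-5/2 + 17/3*e*c - 51/8*e^2 - 15/4*e^2*c^2 + 11/5*e^3*c + 4/5*e^3*c^3 +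
      3/2*e^4 - 1/3*e^5*c + 1/2*e^6 - 1/3*e^7*c) / r ^ 11 * h
  · linear_combination (-7/2*e + 6*e^2*c - 39/8*e^3 - 15/4*e^3*c^2 + 28/15*e^4*c + 4/5*e^4*c^3 +
      3/2*e^5 - 2/3*e^6*c) / r ^ 11 * h
  · linear_combination (2*s + 3*e*E - 3*e*c*s - e^2*c*E + e^2*c^2*s + 3/2*e^3*E + e^3*c*s -
      2*e^4*s - e^4*c*E - e^4*c^2*s + 2*e^5*c*s) * q₆ * h
  · linear_combination (-5*e^2 + 20/3*e^3*c - 15/8*e^4 - 15/4*e^4*c^2 + 8/15*e^5*c + 4/5*e^5*c^3)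
      / r ^ 11 * h
  · linear_combination (9/2*e^2*E - 2*e^3*c*E) * q₆ * h
  · linear_combination (-4 - 4*s^2 - 4*c^2 + 12*e*s*E + 24*e*c + 8*e*c*s^2 + 8*e*c^3 - 283/4*e^2 -
      9/2*e^2*E^2 - 8*e^2*s^2 - 18*e^2*c*s*E - 33*e^2*c^2 - 5*e^2*c^2*s^2 - 5*e^2*c^4 + 12*e^3*s*E
      + 63*e^3*c + 3*e^3*c*E^2 + 12*e^3*c*s^2 + 6*e^3*c^2*s*E + 15*e^3*c^3 + e^3*c^3*s^2 + e^3*c^5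
      + 145/16*e^4 - 4*e^4*s^2 - 12*e^4*c*s*E - 103/8*e^4*c^2 - 4*e^4*c^2*s^2 - 2*e^4*c^4 -
      79/3*e^5*c + 4*e^5*c*s^2 - e^5*c^3 + 55/8*e^6 + 31/4*e^6*c^2 + 11/5*e^7*c - 1/5*e^7*c^3 -
      3/4*e^8 - 1/2*e^8*c^2 - 1/3*e^9*c) / r ^ 15 * h
  · linear_combination (-1/2 + e*c - 3/8*e^2 - 3/4*e^2*c^2 + 2/15*e^3*c + 1/5*e^3*c^3) / r ^ 9 * h
  · ring
  · linear_combination (-1/2 + 2*e*c - 33/8*e^2 - 9/4*e^2*c^2 + 68/15*e^3*c + 4/5*e^3*c^3 -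
      9/4*e^4 - 3/2*e^4*c^2 + 2/3*e^5*c) / r ^ 11 * h

theorem hasDerivAt_ellJ (e E : ℝ) (i j : Fin 6) :
    HasDerivAt (fun x => ellJ e x i j) (ellK e E i j) E := by
  obtain ⟨h₁₁, h₁₂, h₁₃, h₁₄, h₂₂, h₂₃, h₂₄, h₃₃, h₃₄, h₄₄, h₅₅, h₅₆,
      h₆₆⟩ := hasDerivAt_ellJ_entries e E
  fin_cases i <;> fin_cases j <;> first | exact hasDerivAt_const _ _ | assumption

/-! ### The integrand in the hyperbolic anomaly -/

/-- `e cosh H - 1 = r (e² - 1) / p`. -/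
def hypW (e H : ℝ) : ℝ := e * cosh H - 1

/-- `√(e² - 1)³ (D - 3 e L)` in the hyperbolic anomaly. -/
def hypX (e H : ℝ) : ℝ := sinh H * (e * cosh H - 2 - 2 * e ^ 2) + 3 * e * H

/-- A multiple of `S₃ / ρ²` in the hyperbolic anomaly. -/
def hypY (e H : ℝ) : ℝ := e * sinh H * (e * cosh H + e ^ 2 - 5) + 3 * H

/-- A multiple of `φ₂ / ρ²` in the hyperbolic anomaly. -/
def hypA (e H : ℝ) : ℝ := (e - cosh H) * hypW e H ^ 2 + e * sinh H * hypX e H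

/-- A multiple of `S₁ / ρ²` in the hyperbolic anomaly. -/
def hypB (e H : ℝ) : ℝ := (e - cosh H) * (e * cosh H + e ^ 2 - 2)

/-- A multiple of `φ₃ / ρ²` in the hyperbolic anomaly. -/
def hypC (e H : ℝ) : ℝ := sinh H * hypX e H - (e - cosh H) ^ 2 * (e * cosh H + e ^ 2 - 2)

/-- The entries of the integrand as polynomials in the anomaly and its hyperbolic functions. -/
def hypK (e H : ℝ) : Mat6 :=
  let k₁₁ := hypW e H * (hypA e H ^ 2 + (e ^ 2 - 1) * hypX e H ^ 2) / √(e ^ 2 - 1) ^ 15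
  let k₁₂ := hypW e H * ((e ^ 2 - 1) * (hypA e H * sinh H) + hypX e H * hypB e H) / (e ^ 2 - 1) ^ 6
  let k₁₃ := hypW e H * (-(hypX e H * hypW e H ^ 2)) / (e ^ 2 - 1) ^ 6
  let k₁₄ := hypW e H * (hypA e H * hypC e H +
      (e ^ 2 - 1) * (hypX e H * hypY e H)) / √(e ^ 2 - 1) ^ 15
  let k₂₂ := hypW e H * ((e ^ 2 - 1) ^ 3 * sinh H ^ 2 + hypB e H ^ 2) / √(e ^ 2 - 1) ^ 11
  let k₂₃ := hypW e H * (-(hypB e H * hypW e H ^ 2)) / √(e ^ 2 - 1) ^ 11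
  let k₂₄ := hypW e H * ((e ^ 2 - 1) * (sinh H * hypC e H) + hypB e H * hypY e H) / (e ^ 2 - 1) ^ 6
  let k₃₃ := hypW e H * hypW e H ^ 4 / √(e ^ 2 - 1) ^ 11
  let k₃₄ := hypW e H * (-(hypW e H ^ 2 * hypY e H)) / (e ^ 2 - 1) ^ 6
  let k₄₄ := hypW e H * (hypC e H ^ 2 + (e ^ 2 - 1) * hypY e H ^ 2) / √(e ^ 2 - 1) ^ 15
  let k₅₅ := hypW e H * (sinh H * hypW e H) ^ 2 / √(e ^ 2 - 1) ^ 9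
  let k₅₆ := hypW e H * (-(sinh H * hypW e H * ((e - cosh H) * hypW e H))) / (e ^ 2 - 1) ^ 5
  let k₆₆ := hypW e H * ((e - cosh H) * hypW e H) ^ 2 / √(e ^ 2 - 1) ^ 11
  !![k₁₁, k₁₂, k₁₃, k₁₄, 0, 0;
     k₁₂, k₂₂, k₂₃, k₂₄, 0, 0;
     k₁₃, k₂₃, k₃₃, k₃₄, 0, 0;
     k₁₄, k₂₄, k₃₄, k₄₄, 0, 0;
     0, 0, 0, 0, k₅₅, k₅₆;
     0, 0, 0, 0, k₅₆, k₆₆]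

/-- The counterpart of `hasDerivAt_ellJ_entries` under the formal substitution `E = iH`: `cosh² -
sinh² = 1` replaces the trigonometric relation, and the root is again a free variable. -/
theorem hasDerivAt_hypJ_entries (e H : ℝ) :
    HasDerivAt (hypJ11 e) (hypK e H 0 0) H ∧
    HasDerivAt (hypJ12 e) (hypK e H 0 1) H ∧
    HasDerivAt (hypJ13 e) (hypK e H 0 2) H ∧
    HasDerivAt (hypJ14 e) (hypK e H 0 3) H ∧
    HasDerivAt (hypJ22 e) (hypK e H 1 1) H ∧
    HasDerivAt (hypJ23 e) (hypK e H 1 2) H ∧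
    HasDerivAt (hypJ24 e) (hypK e H 1 3) H ∧
    HasDerivAt (hypJ33 e) (hypK e H 2 2) H ∧
    HasDerivAt (hypJ34 e) (hypK e H 2 3) H ∧
    HasDerivAt (hypJ44 e) (hypK e H 3 3) H ∧
    HasDerivAt (hypJ55 e) (hypK e H 4 4) H ∧
    HasDerivAt (hypJ56 e) (hypK e H 4 5) H ∧
    HasDerivAt (hypJ66 e) (hypK e H 5 5) H := by
  have h := cosh_sq_sub_sinh_sq H
  unfold hypJ11 hypJ12 hypJ13 hypJ14 hypJ22 hypJ23 hypJ24 hypJ33 hypJ34 hypJ44 hypJ55 hypJ56 hypJ66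
  refine ⟨?_, ?_, ?_, ?_, ?_, ?_, ?_, ?_, ?_, ?_, ?_, ?_,
      ?_⟩ <;> apply HasDerivAt.congr_deriv <;> try
    repeat' with_reducible first
      | exact hasDerivAt_const _ _
      | exact hasDerivAt_id' _
      | exact hasDerivAt_sinh _
      | exact hasDerivAt_cosh _
      | apply HasDerivAt.const_mul
      | apply HasDerivAt.div_const
      | apply HasDerivAt.fun_add
      | apply HasDerivAt.fun_sub
      | apply HasDerivAt.fun_neg
      | apply HasDerivAt.fun_pow
      | apply HasDerivAt.fun_mul
  all_goals
    simp only [hypK, hypW, hypX, hypY, hypA, hypB, hypC, Matrix.of_apply, Matrix.cons_val]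
    generalize √(e ^ 2 - 1) = r at *
    generalize sinh H = s at *
    generalize cosh H = c at *
    push_cast
    simp only [div_eq_mul_inv, mul_inv]
    generalize ((e ^ 2 - 1) ^ 6)⁻¹ = q₆
    generalize ((e ^ 2 - 1) ^ 5)⁻¹ = q₅
  · linear_combination (5/2 - 22/3*e*c + 181/8*e^2 - 4*e^2*s^2 + 45/4*e^2*c^2 + 12*e^3*s*H -
      164/5*e^3*c + 8*e^3*c*s^2 - 51/5*e^3*c^3 + 251/8*e^4 - 9/2*e^4*H^2 - 8*e^4*s^2 -
      18*e^4*c*s*H + 101/4*e^4*c^2 - 5*e^4*c^2*s^2 + 5*e^4*c^4 + 12*e^5*s*H - 328/15*e^5*c +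
      3*e^5*c*H^2 + 12*e^5*c*s^2 + 6*e^5*c^2*s*H - 54/5*e^5*c^3 + e^5*c^3*s^2 - e^5*c^5 +
      49/16*e^6 - 4*e^6*s^2 - 12*e^6*c*s*H + 49/8*e^6*c^2 - 4*e^6*c^2*s^2 + 2*e^6*c^4 - 8/15*e^7*c
      + 4*e^7*c*s^2 - 4/5*e^7*c^3) / r ^ 15 * h
  · linear_combination (-2*e*s - 3*e^2*H + 3*e^2*c*s + e^3*c*H - e^3*c^2*s - 3/2*e^4*H - e^4*c*s +
      2*e^5*s + e^5*c*H + e^5*c^2*s - 2*e^6*c*s) * q₆ * h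
  · linear_combination (-9/2*e^3*H + 2*e^4*c*H) * q₆ * h
  · linear_combination (-2*c + 35/2*e - 4*e*s^2 + 7*e*c^2 + 12*e^2*s*H - 104/3*e^2*c + 8*e^2*c*s^2
      - 9*e^2*c^3 + 371/8*e^3 - 9/2*e^3*H^2 - 8*e^3*s^2 - 18*e^3*c*s*H + 125/4*e^3*c^2 -
      5*e^3*c^2*s^2 + 5*e^3*c^4 + 12*e^4*s*H - 502/15*e^4*c + 3*e^4*c*H^2 + 12*e^4*c*s^2 +
      6*e^4*c^2*s*H - 66/5*e^4*c^3 + e^4*c^3*s^2 - e^4*c^5 - 25/16*e^5 - 4*e^5*s^2 - 12*e^5*c*s*H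
      + 55/8*e^5*c^2 - 4*e^5*c^2*s^2 + 2*e^5*c^4 + 104/15*e^6*c + 4*e^6*c*s^2 + 2/5*e^6*c^3 -
      11/4*e^7 - 5/2*e^7*c^2 + 2/3*e^8*c) / r ^ 15 * h
  · linear_combination (5/2 - 17/3*e*c + 51/8*e^2 + 15/4*e^2*c^2 - 11/5*e^3*c - 4/5*e^3*c^3 -
      3/2*e^4 + 1/3*e^5*c - 1/2*e^6 + 1/3*e^7*c) / r ^ 11 * h
  · linear_combination (7/2*e - 6*e^2*c + 39/8*e^3 + 15/4*e^3*c^2 - 28/15*e^4*c - 4/5*e^4*c^3 -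
      3/2*e^5 + 2/3*e^6*c) / r ^ 11 * h
  · linear_combination (-2*s - 3*e*H + 3*e*c*s + e^2*c*H - e^2*c^2*s - 3/2*e^3*H - e^3*c*s +
      2*e^4*s + e^4*c*H + e^4*c^2*s - 2*e^5*c*s) * q₆ * h
  · linear_combination (5*e^2 - 20/3*e^3*c + 15/8*e^4 + 15/4*e^4*c^2 - 8/15*e^5*c - 4/5*e^5*c^3) /
      r ^ 11 * h
  · linear_combination (-9/2*e^2*H + 2*e^3*c*H) * q₆ * h
  · linear_combination (4 - 4*s^2 + 4*c^2 + 12*e*s*H - 24*e*c + 8*e*c*s^2 - 8*e*c^3 + 283/4*e^2 -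
      9/2*e^2*H^2 - 8*e^2*s^2 - 18*e^2*c*s*H + 33*e^2*c^2 - 5*e^2*c^2*s^2 + 5*e^2*c^4 + 12*e^3*s*H
      - 63*e^3*c + 3*e^3*c*H^2 + 12*e^3*c*s^2 + 6*e^3*c^2*s*H - 15*e^3*c^3 + e^3*c^3*s^2 - e^3*c^5
      - 145/16*e^4 - 4*e^4*s^2 - 12*e^4*c*s*H + 103/8*e^4*c^2 - 4*e^4*c^2*s^2 + 2*e^4*c^4 +
      79/3*e^5*c + 4*e^5*c*s^2 + e^5*c^3 - 55/8*e^6 - 31/4*e^6*c^2 - 11/5*e^7*c + 1/5*e^7*c^3 +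
      3/4*e^8 + 1/2*e^8*c^2 + 1/3*e^9*c) / r ^ 15 * h
  · linear_combination (-1/2 + e*c - 3/8*e^2 - 3/4*e^2*c^2 + 2/15*e^3*c + 1/5*e^3*c^3) / r ^ 9 * h
  · ring
  · linear_combination (1/2 - 2*e*c + 33/8*e^2 + 9/4*e^2*c^2 - 68/15*e^3*c - 4/5*e^3*c^3 + 9/4*e^4
      + 3/2*e^4*c^2 - 2/3*e^5*c) / r ^ 11 * h

theorem hasDerivAt_hypJ (e H : ℝ) (i j : Fin 6) :
    HasDerivAt (fun x => hypJ e x i j) (hypK e H i j) H := by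
  obtain ⟨h₁₁, h₁₂, h₁₃, h₁₄, h₂₂, h₂₃, h₂₄, h₃₃, h₃₄, h₄₄, h₅₅, h₅₆,
      h₆₆⟩ := hasDerivAt_hypJ_entries e H
  fin_cases i <;> fin_cases j <;> first | exact hasDerivAt_const _ _ | assumption

/-! ### The fundamental matrix at one point of the orbit -/

/-- The relations that make `d.invMat` the inverse of `d.mat`. -/
structure FundData.IsFundamental (d : FundData) : Prop where
  sq_add_sq : d.s ^ 2 + d.c ^ 2 = 1
  wronskian : d.φ₁ * d.dφ₂ - d.φ₂ * d.dφ₁ = 1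
  φ₃_eq : d.φ₃ = 2 * (d.φ₁ * d.S₂ - d.φ₂ * d.S₁)
  dφ₃_eq : d.dφ₃ = 2 * (d.dφ₁ * d.S₂ - d.dφ₂ * d.S₁)

/-- The out-of-plane block is a rotation. In the other entries, once `φ₃` and `dφ₃` are expressed
through the rest, what remains is an identity or a multiple of the Wronskian relation. -/
theorem FundData.IsFundamental.mat_mul_invMat {d : FundData} (hd : d.IsFundamental) :
    d.mat * d.invMat = 1 := by
  obtain ⟨h, hW, h₃, h₃'⟩ := hd
  ext i j
  fin_cases i <;> fin_cases j <;>
    simp [FundData.mat, FundData.invMat, Matrix.mul_apply, Fin.sum_univ_six, h₃, h₃'] <;>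
    first
      | ring1
      | linear_combination (exp := 1) hW
      | linear_combination (exp := 1) h
      | linear_combination (exp := 1) -2 * hW

theorem FundData.IsFundamental.isUnit_det {d : FundData} (hd : d.IsFundamental) :
    IsUnit d.mat.det :=
  Matrix.isUnit_det_of_right_inverse hd.mat_mul_invMat

theorem FundData.IsFundamental.inv_mat {d : FundData} (hd : d.IsFundamental) :
    d.mat⁻¹ = d.invMat :=
  Matrix.inv_eq_right_inv hd.mat_mul_invMat

/-- The weight kills the first three columns of the inverse. The surviving ones contain no `dφᵢ`, so
later changes of variable need only the `φᵢ`, the `Sᵢ`, `s` and `c`. -/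
theorem FundData.IsFundamental.kernelOf_apply {d : FundData} (hd : d.IsFundamental) (e : ℝ)
    (i j : Fin 6) : kernelOf e d i j =
      (d.invMat i 3 * d.invMat j 3 + d.invMat i 4 * d.invMat j 4 +
        d.invMat i 5 * d.invMat j 5) / (1 + e * d.c) ^ 6 := by
  simp only [kernelOf, hd.inv_mat, Matrix.mul_apply, Fin.sum_univ_six, Matrix.transpose_apply,
    Matrix.diagonal_apply, Fin.reduceEq, if_true, if_false, Matrix.cons_val]
  ring

/-- The data in a form common to all eccentricities: `U` is an antiderivative of `cos f / ρ³`. -/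
def fundOf (e s c U S₃ : ℝ) : FundData :=
  let ρ := 1 + e * c
  let φ₁ := ρ * s
  let dφ₁ := ρ * c - e * s ^ 2
  let S₁ := -c - 1 / 2 * e * c ^ 2
  let S₂ := -(ρ ^ 2 * U)
  let dφ₂ := 2 * e * dφ₁ * U + e * s * c / ρ ^ 2 + s / ρ
  ⟨s, c, φ₁, 2 * e * φ₁ * U - c / ρ, -2 * φ₁ * U - c ^ 2 / ρ - c ^ 2, dφ₁, dφ₂,
    2 * (dφ₁ * S₂ - dφ₂ * S₁), S₁, S₂, S₃⟩

/-- The terms in `U` cancel in the Wronskian, and `ρ² + 2 e S₁ = 1` matches those in `φ₃`. Hence `U`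
and `S₃` are arbitrary here. -/
theorem fundOf_isFundamental {e s c : ℝ} (U S₃ : ℝ) (h : s ^ 2 + c ^ 2 = 1)
    (hρ : 1 + e * c ≠ 0) : (fundOf e s c U S₃).IsFundamental where
  sq_add_sq := h
  wronskian := by
    simp only [fundOf]
    field_simp
    linear_combination (1 + e * c) * h
  φ₃_eq := by
    simp only [fundOf]
    field_simp
    ring
  dφ₃_eq := rfl

theorem fundData_eq_fundOf {e : ℝ} (s c L : ℝ) (he : 1 - e ^ 2 ≠ 0) :
    fundData e s c L = fundOf e s c ((s * (2 + e * c) / (1 + e * c) ^ 2 - 3 * e * L) /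
        (2 * (1 - e ^ 2)))
      (e * s * (2 + e * c) / (1 - e ^ 2) - 3 * (1 + e * c) ^ 2 * L / (1 - e ^ 2)) := by
  have h₂' : ∀ x D : ℝ, e * x / (1 - e ^ 2) * D = 2 * e * x * (D / (2 * (1 - e ^ 2))) :=
    fun x D => by field_simp
  have h₃ : ∀ x D : ℝ, -x / (1 - e ^ 2) * D = -2 * x * (D / (2 * (1 - e ^ 2))) :=
    fun x D => by field_simp
  have hS : ∀ x D : ℝ, -(x * D) / (2 * (1 - e ^ 2)) = -(x * (D / (2 * (1 - e ^ 2)))) :=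
    fun x D => by field_simp
  simp only [fundData, fundOf, h₂', h₃, hS]

theorem fundData_isFundamental {e s c : ℝ} (L : ℝ) (he : 1 - e ^ 2 ≠ 0)
    (h : s ^ 2 + c ^ 2 = 1) (hρ : 1 + e * c ≠ 0) : (fundData e s c L).IsFundamental := by
  rw [fundData_eq_fundOf s c L he]
  exact fundOf_isFundamental _ _ h hρ

/-! ### The range of true anomalies -/

theorem rho_pos {e f : ℝ} (he : 0 ≤ e) (hf : f ∈ anomalyRange e) : 0 < rho e f := by
  rcases hf with h | h
  · unfold rho
    nlinarith [neg_one_le_cos f]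
  · exact h.2

theorem continuous_rho (e : ℝ) : Continuous (rho e) := by
  unfold rho
  fun_prop

theorem isOpen_anomalyRange (e : ℝ) : IsOpen (anomalyRange e) := by
  by_cases he : e < 1
  · simp [anomalyRange, he]
  · simp only [anomalyRange, he, false_or]
    exact (isOpen_lt continuous_abs continuous_const).inter
      (isOpen_lt continuous_const (continuous_rho e))

theorem zero_mem_anomalyRange {e : ℝ} (he : 0 ≤ e) : (0 : ℝ) ∈ anomalyRange e := by
  right
  simp only [abs_zero, rho, cos_zero]
  exact ⟨pi_pos, by linarith⟩

theorem rho_le_rho {e x y : ℝ} (he : 0 ≤ e) (hxy : |x| ≤ |y|) (hy : |y| ≤ π) :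
    rho e y ≤ rho e x := by
  have h := cos_le_cos_of_nonneg_of_le_pi (abs_nonneg x) hy hxy
  rw [cos_abs, cos_abs] at h
  unfold rho
  nlinarith

/-- On `|f| ≤ π` the function `ρ` decreases in `|f|`, so for `e ≥ 1` a point between two points of
the range inherits both conditions from the endpoint of larger modulus. Integrals between points of
the range therefore stay away from the zeros of `ρ`. -/
theorem ordConnected_anomalyRange {e : ℝ} (he : 0 ≤ e) : (anomalyRange e).OrdConnected := by
  refine ⟨fun x hx y hy z hz => ?_⟩
  by_cases h1 : e < 1
  · exact Or.inl h1
  · have hx := hx.resolve_left h1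
    have hy := hy.resolve_left h1
    rcases le_max_iff.1 (abs_le_max_abs_abs hz.1 hz.2) with h | h
    · exact Or.inr ⟨h.trans_lt hx.1, hx.2.trans_le (rho_le_rho he h hx.1.le)⟩
    · exact Or.inr ⟨h.trans_lt hy.1, hy.2.trans_le (rho_le_rho he h hy.1.le)⟩

theorem uIcc_subset_anomalyRange {e a b : ℝ} (he : 0 ≤ e) (ha : a ∈ anomalyRange e)
    (hb : b ∈ anomalyRange e) : Set.uIcc a b ⊆ anomalyRange e :=
  (ordConnected_anomalyRange he).uIcc_subset ha hb

theorem continuousOn_inv_rho_sq {e : ℝ} (he : 0 ≤ e) :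
    ContinuousOn (fun θ => 1 / rho e θ ^ 2) (anomalyRange e) :=
  continuousOn_const.div ((continuous_rho e).pow 2).continuousOn
    fun _ h => pow_ne_zero 2 (rho_pos he h).ne'

theorem intervalIntegrable_inv_rho_sq {e a b : ℝ} (he : 0 ≤ e) (ha : a ∈ anomalyRange e)
    (hb : b ∈ anomalyRange e) :
    IntervalIntegrable (fun θ => 1 / rho e θ ^ 2) MeasureTheory.volume a b :=
  ((continuousOn_inv_rho_sq he).mono (uIcc_subset_anomalyRange he ha hb)).intervalIntegrable

theorem hasDerivAt_meanL {e f : ℝ} (he : 0 ≤ e) (hf : f ∈ anomalyRange e) :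
    HasDerivAt (meanL e) (1 / rho e f ^ 2) f := by
  have hn := (isOpen_anomalyRange e).mem_nhds hf
  exact intervalIntegral.integral_hasDerivAt_right
    (intervalIntegrable_inv_rho_sq he (zero_mem_anomalyRange he) hf)
    ((continuousOn_inv_rho_sq he).stronglyMeasurableAtFilter (isOpen_anomalyRange e) f hf)
    ((continuousOn_inv_rho_sq he).continuousAt hn)

theorem hasDerivAt_rho (e f : ℝ) : HasDerivAt (rho e) (-(e * sin f)) f :=
  (((hasDerivAt_cos f).const_mul e).const_add 1).congr_deriv (by ring)

/-! ### Half-angle formulas -/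

theorem cos_half_ne_zero {f : ℝ} (h : 1 + cos f ≠ 0) : cos (f / 2) ≠ 0 := by
  intro h0
  have := cos_sq (f / 2)
  rw [h0, mul_div_cancel₀ f (two_ne_zero)] at this
  exact h (by linarith)

theorem cos_eq_tan_half {f : ℝ} (h : 1 + cos f ≠ 0) :
    cos f = (1 - tan (f / 2) ^ 2) / (1 + tan (f / 2) ^ 2) := by
  have h0 := cos_half_ne_zero h
  have h1 := sin_sq_add_cos_sq (f / 2)
  have h2 : cos f = 2 * cos (f / 2) ^ 2 - 1 := by
    rw [← cos_two_mul, mul_div_cancel₀ f (two_ne_zero)]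
  rw [tan_eq_sin_div_cos, h2]
  field_simp
  rw [add_comm (cos (f / 2) ^ 2), h1]
  linarith

theorem sin_eq_tan_half {f : ℝ} (h : 1 + cos f ≠ 0) :
    sin f = 2 * tan (f / 2) / (1 + tan (f / 2) ^ 2) := by
  have h0 := cos_half_ne_zero h
  have h1 := sin_sq_add_cos_sq (f / 2)
  have h2 : sin f = 2 * sin (f / 2) * cos (f / 2) := by
    rw [← sin_two_mul, mul_div_cancel₀ f (two_ne_zero)]
  rw [tan_eq_sin_div_cos, h2]
  field_simp
  rw [add_comm (cos (f / 2) ^ 2), h1, mul_one]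

theorem hasDerivAt_tan_half {f : ℝ} (h : 1 + cos f ≠ 0) :
    HasDerivAt (fun x => tan (x / 2)) ((1 + tan (f / 2) ^ 2) / 2) f := by
  have h0 := cos_half_ne_zero h
  refine ((hasDerivAt_tan h0).comp f ((hasDerivAt_id f).div_const 2)).congr_deriv ?_
  rw [tan_eq_sin_div_cos]
  have h1 := sin_sq_add_cos_sq (f / 2)
  field_simp
  linarith

/-! ### The fundamental matrix along the orbit -/

/-- An antiderivative of `cos f / ρ³`. -/
def auxU (e f : ℝ) : ℝ :=
  if e = 1 then 1 / 4 * tan (f / 2) - 1 / 20 * tan (f / 2) ^ 5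
  else (sin f * (2 + e * cos f) / rho e f ^ 2 - 3 * e * meanL e f) / (2 * (1 - e ^ 2))

/-- The entry `S₃`. -/
def auxS₃ (e f : ℝ) : ℝ :=
  if e = 1 then 2 * (rho 1 f ^ 2 * auxU 1 f - sin f) - sin f * cos f
  else e * sin f * (2 + e * cos f) / (1 - e ^ 2) - 3 * rho e f ^ 2 * meanL e f / (1 - e ^ 2)

theorem one_sub_sq_ne_zero {e : ℝ} (he : 0 ≤ e) (h1 : e ≠ 1) : 1 - e ^ 2 ≠ 0 := by
  intro h
  have h2 : (e - 1) * (e + 1) = 0 := by linarith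
  rcases mul_eq_zero.1 h2 with h | h
  · exact h1 (by linarith)
  · linarith

theorem fundAt_eq_fundOf {e : ℝ} (he : 0 ≤ e) (f : ℝ) :
    fundAt e f = fundOf e (sin f) (cos f) (auxU e f) (auxS₃ e f) := by
  by_cases h1 : e = 1
  · subst h1
    simp [fundAt, fundDataPar, fundOf, auxU, auxS₃, rho]
  · simp only [fundAt, h1, if_false, auxU, auxS₃, rho]
    exact fundData_eq_fundOf _ _ _ (one_sub_sq_ne_zero he h1)

theorem fundAt_isFundamental {e f : ℝ} (he : 0 ≤ e) (hf : f ∈ anomalyRange e) :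
    (fundAt e f).IsFundamental := by
  rw [fundAt_eq_fundOf he]
  exact fundOf_isFundamental _ _ (sin_sq_add_cos_sq f) (rho_pos he hf).ne'

/-- For `e ≠ 1` this is the identity `D' - 3e/ρ² = 2(1 - e²) cos f / ρ³`. For `e = 1`, with `t = tan
(f/2)`, both sides equal `(1 - t²)(1 + t²)² / 8`. -/
theorem hasDerivAt_auxU {e f : ℝ} (he : 0 ≤ e) (hf : f ∈ anomalyRange e) :
    HasDerivAt (auxU e) (cos f / rho e f ^ 3) f := by
  have hρ := (rho_pos he hf).ne'
  by_cases h1 : e = 1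
  · subst h1
    have hρ' : 1 + cos f ≠ 0 := by simpa [rho] using hρ
    have ht := hasDerivAt_tan_half hρ'
    have := (ht.const_mul (1 / 4)).sub ((ht.fun_pow 5).const_mul (1 / 20))
    have hU : auxU 1 = fun f => 1 / 4 * tan (f / 2) - 1 / 20 * tan (f / 2) ^ 5 := by
      funext x
      simp [auxU]
    rw [hU]
    refine HasDerivAt.congr_deriv this ?_
    rw [rho, cos_eq_tan_half hρ']
    have : 1 + tan (f / 2) ^ 2 ≠ 0 := by positivity
    field_simp
    ring
  · have h2 := one_sub_sq_ne_zero he h1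
    have hD := ((hasDerivAt_sin f).mul (((hasDerivAt_cos f).const_mul e).const_add 2)).div
      ((hasDerivAt_rho e f).fun_pow 2) (pow_ne_zero 2 hρ)
    have := (hD.sub ((hasDerivAt_meanL he hf).const_mul (3 * e))).div_const (2 * (1 - e ^ 2))
    have hU : auxU e = fun f => (sin f * (2 + e * cos f) / rho e f ^ 2 - 3 * e * meanL e f) /
        (2 * (1 - e ^ 2)) := by
      funext x
      simp [auxU, h1]
    rw [hU]
    refine HasDerivAt.congr_deriv this ?_
    have h := sin_sq_add_cos_sq f
    unfold rho at *
    have hρ' : 1 + cos f * e ≠ 0 := by rwa [mul_comm]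
    simp only [Pi.mul_apply]
    field_simp
    linear_combination e * (3 + e * cos f) * (1 + e * cos f) * h

theorem hasDerivAt_auxS₃ {e f : ℝ} (he : 0 ≤ e) (hf : f ∈ anomalyRange e) :
    HasDerivAt (auxS₃ e) (2 * (fundAt e f).φ₃ + 1) f := by
  have hρ := (rho_pos he hf).ne'
  have h := sin_sq_add_cos_sq f
  rw [fundAt_eq_fundOf he]
  have hr := (hasDerivAt_rho e f).fun_pow 2
  have hs := hasDerivAt_sin f
  have hc := hasDerivAt_cos f
  by_cases h1 : e = 1
  · subst h1
    have hS : auxS₃ 1 = fun f => 2 * (rho 1 f ^ 2 * auxU 1 f - sin f) - sin f * cos f := by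
      funext x
      simp [auxS₃]
    rw [hS]
    refine ((((hr.fun_mul (hasDerivAt_auxU he hf)).fun_sub hs).const_mul 2).fun_sub
      (hs.fun_mul hc)).congr_deriv ?_
    simp only [fundOf]
    generalize auxU 1 f = U
    unfold rho at *
    have hρ' : 1 + cos f ≠ 0 := by simpa using hρ
    field_simp
    linear_combination (1 + cos f) * h
  · have h2 := one_sub_sq_ne_zero he h1
    have hS : auxS₃ e = fun f => e * sin f * (2 + e * cos f) / (1 - e ^ 2) -
        3 * rho e f ^ 2 * meanL e f / (1 - e ^ 2) := by
      funext x
      simp [auxS₃, h1]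
    rw [hS]
    refine ((((hs.const_mul e).fun_mul ((hc.const_mul e).const_add 2)).div_const (1 -
        e ^ 2)).fun_sub
      (((hr.const_mul 3).fun_mul (hasDerivAt_meanL he hf)).div_const (1 - e ^ 2))).congr_deriv ?_
    simp only [fundOf, auxU, h1, if_false]
    generalize meanL e f = L
    unfold rho at *
    have hρ' : 1 + cos f * e ≠ 0 := by rwa [mul_comm]
    field_simp
    linear_combination (4 + 2 * e * cos f - e ^ 2 - e ^ 3 * cos f) * h

/-- The derivatives of the data along the orbit. -/
theorem hasDerivAt_fundAt {e f : ℝ} (he : 0 ≤ e) (hf : f ∈ anomalyRange e) :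
    HasDerivAt (fun x => (fundAt e x).φ₁) (fundAt e f).dφ₁ f ∧
    HasDerivAt (fun x => (fundAt e x).φ₂) (fundAt e f).dφ₂ f ∧
    HasDerivAt (fun x => (fundAt e x).φ₃) (fundAt e f).dφ₃ f ∧
    HasDerivAt (fun x => (fundAt e x).dφ₁) ((3 / rho e f - 4) * (fundAt e f).φ₁) f ∧
    HasDerivAt (fun x => (fundAt e x).dφ₂) ((3 / rho e f - 4) * (fundAt e f).φ₂) f ∧
    HasDerivAt (fun x => (fundAt e x).dφ₃) ((3 / rho e f - 4) * (fundAt e f).φ₃ - 2) f ∧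
    HasDerivAt (fun x => (fundAt e x).S₁) (fundAt e f).φ₁ f ∧
    HasDerivAt (fun x => (fundAt e x).S₂) (fundAt e f).φ₂ f ∧
    HasDerivAt (fun x => (fundAt e x).S₃) (2 * (fundAt e f).φ₃ + 1) f := by
  have hρ := (rho_pos he hf).ne'
  have hS₃ := hasDerivAt_auxS₃ he hf
  have hU := hasDerivAt_auxU he hf
  have hr := hasDerivAt_rho e f
  have hs := hasDerivAt_sin f
  have hc := hasDerivAt_cos f
  have hd := fundAt_isFundamental he hf
  have hρ' : 1 + cos f * e ≠ 0 := by rwa [mul_comm]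
  have H₁ : HasDerivAt (fun x => (fundAt e x).φ₁) (fundAt e f).dφ₁ f := by
    simp only [fundAt_eq_fundOf he, fundOf]
    refine (hr.fun_mul hs).congr_deriv ?_
    unfold rho
    ring
  have H₁' : HasDerivAt (fun x => (fundAt e x).dφ₁) ((3 / rho e f - 4) * (fundAt e f).φ₁) f := by
    simp only [fundAt_eq_fundOf he, fundOf]
    refine ((hr.fun_mul hc).fun_sub ((hs.fun_pow 2).const_mul e)).congr_deriv ?_
    unfold rho at *
    field_simp
    ring
  have HS₁ : HasDerivAt (fun x => (fundAt e x).S₁) (fundAt e f).φ₁ f := by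
    simp only [fundAt_eq_fundOf he, fundOf]
    refine (hc.fun_neg.fun_sub ((hc.fun_pow 2).const_mul (1 / 2 * e))).congr_deriv ?_
    ring
  have HS₂ : HasDerivAt (fun x => (fundAt e x).S₂) (fundAt e f).φ₂ f := by
    simp only [fundAt_eq_fundOf he, fundOf]
    refine ((hr.fun_pow 2).fun_mul hU).fun_neg.congr_deriv ?_
    generalize auxU e f = U
    unfold rho at *
    field_simp
    ring
  have H₂ : HasDerivAt (fun x => (fundAt e x).φ₂) (fundAt e f).dφ₂ f := by
    simp only [fundAt_eq_fundOf he, fundOf]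
    refine ((((hr.fun_mul hs).const_mul (2 * e)).fun_mul hU).fun_sub
      (hc.fun_div hr hρ)).congr_deriv ?_
    generalize auxU e f = U
    unfold rho at *
    field_simp
    ring
  have H₂' : HasDerivAt (fun x => (fundAt e x).dφ₂) ((3 / rho e f - 4) * (fundAt e f).φ₂) f := by
    simp only [fundAt_eq_fundOf he, fundOf]
    refine ((((((hr.fun_mul hc).fun_sub ((hs.fun_pow 2).const_mul e)).const_mul (2 * e)).fun_mul
      hU).fun_add (((hs.const_mul e).fun_mul hc).fun_div (hr.fun_pow 2)
      (pow_ne_zero 2 hρ))).fun_add (hs.fun_div hr hρ)).congr_deriv ?_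
    generalize auxU e f = U
    unfold rho at *
    field_simp
    ring
  have hev : ∀ᶠ x in nhds f, x ∈ anomalyRange e := (isOpen_anomalyRange e).mem_nhds hf
  -- Variation of parameters: in the derivative of `2(φ₁ S₂ - φ₂ S₁)` the terms with `Sᵢ' = φᵢ`
  -- cancel. The formula for `φ₃` requires `ρ ≠ 0`, hence the passage to a neighbourhood inside the
  -- range.
  have H₃ : HasDerivAt (fun x => (fundAt e x).φ₃) (fundAt e f).dφ₃ f := by
    have := ((H₁.fun_mul HS₂).fun_sub (H₂.fun_mul HS₁)).const_mul 2
    refine (this.congr_of_eventuallyEq ?_).congr_deriv ?_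
    · exact hev.mono fun x hx => (fundAt_isFundamental he hx).φ₃_eq
    · rw [hd.dφ₃_eq]
      ring
  have H₃' : HasDerivAt (fun x => (fundAt e x).dφ₃)
      ((3 / rho e f - 4) * (fundAt e f).φ₃ - 2) f := by
    have := ((H₁'.fun_mul HS₂).fun_sub (H₂'.fun_mul HS₁)).const_mul 2
    refine (this.congr_of_eventuallyEq ?_).congr_deriv ?_
    · exact hev.mono fun x hx => (fundAt_isFundamental he hx).dφ₃_eq
    · rw [hd.φ₃_eq]
      -- Here the terms with `Sᵢ' = φᵢ` do not cancel: they add up to `-2` times the Wronskian, the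
      -- inhomogeneity of the equation for `φ₃`.
      linear_combination -2 * hd.wronskian
  refine ⟨H₁, H₂, H₃, H₁', H₂', H₃', HS₁, HS₂, ?_⟩
  convert hS₃ using 2 with x
  rw [fundAt_eq_fundOf he, fundOf]

theorem fundAt_s {e : ℝ} (he : 0 ≤ e) (f : ℝ) : (fundAt e f).s = sin f := by
  rw [fundAt_eq_fundOf he, fundOf]

theorem fundAt_c {e : ℝ} (he : 0 ≤ e) (f : ℝ) : (fundAt e f).c = cos f := by
  rw [fundAt_eq_fundOf he, fundOf]

theorem hasDerivAt_phi {e f : ℝ} (he : 0 ≤ e) (hf : f ∈ anomalyRange e) (i j : Fin 6) :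
    HasDerivAt (fun x => phi e x i j) ((sysA e f * phi e f) i j) f := by
  obtain ⟨h₁, h₂, h₃, h₁', h₂', h₃', hS₁, hS₂, hS₃⟩ := hasDerivAt_fundAt he hf
  have hs : HasDerivAt (fun x => (fundAt e x).s) (fundAt e f).c f := by
    simp only [fundAt_s he, fundAt_c he]
    exact hasDerivAt_sin f
  have hc : HasDerivAt (fun x => (fundAt e x).c) (-(fundAt e f).s) f := by
    simp only [fundAt_s he, fundAt_c he]
    exact hasDerivAt_cos f
  have key : ∀ {g : ℝ → ℝ} {a b : ℝ}, HasDerivAt g a f → a = b → HasDerivAt g b f :=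
    fun h h' => h.congr_deriv h'
  -- Unification of the matrix entry with each candidate selects its derivative; equality with the
  -- entry of `A φ` remains as algebra.
  fin_cases i <;> fin_cases j <;>
    first
    | refine key (hasDerivAt_const _ _) ?_
    | refine key h₁ ?_
    | refine key h₂ ?_
    | refine key h₃ ?_
    | refine key h₁' ?_
    | refine key h₂' ?_
    | refine key h₃' ?_
    | refine key hs ?_
    | refine key hc ?_
    | refine key hs.neg ?_
    | refine key hS₃.neg ?_
    | refine key (hS₁.const_mul (-2)) ?_
    | refine key (hS₂.const_mul (-2)) ?_
    | refine key (h₁.const_mul (-2)) ?_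
    | refine key (h₂.const_mul (-2)) ?_
    | refine key ((h₃.const_mul (-2)).sub_const 1) ?_
  all_goals
    simp [sysA, phi, FundData.mat, Matrix.mul_apply, Fin.sum_univ_six]
  all_goals ring

/-! ### Identification of the substituted integrands with `ellK` and `hypK`. -/

theorem sqrt_pow_three {q : ℝ} (hq : 0 ≤ q) : √(q ^ 3) = √q ^ 3 := by
  rw [show q ^ 3 = (√q ^ 3) ^ 2 by rw [← pow_mul, mul_comm, pow_mul, sq_sqrt hq],
    sqrt_sq (by positivity)]

theorem ellW_pos {e : ℝ} (he : 0 ≤ e) (h1 : e < 1) (E : ℝ) : 0 < ellW e E := by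
  unfold ellW
  nlinarith [cos_le_one E]

/-- The data of the fundamental matrix in the eccentric anomaly. -/
theorem fundData_ofE {e r E : ℝ} (hr0 : r ≠ 0) (hr : r ^ 2 = 1 -
    e ^ 2) (hW : ellW e E ≠ 0) {d : FundData}
    (hd : d = fundData e (r * sin E / ellW e E) ((cos E - e) / ellW e E)
      ((E - e * sin E) / r ^ 3)) :
    d.φ₁ = r ^ 3 * sin E / ellW e E ^ 2 ∧
    d.φ₂ = -ellA e E / (r ^ 2 * ellW e E ^ 2) ∧
    d.φ₃ = ellC e E / (r ^ 2 * ellW e E ^ 2) ∧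
    d.S₁ = -ellB e E / (2 * ellW e E ^ 2) ∧
    d.S₂ = -ellX e E / (2 * r * ellW e E ^ 2) ∧
    d.S₃ = ellY e E / (r * ellW e E ^ 2) ∧
    1 + e * d.c = r ^ 2 / ellW e E := by
  subst hd
  have hw : ellW e E = 1 - e * cos E := rfl
  have hX : ellX e E = sin E * (2 + 2 * e ^ 2 - e * cos E) - 3 * e * E := rfl
  simp only [fundData, ellA, ellB, ellC, ellY]
  generalize ellX e E = X at *
  generalize ellW e E = w at *
  generalize sin E = s at *
  generalize cos E = c at *
  have hq : 1 - e ^ 2 = r ^ 2 := by linarith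
  have hρ : 1 + e * ((c - e) / w) = r ^ 2 / w := by
    rw [hr, hw]
    rw [hw] at hW
    field_simp
    ring
  have hρ₂ : 2 + e * ((c - e) / w) = (w + r ^ 2) / w := by
    rw [add_div, ← hρ, div_self hW]
    ring
  have hD : r * s / w * ((w + r ^ 2) / w) / (r ^ 2 / w) ^ 2 -
      3 * e * ((E - e * s) / r ^ 3) = X / r ^ 3 := by
    rw [hX]
    field_simp
    rw [hr, hw]
    ring
  rw [hq, hρ, hρ₂, hD]
  refine ⟨?_, ?_, ?_, ?_, ?_, ?_, rfl⟩
  · field_simp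
  · field_simp
    ring
  · field_simp
    rw [hr, hw]
    ring
  · field_simp
    rw [hw]
    ring
  · field_simp
  · field_simp
    rw [hr, hw]
    ring

/-- With `r = √(1 - e²)` one has `ρ = r² / W`. The Jacobian `r / W`, the weight `W⁶ / r¹²` and the
denominators `W⁴` of a product of two columns leave `W / r¹¹`, up to the further powers of `r` in
the numerators; no denominator depends on `E`. -/
theorem kernelE_eq {e : ℝ} (he : 0 ≤ e) (h1 : e < 1) (E : ℝ) : kernelE e E = ellK e E := by
  have hq0 : 0 < 1 - e ^ 2 := by nlinarith
  have hW := (ellW_pos he h1 E).ne'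
  have hr0 : √(1 - e ^ 2) ≠ 0 := (sqrt_pos.2 hq0).ne'
  have hr : √(1 - e ^ 2) ^ 2 = 1 - e ^ 2 := sq_sqrt hq0.le
  have hr3 : √((1 - e ^ 2) ^ 3) = √(1 - e ^ 2) ^ 3 := sqrt_pow_three hq0.le
  obtain ⟨d, hdd⟩ : ∃ d, fundData e (sinOfE e E) (cosOfE e E) (meanLOfE e E) = d := ⟨_, rfl⟩
  obtain ⟨h₁, h₂, h₃, hS₁, hS₂, hS₃, hρ⟩ := fundData_ofE (d := d) hr0 hr hW (by
    rw [← hdd, meanLOfE, hr3]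
    rfl)
  have hd : d.IsFundamental := by
    subst hdd
    refine fundData_isFundamental _ (by exact hq0.ne') ?_ ?_
    · have h := sin_sq_add_cos_sq E
      unfold ellW at hW
      simp only [sinOfE, cosOfE, div_pow, mul_pow, hr]
      field_simp
      linear_combination (1 - e ^ 2) * h
    · exact hρ.trans_ne (by positivity)
  have hs : d.s = √(1 - e ^ 2) * sin E / ellW e E := by rw [← hdd]; rfl
  have hc : d.c = (cos E - e) / ellW e E := by rw [← hdd]; rfl
  rw [kernelE, hdd]
  change (√(1 - e ^ 2) / ellW e E) • _ = _
  clear hdd hr3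
  ext i j
  rw [Matrix.smul_apply, hd.kernelOf_apply, hρ, smul_eq_mul]
  unfold ellK
  -- From here `1 - e²` is rewritten as `r²`, and the numerators `ellA`, `ellB`, `ellC`, `ellX`,
  -- `ellY` stay unexpanded: only powers of `r` and `W` have to match.
  generalize √(1 - e ^ 2) = r at *
  clear hd
  fin_cases i <;> fin_cases j <;>
    simp only [FundData.invMat, Matrix.of_apply, Matrix.cons_val, Fin.reduceFinMk, h₁, h₂, h₃,
      hS₁, hS₂, hS₃, ← hr, hs, hc, Fin.zero_eta, Fin.mk_one]
  all_goals generalize ellW e E = w at *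
  all_goals
    field_simp
    try ring

theorem hypW_pos {e : ℝ} (h1 : 1 < e) (H : ℝ) : 0 < hypW e H := by
  unfold hypW
  nlinarith [one_le_cosh H]

/-- The data of the fundamental matrix in the hyperbolic anomaly. -/
theorem fundData_ofH {e r H : ℝ} (hr0 : r ≠ 0) (hr : r ^ 2 = e ^ 2 -
    1) (hW : hypW e H ≠ 0) {d : FundData}
    (hd : d = fundData e (r * sinh H / hypW e H) ((e - cosh H) / hypW e H)
      ((e * sinh H - H) / r ^ 3)) :
    d.φ₁ = r ^ 3 * sinh H / hypW e H ^ 2 ∧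
    d.φ₂ = -hypA e H / (r ^ 2 * hypW e H ^ 2) ∧
    d.φ₃ = hypC e H / (r ^ 2 * hypW e H ^ 2) ∧
    d.S₁ = -hypB e H / (2 * hypW e H ^ 2) ∧
    d.S₂ = hypX e H / (2 * r * hypW e H ^ 2) ∧
    d.S₃ = -hypY e H / (r * hypW e H ^ 2) ∧
    1 + e * d.c = r ^ 2 / hypW e H := by
  subst hd
  have hw : hypW e H = e * cosh H - 1 := rfl
  have hX : hypX e H = sinh H * (e * cosh H - 2 - 2 * e ^ 2) + 3 * e * H := rfl
  simp only [fundData, hypA, hypB, hypC, hypY]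
  generalize hypX e H = X at *
  generalize hypW e H = w at *
  generalize sinh H = s at *
  generalize cosh H = c at *
  have hq : 1 - e ^ 2 = -r ^ 2 := by linarith
  have hρ : 1 + e * ((e - c) / w) = r ^ 2 / w := by
    rw [hr, hw]
    rw [hw] at hW
    field_simp
    ring
  have hρ₂ : 2 + e * ((e - c) / w) = (w + r ^ 2) / w := by
    rw [add_div, ← hρ, div_self hW]
    ring
  have hD : r * s / w * ((w + r ^ 2) / w) / (r ^ 2 / w) ^ 2 -
      3 * e * ((e * s - H) / r ^ 3) = X / r ^ 3 := by
    rw [hX]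
    field_simp
    rw [hr, hw]
    ring
  rw [hq, hρ, hρ₂, hD]
  refine ⟨?_, ?_, ?_, ?_, ?_, ?_, rfl⟩
  · field_simp
  · field_simp
    ring
  · field_simp
    rw [hr, hw]
    ring
  · field_simp
    rw [hw]
    ring
  · field_simp
  · field_simp
    rw [hr, hw]
    ring

/-- The same count of powers, with `r² = e² - 1`; the sign of `1 - e² = -r²` has been absorbed in
`fundData_ofH`. -/
theorem kernelH_eq {e : ℝ} (h1 : 1 < e) (H : ℝ) : kernelH e H = hypK e H := by
  have hq0 : 0 < e ^ 2 - 1 := by nlinarith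
  have hW := (hypW_pos h1 H).ne'
  have hr0 : √(e ^ 2 - 1) ≠ 0 := (sqrt_pos.2 hq0).ne'
  have hr : √(e ^ 2 - 1) ^ 2 = e ^ 2 - 1 := sq_sqrt hq0.le
  have hr3 : √((e ^ 2 - 1) ^ 3) = √(e ^ 2 - 1) ^ 3 := sqrt_pow_three hq0.le
  obtain ⟨d, hdd⟩ : ∃ d, fundData e (sinOfH e H) (cosOfH e H) (meanLOfH e H) = d := ⟨_, rfl⟩
  obtain ⟨h₁, h₂, h₃, hS₁, hS₂, hS₃, hρ⟩ := fundData_ofH (d := d) hr0 hr hW (by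
    rw [← hdd, meanLOfH, hr3]
    rfl)
  have hd : d.IsFundamental := by
    subst hdd
    refine fundData_isFundamental _ (by linarith) ?_ ?_
    · have h := cosh_sq_sub_sinh_sq H
      unfold hypW at hW
      simp only [sinOfH, cosOfH, div_pow, mul_pow, hr]
      field_simp
      linear_combination (1 - e ^ 2) * h
    · exact hρ.trans_ne (by positivity)
  have hs : d.s = √(e ^ 2 - 1) * sinh H / hypW e H := by rw [← hdd]; rfl
  have hc : d.c = (e - cosh H) / hypW e H := by rw [← hdd]; rfl
  rw [kernelH, hdd]
  change (√(e ^ 2 - 1) / hypW e H) • _ = _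
  clear hdd hr3
  ext i j
  rw [Matrix.smul_apply, hd.kernelOf_apply, hρ, smul_eq_mul]
  unfold hypK
  generalize √(e ^ 2 - 1) = r at *
  clear hd
  fin_cases i <;> fin_cases j <;>
    simp only [FundData.invMat, Matrix.of_apply, Matrix.cons_val, Fin.reduceFinMk, h₁, h₂, h₃,
      hS₁, hS₂, hS₃, ← hr, hs, hc, Fin.zero_eta, Fin.mk_one]
  all_goals generalize hypW e H = w at *
  all_goals
    field_simp
    try ring

/-! ### The parabolic case in `t = tan (f / 2)` -/

/-- The matrix `J` of the parabolic case as a polynomial in `t = tan (f / 2)`. -/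
def parT (t : ℝ) : Mat6 :=
  let q := 1 + t ^ 2
  let k₁₁ := -t / 144144000 * (237568 + 118784 * q + 89088 * q ^ 2 - 1847680 * q ^ 3 +
      185080 * q ^ 4 +
    166572 * q ^ 5 - 72534 * q ^ 6 - 3003 * q ^ 7)
  let k₁₂ := (q / 2) ^ 5 / 25 + 3 / 20 * (q / 2) ^ 4 - 4 / 15 * (q / 2) ^ 3 - (q / 2) ^ 6 / 15
  let k₁₃ := (q / 2) ^ 4 / 10 + 2 / 25 * (q / 2) ^ 5 - (q / 2) ^ 6 / 15
  let k₁₄ := -t / 48048000 * (51456 + 25728 * q + 19296 * q ^ 2 + 977040 * q ^ 3 + 104160 * q ^ 4 -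
    26376 * q ^ 5 - 24178 * q ^ 6 - 1001 * q ^ 7)
  let k₂₂ := 1 / 352 * t ^ 11 + 5 / 288 * t ^ 9 + 1 / 112 * t ^ 7 + 1 / 80 * t ^ 5 +
      13 / 96 * t ^ 3 + 9 / 32 * t
  let k₂₃ := 1 / 352 * t ^ 11 + 5 / 288 * t ^ 9 +
      3 / 112 * t ^ 7 - 1 / 80 * t ^ 5 - 7 / 96 * t ^ 3 - 3 / 32 * t
  let k₂₄ := -4 / 25 * (q / 2) ^ 5 - 1 / 10 * (q / 2) ^ 4 + 2 / 5 * (q / 2) ^ 3 - (q / 2) ^ 6 / 15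
  let k₃₃ := 1 / 352 * t ^ 11 + 5 / 288 * t ^ 9 + 5 / 112 * t ^ 7 + 1 / 16 * t ^ 5 +
      5 / 96 * t ^ 3 + 1 / 32 * t
  let k₃₄ := -3 / 25 * (q / 2) ^ 5 - 3 / 20 * (q / 2) ^ 4 - (q / 2) ^ 6 / 15
  let k₄₄ := t / 144144000 * (1759232 + 879616 * q + 659712 * q ^ 2 + 4874080 * q ^ 3 +
      1562120 * q ^ 4 +
    324828 * q ^ 5 + 72534 * q ^ 6 + 3003 * q ^ 7)
  let k₅₅ := 1 / 72 * t ^ 9 + 3 / 56 * t ^ 7 + 3 / 40 * t ^ 5 + 1 / 24 * t ^ 3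
  let k₅₆ := (q / 2) ^ 5 / 5 - (q / 2) ^ 4 / 4
  let k₆₆ := 1 / 352 * t ^ 11 + 1 / 288 * t ^ 9 - 1 / 112 * t ^ 7 - 1 / 80 * t ^ 5 +
      1 / 96 * t ^ 3 + 1 / 32 * t
  !![k₁₁, k₁₂, k₁₃, k₁₄, 0, 0;
     k₁₂, k₂₂, k₂₃, k₂₄, 0, 0;
     k₁₃, k₂₃, k₃₃, k₃₄, 0, 0;
     k₁₄, k₂₄, k₃₄, k₄₄, 0, 0;
     0, 0, 0, 0, k₅₅, k₅₆;
     0, 0, 0, 0, k₅₆, k₆₆]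

/-- `(1 + t²)² φ₂` in the parabolic case. -/
def parA (t : ℝ) : ℝ := t * (2 * t - 2 / 5 * t ^ 5) - (1 - t ^ 2) * (1 + t ^ 2) ^ 2 / 2

/-- `(1 + t²)² φ₃` in the parabolic case. -/
def parC (t : ℝ) : ℝ := -(t * (2 * t - 2 / 5 * t ^ 5)) - (1 - t ^ 2) ^ 2 * (3 + t ^ 2) / 2

/-- `df/dt` times the integrand of the parabolic case as a polynomial in `t = tan (f / 2)`. -/
def parK (t : ℝ) : Mat6 :=
  let q := 1 + t ^ 2
  let A := parA t
  let B := (1 - t ^ 2) * (3 + t ^ 2)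
  let C := parC t
  let X := 2 / 5 * t ^ 5 - 2 * t
  let Y := -4 * t - 2 * t ^ 3 - 2 / 5 * t ^ 5
  let k₁₁ := A ^ 2 + X ^ 2
  let k₁₂ := X * B - 4 * t * A
  let k₁₃ := -(X * q ^ 2)
  let k₁₄ := -(A * C + X * Y)
  let k₂₂ := 16 * t ^ 2 + B ^ 2
  let k₂₃ := -(B * q ^ 2)
  let k₂₄ := 4 * t * C - B * Y
  let k₃₃ := q ^ 4
  let k₃₄ := q ^ 2 * Y
  let k₄₄ := C ^ 2 + Y ^ 2
  let k₅₅ := (2 * t * q) ^ 2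
  let k₅₆ := -(2 * t * (1 - t ^ 2) * q ^ 2)
  let k₆₆ := ((1 - t ^ 2) * q) ^ 2
  (q / 32) •
  !![k₁₁, k₁₂, k₁₃, k₁₄, 0, 0;
     k₁₂, k₂₂, k₂₃, k₂₄, 0, 0;
     k₁₃, k₂₃, k₃₃, k₃₄, 0, 0;
     k₁₄, k₂₄, k₃₄, k₄₄, 0, 0;
     0, 0, 0, 0, k₅₅, k₅₆;
     0, 0, 0, 0, k₅₆, k₆₆]

/-- Put `q = 1 + t²`. Then `1 + cos f = 2/q`, `cos² (f/2) = 1/q` and `sin (f/2) = t cos (f/2)`, so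
the fifteenth power of `cos (f/2)` in the denominators disappears. -/
theorem parJ_eq_parT {f : ℝ} (h : 1 + cos f ≠ 0) : parJ f = parT (tan (f / 2)) := by
  have hu := cos_half_ne_zero h
  have hs : sin (f / 2) = tan (f / 2) * cos (f / 2) := (tan_mul_cos hu).symm
  have hc : 1 + cos f = 2 / (1 + tan (f / 2) ^ 2) := by
    rw [cos_eq_tan_half h]
    have : 1 + tan (f / 2) ^ 2 ≠ 0 := by positivity
    field_simp
    ring
  have hq : 1 + tan (f / 2) ^ 2 = 1 / cos (f / 2) ^ 2 := by
    rw [← inv_one_add_tan_sq hu, one_div, inv_inv]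
  ext i j
  fin_cases i <;> fin_cases j <;>
    simp only [parJ, parT, parJ11, parJ12, parJ13, parJ14, parJ22, parJ23, parJ24, parJ33, parJ34,
      parJ44, parJ55, parJ56, parJ66, Matrix.of_apply, Matrix.cons_val, Fin.reduceFinMk,
      Fin.zero_eta, Fin.mk_one]
  all_goals first
    | rfl
    | (rw [hs, hq]
       generalize tan (f / 2) = t at *
       generalize cos (f / 2) = u at *
       field_simp)
    | (rw [hc]
       have : 1 + tan (f / 2) ^ 2 ≠ 0 := by positivity
       generalize tan (f / 2) = t at *
       field_simp
       try ring1)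

theorem hasDerivAt_parT (t : ℝ) (i j : Fin 6) :
    HasDerivAt (fun x => parT x i j) (parK t i j) t := by
  have hq : HasDerivAt (fun x : ℝ => 1 + x ^ 2) (2 * t) t := by
    simpa using (hasDerivAt_pow 2 t).const_add 1
  fin_cases i <;> fin_cases j <;>
    simp only [parT, parK, Matrix.smul_apply, Matrix.of_apply, Matrix.cons_val, Fin.reduceFinMk,
      Fin.zero_eta, Fin.mk_one] <;> apply HasDerivAt.congr_deriv <;> try
    repeat' with_reducible first
      | exact hasDerivAt_const _ _
      | exact hasDerivAt_id' _
      | exact hq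
      | apply HasDerivAt.const_mul
      | apply HasDerivAt.div_const
      | apply HasDerivAt.fun_add
      | apply HasDerivAt.fun_sub
      | apply HasDerivAt.fun_neg
      | apply HasDerivAt.fun_pow
      | apply HasDerivAt.fun_mul
  all_goals simp only [parA, parC, smul_eq_mul]
  all_goals push_cast
  all_goals ring

theorem fundDataPar_isFundamental {f : ℝ} (h : 1 + cos f ≠ 0) :
    (fundDataPar f).IsFundamental := by
  have h1 := fundAt_eq_fundOf zero_le_one f
  rw [fundAt, if_pos rfl] at h1
  rw [h1]
  exact fundOf_isFundamental _ _ (sin_sq_add_cos_sq f) (by rwa [one_mul])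

/-- The needed entries of the inverse are polynomials in `t` over `q²`, where `q = 1 + t²`, and `ρ⁻⁶
= q⁶ / 64`. With `df/dt = 2/q` this leaves the factor `q / 32` of `parK`; the scalar here is `dt/df
= q/2`. -/
theorem kernel_one_eq {f : ℝ} (h : 1 + cos f ≠ 0) :
    kernel 1 f = ((1 + tan (f / 2) ^ 2) / 2) • parK (tan (f / 2)) := by
  have hd := fundDataPar_isFundamental h
  have hc := cos_eq_tan_half h
  have hs := sin_eq_tan_half h
  have hq : 1 + tan (f / 2) ^ 2 ≠ 0 := by positivity
  have hρ : 1 + cos f = 2 / (1 + tan (f / 2) ^ 2) := by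
    rw [hc]
    field_simp
    ring
  ext i j
  rw [kernel, fundAt, if_pos rfl, hd.kernelOf_apply, Matrix.smul_apply, smul_eq_mul]
  have h₁ : (fundDataPar f).φ₁ = 4 * tan (f / 2) / (1 + tan (f / 2) ^ 2) ^ 2 := by
    simp only [fundDataPar, hρ, hs]
    field_simp
    ring
  have h₂ : (fundDataPar f).φ₂ = parA (tan (f / 2)) / (1 + tan (f / 2) ^ 2) ^ 2 := by
    simp only [fundDataPar, hρ, hs, parA]
    rw [hc]
    field_simp
    ring
  have h₃ : (fundDataPar f).φ₃ = parC (tan (f / 2)) / (1 + tan (f / 2) ^ 2) ^ 2 := by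
    simp only [fundDataPar, hρ, hs, parC]
    rw [hc]
    field_simp
    ring
  have hS₁ : (fundDataPar f).S₁ =
      -((1 - tan (f / 2) ^ 2) * (3 + tan (f / 2) ^ 2)) / (2 * (1 + tan (f / 2) ^ 2) ^ 2) := by
    simp only [fundDataPar]
    rw [hc]
    field_simp
    ring
  have hS₂ : (fundDataPar f).S₂ =
      (2 / 5 * tan (f / 2) ^ 5 - 2 * tan (f / 2)) / (2 * (1 + tan (f / 2) ^ 2) ^ 2) := by
    simp only [fundDataPar, hρ]
    field_simp
    ring
  have hS₃ : (fundDataPar f).S₃ =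
      (-4 * tan (f / 2) - 2 * tan (f / 2) ^ 3 - 2 / 5 * tan (f / 2) ^ 5) /
        (1 + tan (f / 2) ^ 2) ^ 2 := by
    simp only [fundDataPar, hρ, hs]
    rw [hc]
    field_simp
    ring
  have hs' : (fundDataPar f).s = 2 * tan (f / 2) / (1 + tan (f / 2) ^ 2) := hs
  have hc' : (fundDataPar f).c = (1 - tan (f / 2) ^ 2) / (1 + tan (f / 2) ^ 2) := hc
  have hρ' : 1 + 1 * (fundDataPar f).c = 2 / (1 + tan (f / 2) ^ 2) := by rw [one_mul]; exact hρ
  rw [hρ']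
  clear hd hρ hρ' hc hs
  generalize tan (f / 2) = t at *
  fin_cases i <;> fin_cases j <;>
    simp only [FundData.invMat, parK, Matrix.smul_apply, Matrix.of_apply, Matrix.cons_val,
      Fin.reduceFinMk, h₁, h₂, h₃, hS₁, hS₂, hS₃, hs', hc', Fin.zero_eta, Fin.mk_one, smul_eq_mul]
  all_goals
    field_simp
    try ring

theorem hasDerivAt_parJ {f : ℝ} (h : 1 + cos f ≠ 0) (i j : Fin 6) :
    HasDerivAt (fun x => parJ x i j) (kernel 1 f i j) f := by
  have hev : ∀ᶠ x in nhds f, 1 + cos x ≠ 0 :=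
    (continuous_const.add continuous_cos).continuousAt.eventually_ne h
  refine (((hasDerivAt_parT _ i j).comp f (hasDerivAt_tan_half h)).congr_of_eventuallyEq
    (hev.mono fun x hx => ?_)).congr_deriv ?_
  · simp [parJ_eq_parT hx]
  · rw [kernel_one_eq h, Matrix.smul_apply, smul_eq_mul, mul_comm]

/-! ### The eccentric anomaly -/

theorem cos_atan2 {x y : ℝ} (h : x ^ 2 + y ^ 2 = 1) : cos (atan2 y x) = x := by
  have hn : ‖(⟨x, y⟩ : ℂ)‖ = 1 := by
    rw [Complex.norm_def, Complex.normSq_mk, ← pow_two, ← pow_two, h, sqrt_one]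
  have h0 : (⟨x, y⟩ : ℂ) ≠ 0 := by
    rw [← norm_pos_iff, hn]
    exact one_pos
  rw [atan2, Complex.cos_arg h0, hn, div_one]

theorem sin_atan2 {x y : ℝ} (h : x ^ 2 + y ^ 2 = 1) : sin (atan2 y x) = y := by
  have hn : ‖(⟨x, y⟩ : ℂ)‖ = 1 := by
    rw [Complex.norm_def, Complex.normSq_mk, ← pow_two, ← pow_two, h, sqrt_one]
  rw [atan2, Complex.sin_arg, hn, div_one]

theorem eq_of_cos_eq_of_sin_eq {a b : ℝ} (ha : a ∈ Set.Ioc (-π) π) (hb : b ∈ Set.Ioc (-π) π)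
    (hc : cos a = cos b) (hs : sin a = sin b) : a = b := by
  rw [← Complex.arg_cos_add_sin_mul_I ha, ← Complex.arg_cos_add_sin_mul_I hb,
    ← Complex.ofReal_cos, ← Complex.ofReal_sin, hc, hs, Complex.ofReal_cos, Complex.ofReal_sin]

theorem rho_pos_of_lt_one {e : ℝ} (he : 0 ≤ e) (h1 : e < 1) (f : ℝ) : 0 < rho e f :=
  rho_pos he (Or.inl h1)

theorem ecc_unit {e : ℝ} (he : 0 ≤ e) (h1 : e < 1) (f : ℝ) :
    ((cos f + e) / rho e f) ^ 2 + (√(1 - e ^ 2) * sin f / rho e f) ^ 2 = 1 := by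
  have hρ := (rho_pos_of_lt_one he h1 f).ne'
  have hq := sq_sqrt (show (0 : ℝ) ≤ 1 - e ^ 2 by nlinarith)
  have h := sin_sq_add_cos_sq f
  rw [div_pow, div_pow, mul_pow, hq]
  field_simp
  unfold rho
  linear_combination (1 - e ^ 2) * h

/-- The term `f - atan2 (sin f) (cos f)` has cosine 1 and sine 0, so it only counts revolutions; the
other `atan2` is the angle of a point on the unit circle. -/
theorem cos_sin_eccAnomaly {e : ℝ} (he : 0 ≤ e) (h1 : e < 1) (f : ℝ) :
    cos (eccAnomaly e f) = (cos f + e) / rho e f ∧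
      sin (eccAnomaly e f) = √(1 - e ^ 2) * sin f / rho e f := by
  have h := ecc_unit he h1 f
  have hf := cos_sq_add_sin_sq f
  have hc : cos (f - atan2 (sin f) (cos f)) = 1 := by
    rw [cos_sub, cos_atan2 hf, sin_atan2 hf, ← pow_two, ← pow_two, hf]
  have hs : sin (f - atan2 (sin f) (cos f)) = 0 := by
    rw [sin_sub, cos_atan2 hf, sin_atan2 hf, mul_comm, sub_self]
  rw [eccAnomaly, add_sub_assoc, cos_add, sin_add, hc, hs, cos_atan2 h, sin_atan2 h]
  constructor <;> ring

/-- The two sines have the same sign, so both angles lie in `[0, π]` or both in `(-π, 0)`. A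
difference of exactly `π` would make the two points antipodal, which forces `sin f = 0` and `cos f =
-e`, impossible for `e < 1`. -/
theorem abs_atan2_sub_lt {e : ℝ} (he : 0 ≤ e) (h1 : e < 1) (f : ℝ) :
    |atan2 (√(1 - e ^ 2) * sin f / rho e f) ((cos f + e) / rho e f) -
      atan2 (sin f) (cos f)| < π := by
  have hρ := rho_pos_of_lt_one he h1 f
  have hq : 0 < √(1 - e ^ 2) := sqrt_pos.2 (by nlinarith)
  have h := ecc_unit he h1 f
  have hf := cos_sq_add_sin_sq f
  have hc₁ := cos_atan2 h
  have hs₁ := sin_atan2 h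
  have hc₂ := cos_atan2 hf
  have hs₂ := sin_atan2 hf
  set a := atan2 (√(1 - e ^ 2) * sin f / rho e f) ((cos f + e) / rho e f) with ha
  set b := atan2 (sin f) (cos f) with hb
  have hne : ∀ {x y : ℝ}, (x = y + π ∨ x = y - π) → cos x = -cos y ∧ sin x = -sin y := by
    rintro x y (rfl | rfl)
    · exact ⟨cos_add_pi y, sin_add_pi y⟩
    · exact ⟨cos_sub_pi y, sin_sub_pi y⟩
  have hopp : ¬(cos a = -cos b ∧ sin a = -sin b) := by
    rintro ⟨h₁, h₂⟩
    rw [hc₁, hc₂, div_eq_iff hρ.ne'] at h₁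
    rw [hs₁, hs₂, div_eq_iff hρ.ne'] at h₂
    have hs : sin f = 0 := by
      have : sin f * (√(1 - e ^ 2) + rho e f) = 0 := by linarith
      exact (mul_eq_zero.1 this).resolve_right (by positivity)
    rw [hs] at hf
    unfold rho at h₁
    have : 2 * (cos f + e) = 0 := by linear_combination h₁ - e * hf
    nlinarith
  have ha1 : a ∈ Set.Ioc (-π) π := Complex.arg_mem_Ioc _
  have hb1 : b ∈ Set.Ioc (-π) π := Complex.arg_mem_Ioc _
  rw [abs_lt]
  rcases le_or_gt 0 (sin f) with h0 | h0
  · have ha0 : 0 ≤ a := Complex.arg_nonneg_iff.2 (by positivity)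
    have hb0 : 0 ≤ b := Complex.arg_nonneg_iff.2 h0
    constructor
    · refine lt_of_le_of_ne (by linarith [hb1.2]) fun h' => hopp (hne (Or.inr ?_))
      linarith
    · refine lt_of_le_of_ne (by linarith [ha1.2]) fun h' => hopp (hne (Or.inl ?_))
      linarith
  · have ha0 : a < 0 := Complex.arg_neg_iff.2
      (div_neg_of_neg_of_pos (mul_neg_of_pos_of_neg hq h0) hρ)
    have hb0 : b < 0 := Complex.arg_neg_iff.2 h0
    exact ⟨by linarith [ha1.1], by linarith [hb1.1]⟩

/-- The witness is `b = tan (½ arcsin e) = e / (1 + √(1 - e²))`; it makes both `e` and the root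
rational in `b`. -/
theorem exists_half_eccentricity {e : ℝ} (he : 0 ≤ e) (h1 : e < 1) :
    ∃ b, 0 ≤ b ∧ b < 1 ∧ e * (1 + b ^ 2) = 2 * b ∧ √(1 - e ^ 2) * (1 + b ^ 2) = 1 - b ^ 2 := by
  have hq : 0 < √(1 - e ^ 2) := sqrt_pos.2 (by nlinarith)
  have hq2 := sq_sqrt (show (0 : ℝ) ≤ 1 - e ^ 2 by nlinarith)
  generalize √(1 - e ^ 2) = q at *
  refine ⟨e / (1 + q), by positivity, ?_, ?_, ?_⟩
  · rw [div_lt_one (by positivity)]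
    linarith
  · field_simp
    linear_combination e * hq2
  · field_simp
    linear_combination (1 + q) * hq2

/-- This removes the branch cuts. The difference of the two `atan2` values and `-2 arctan u` both
lie in `(-π, π)` and have the same cosine and sine, hence coincide; the right-hand side is visibly
smooth in `f`. -/
theorem eccAnomaly_eq {e b : ℝ} (he : 0 ≤ e) (h1 : e < 1) (hb0 : 0 ≤ b) (hb1 : b < 1)
    (hb : e * (1 + b ^ 2) = 2 * b) (hbq : √(1 - e ^ 2) * (1 + b ^ 2) = 1 - b ^ 2) (f : ℝ) :
    eccAnomaly e f = f - 2 * arctan (b * sin f / (1 + b * cos f)) := by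
  have hρ := rho_pos_of_lt_one he h1 f
  have h := ecc_unit he h1 f
  have hf := cos_sq_add_sin_sq f
  have habs := abs_lt.1 (abs_atan2_sub_lt he h1 f)
  have hv : 0 < 1 + b * cos f := by nlinarith [neg_one_le_cos f]
  set u := b * sin f / (1 + b * cos f) with hu
  have hB : (0 : ℝ) < 1 + b ^ 2 := by positivity
  have hρB : rho e f = (1 + b ^ 2 + 2 * b * cos f) / (1 + b ^ 2) := by
    rw [eq_div_iff hB.ne', rho]
    linear_combination cos f * hb
  have he' : e = 2 * b / (1 + b ^ 2) := by rw [eq_div_iff hB.ne', hb]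
  have hq' : √(1 - e ^ 2) = (1 - b ^ 2) / (1 + b ^ 2) := by rw [eq_div_iff hB.ne', hbq]
  have hN : 0 < 1 + b ^ 2 + 2 * b * cos f := by
    rw [hρB] at hρ
    exact (div_pos_iff_of_pos_right hB).1 hρ
  have hu2 : 1 + u ^ 2 = (1 + b ^ 2 + 2 * b * cos f) / (1 + b * cos f) ^ 2 := by
    rw [hu]
    field_simp
    linear_combination b ^ 2 * hf
  have hcos : cos (2 * arctan u) = 2 / (1 + u ^ 2) - 1 := by
    rw [cos_two_mul, cos_sq_arctan]
    ring
  have hsin : sin (2 * arctan u) = 2 * u / (1 + u ^ 2) := by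
    have h2 : sin (arctan u) = u * cos (arctan u) := by
      rw [← tan_mul_cos (cos_arctan_pos u).ne', tan_arctan]
    rw [sin_two_mul, h2, show 2 * (u * cos (arctan u)) * cos (arctan u)
      = 2 * u * cos (arctan u) ^ 2 by ring, cos_sq_arctan]
    ring
  have key := eq_of_cos_eq_of_sin_eq (a := atan2 (√(1 - e ^ 2) * sin f / rho e f)
      ((cos f + e) / rho e f) - atan2 (sin f) (cos f)) (b := -(2 * arctan u))
    ⟨habs.1, habs.2.le⟩
    ⟨by linarith [arctan_lt_pi_div_two u], by linarith [neg_pi_div_two_lt_arctan u]⟩ ?_ ?_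
  · rw [eccAnomaly]
    linarith
  · rw [cos_sub, cos_neg, cos_atan2 h, sin_atan2 h, cos_atan2 hf, sin_atan2 hf, hcos, hu2, hρB,
      hq', he']
    have hN' : 1 + b ^ 2 + cos f * 2 * b ≠ 0 := by linarith
    field_simp
    linear_combination (1 - b ^ 2) * hf
  · rw [sin_sub, sin_neg, cos_atan2 h, sin_atan2 h, cos_atan2 hf, sin_atan2 hf, hsin, hu2, hρB,
      hq', he', hu]
    field_simp
    ring

theorem hasDerivAt_eccAnomaly_rho {e : ℝ} (he : 0 ≤ e) (h1 : e < 1) (f : ℝ) :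
    HasDerivAt (eccAnomaly e) (√(1 - e ^ 2) / rho e f) f := by
  obtain ⟨b, hb0, hb1, hb, hbq⟩ := exists_half_eccentricity he h1
  have hE : eccAnomaly e = fun x => x - 2 * arctan (b * sin x / (1 + b * cos x)) :=
    funext (eccAnomaly_eq he h1 hb0 hb1 hb hbq)
  have hv : 0 < 1 + b * cos f := by nlinarith [neg_one_le_cos f]
  have hB : (0 : ℝ) < 1 + b ^ 2 := by positivity
  have hρ := rho_pos_of_lt_one he h1 f
  have hρB : rho e f = (1 + b ^ 2 + 2 * b * cos f) / (1 + b ^ 2) := by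
    rw [eq_div_iff hB.ne', rho]
    linear_combination cos f * hb
  have hN : 0 < 1 + b ^ 2 + 2 * b * cos f := by
    rw [hρB] at hρ
    exact (div_pos_iff_of_pos_right hB).1 hρ
  have hq' : √(1 - e ^ 2) = (1 - b ^ 2) / (1 + b ^ 2) := by rw [eq_div_iff hB.ne', hbq]
  have hu2 : 1 + (b * sin f / (1 + b * cos f)) ^ 2 =
      (1 + b ^ 2 + 2 * b * cos f) / (1 + b * cos f) ^ 2 := by
    field_simp
    linear_combination b ^ 2 * sin_sq_add_cos_sq f
  rw [hE]
  refine ((hasDerivAt_id' f).fun_sub (((((hasDerivAt_sin f).const_mul b).fun_div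
    (((hasDerivAt_cos f).const_mul b).const_add 1) hv.ne').arctan).const_mul 2)).congr_deriv ?_
  rw [hu2, hρB, hq']
  field_simp
  linear_combination -2 * b ^ 2 * sin_sq_add_cos_sq f

theorem one_sub_mul_cos_eccAnomaly {e : ℝ} (he : 0 ≤ e) (h1 : e < 1) (f : ℝ) :
    1 - e * cos (eccAnomaly e f) = (1 - e ^ 2) / rho e f := by
  have hρ := (rho_pos_of_lt_one he h1 f).ne'
  rw [(cos_sin_eccAnomaly he h1 f).1]
  field_simp
  unfold rho
  ring

theorem hasDerivAt_eccAnomaly {e : ℝ} (he : 0 ≤ e) (h1 : e < 1) (f : ℝ) :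
    HasDerivAt (eccAnomaly e) ((1 - e * cos (eccAnomaly e f)) / √(1 - e ^ 2)) f := by
  refine (hasDerivAt_eccAnomaly_rho he h1 f).congr_deriv ?_
  have hq : 0 < √(1 - e ^ 2) := sqrt_pos.2 (by nlinarith)
  have hq2 := sq_sqrt (show (0 : ℝ) ≤ 1 - e ^ 2 by nlinarith)
  have hρ := (rho_pos_of_lt_one he h1 f).ne'
  rw [one_sub_mul_cos_eccAnomaly he h1, ← hq2, sqrt_sq hq.le]
  generalize √(1 - e ^ 2) = q at *
  field_simp

theorem sin_eq_sinOfE {e : ℝ} (he : 0 ≤ e) (h1 : e < 1) (f : ℝ) :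
    sin f = sinOfE e (eccAnomaly e f) := by
  have hq2 := sq_sqrt (show (0 : ℝ) ≤ 1 - e ^ 2 by nlinarith)
  have hq : 0 < √(1 - e ^ 2) := sqrt_pos.2 (by nlinarith)
  have hρ := (rho_pos_of_lt_one he h1 f).ne'
  rw [sinOfE, one_sub_mul_cos_eccAnomaly he h1, (cos_sin_eccAnomaly he h1 f).2, ← hq2,
    sqrt_sq hq.le]
  field_simp

theorem cos_eq_cosOfE {e : ℝ} (he : 0 ≤ e) (h1 : e < 1) (f : ℝ) :
    cos f = cosOfE e (eccAnomaly e f) := by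
  have hq : 1 - e ^ 2 ≠ 0 := by nlinarith
  have hρ := (rho_pos_of_lt_one he h1 f).ne'
  rw [cosOfE, one_sub_mul_cos_eccAnomaly he h1, (cos_sin_eccAnomaly he h1 f).1]
  field_simp
  unfold rho
  ring

theorem abs_sub_eccAnomaly_lt {e : ℝ} (he : 0 ≤ e) (h1 : e < 1) (f : ℝ) :
    |f - eccAnomaly e f| < 2 * π := by
  have h := abs_lt.1 (abs_atan2_sub_lt he h1 f)
  have := pi_pos
  rw [abs_lt, eccAnomaly]
  constructor <;> linarith

theorem meanL_eq_of_hasDerivAt {e f : ℝ} (he : 0 ≤ e) (hf : f ∈ anomalyRange e) {g : ℝ → ℝ}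
    (hg : ∀ x ∈ anomalyRange e, HasDerivAt g (1 / rho e x ^ 2) x) (h0 : g 0 = 0) :
    meanL e f = g f := by
  have hz := zero_mem_anomalyRange he
  rw [meanL, intervalIntegral.integral_eq_sub_of_hasDerivAt
    (fun x hx => hg x (uIcc_subset_anomalyRange he hz hf hx))
    (intervalIntegrable_inv_rho_sq he hz hf), h0, sub_zero]

theorem meanL_eq_meanLOfE {e : ℝ} (he : 0 ≤ e) (h1 : e < 1) (f : ℝ) :
    meanL e f = meanLOfE e (eccAnomaly e f) := by
  have hq2 := sq_sqrt (show (0 : ℝ) ≤ 1 - e ^ 2 by nlinarith)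
  have hq : 0 < √(1 - e ^ 2) := sqrt_pos.2 (by nlinarith)
  refine meanL_eq_of_hasDerivAt (g := fun x => meanLOfE e (eccAnomaly e x)) he (Or.inl h1)
    (fun x _ => ?_) ?_
  · have hE := hasDerivAt_eccAnomaly_rho he h1 x
    have hρ := (rho_pos_of_lt_one he h1 x).ne'
    refine ((hE.fun_sub (hE.sin.const_mul e)).div_const _).congr_deriv ?_
    rw [sqrt_pow_three (by nlinarith), show √(1 - e ^ 2) / rho e x -
      e * (cos (eccAnomaly e x) * (√(1 - e ^ 2) / rho e x)) =
      √(1 - e ^ 2) / rho e x * (1 - e * cos (eccAnomaly e x)) by ring,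
      one_sub_mul_cos_eccAnomaly he h1, ← hq2, sqrt_sq hq.le]
    field_simp
  · have h0 : eccAnomaly e 0 = 0 := by
      obtain ⟨b, hb0, hb1, hb, hbq⟩ := exists_half_eccentricity he h1
      simp [eccAnomaly_eq he h1 hb0 hb1 hb hbq]
    simp [meanLOfE, h0]

/-! ### The hyperbolic anomaly -/

theorem hasDerivAt_artanh {x : ℝ} (hx : x ∈ Set.Ioo (-1) 1) :
    HasDerivAt artanh (1 / (1 - x ^ 2)) x := by
  have h1 : 0 < 1 + x := by linarith [hx.1]
  have h2 : 0 < 1 - x := by linarith [hx.2]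
  have h3 : 1 - x ^ 2 ≠ 0 := by nlinarith
  have hd := ((((hasDerivAt_id' x).const_add 1).fun_div ((hasDerivAt_id' x).const_sub 1)
    h2.ne').log (by positivity)).const_mul (1 / 2)
  refine (hd.congr_of_eventuallyEq ?_).congr_deriv ?_
  · filter_upwards [Ioo_mem_nhds hx.1 hx.2] with y hy
    exact artanh_eq_half_log ⟨hy.1.le, hy.2.le⟩
  · field_simp
    ring

/-- The middle identity does the work: positivity of `ρ` puts the argument of `artanh` in its open
domain, and the square root in `cosh (artanh x)` and `sinh (artanh x)` becomes `ρ / (e + cos f)`. -/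
theorem hyp_arg {e f : ℝ} (h1 : 1 < e) (hf : f ∈ anomalyRange e) :
    0 < e + cos f ∧
    1 - (√(e ^ 2 - 1) * sin f / (e + cos f)) ^ 2 = (rho e f / (e + cos f)) ^ 2 ∧
    √(e ^ 2 - 1) * sin f / (e + cos f) ∈ Set.Ioo (-1) 1 := by
  have hρ := rho_pos (by linarith) hf
  have hec : 0 < e + cos f := by linarith [neg_one_le_cos f]
  have hq2 := sq_sqrt (show (0 : ℝ) ≤ e ^ 2 - 1 by nlinarith)
  have hx : 1 - (√(e ^ 2 - 1) * sin f / (e + cos f)) ^ 2 = (rho e f / (e + cos f)) ^ 2 := by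
    rw [div_pow, mul_pow, hq2]
    field_simp
    unfold rho
    linear_combination (1 - e ^ 2) * sin_sq_add_cos_sq f
  refine ⟨hec, hx, abs_lt.1 ((sq_lt_one_iff_abs_lt_one _).1 ?_)⟩
  have : 0 < (rho e f / (e + cos f)) ^ 2 := by positivity
  linarith

theorem cosh_sinh_hypAnomaly {e f : ℝ} (h1 : 1 < e) (hf : f ∈ anomalyRange e) :
    cosh (hypAnomaly e f) = (e + cos f) / rho e f ∧
      sinh (hypAnomaly e f) = √(e ^ 2 - 1) * sin f / rho e f := by
  obtain ⟨hec, hx, hx1⟩ := hyp_arg h1 hf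
  have hρ := rho_pos (by linarith) hf
  rw [hypAnomaly, cosh_artanh hx1, sinh_artanh hx1, hx, sqrt_sq (by positivity)]
  constructor <;> field_simp

theorem hasDerivAt_hypAnomaly_rho {e f : ℝ} (h1 : 1 < e) (hf : f ∈ anomalyRange e) :
    HasDerivAt (hypAnomaly e) (√(e ^ 2 - 1) / rho e f) f := by
  obtain ⟨hec, hx, hx1⟩ := hyp_arg h1 hf
  have hρ := rho_pos (by linarith) hf
  have hd := (hasDerivAt_artanh hx1).comp f ((((hasDerivAt_sin f).const_mul (√(e ^ 2 - 1))).fun_div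
    ((hasDerivAt_cos f).const_add e) hec.ne'))
  refine hd.congr_deriv ?_
  rw [hx]
  field_simp
  unfold rho
  linear_combination √(e ^ 2 - 1) * sin_sq_add_cos_sq f

theorem mul_cosh_hypAnomaly_sub_one {e f : ℝ} (h1 : 1 < e) (hf : f ∈ anomalyRange e) :
    e * cosh (hypAnomaly e f) - 1 = (e ^ 2 - 1) / rho e f := by
  have hρ := (rho_pos (by linarith) hf).ne'
  rw [(cosh_sinh_hypAnomaly h1 hf).1]
  field_simp
  unfold rho
  ring

theorem hasDerivAt_hypAnomaly {e f : ℝ} (h1 : 1 < e) (hf : f ∈ anomalyRange e) :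
    HasDerivAt (hypAnomaly e) ((e * cosh (hypAnomaly e f) - 1) / √(e ^ 2 - 1)) f := by
  refine (hasDerivAt_hypAnomaly_rho h1 hf).congr_deriv ?_
  have hq : 0 < √(e ^ 2 - 1) := sqrt_pos.2 (by nlinarith)
  have hq2 := sq_sqrt (show (0 : ℝ) ≤ e ^ 2 - 1 by nlinarith)
  have hρ := (rho_pos (by linarith) hf).ne'
  rw [mul_cosh_hypAnomaly_sub_one h1 hf, ← hq2, sqrt_sq hq.le]
  generalize √(e ^ 2 - 1) = q at *
  field_simp

theorem sin_eq_sinOfH {e f : ℝ} (h1 : 1 < e) (hf : f ∈ anomalyRange e) :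
    sin f = sinOfH e (hypAnomaly e f) := by
  have hq2 := sq_sqrt (show (0 : ℝ) ≤ e ^ 2 - 1 by nlinarith)
  have hq : 0 < √(e ^ 2 - 1) := sqrt_pos.2 (by nlinarith)
  have hρ := (rho_pos (by linarith) hf).ne'
  rw [sinOfH, mul_cosh_hypAnomaly_sub_one h1 hf, (cosh_sinh_hypAnomaly h1 hf).2, ← hq2,
    sqrt_sq hq.le]
  field_simp

theorem cos_eq_cosOfH {e f : ℝ} (h1 : 1 < e) (hf : f ∈ anomalyRange e) :
    cos f = cosOfH e (hypAnomaly e f) := by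
  have hq : e ^ 2 - 1 ≠ 0 := by nlinarith
  have hρ := (rho_pos (by linarith) hf).ne'
  rw [cosOfH, mul_cosh_hypAnomaly_sub_one h1 hf, (cosh_sinh_hypAnomaly h1 hf).1]
  field_simp
  unfold rho
  ring

theorem meanL_eq_meanLOfH {e f : ℝ} (h1 : 1 < e) (hf : f ∈ anomalyRange e) :
    meanL e f = meanLOfH e (hypAnomaly e f) := by
  have hq2 := sq_sqrt (show (0 : ℝ) ≤ e ^ 2 - 1 by nlinarith)
  have hq : 0 < √(e ^ 2 - 1) := sqrt_pos.2 (by nlinarith)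
  refine meanL_eq_of_hasDerivAt (g := fun x => meanLOfH e (hypAnomaly e x)) (by linarith) hf
    (fun x hx => ?_) ?_
  · have hH := hasDerivAt_hypAnomaly_rho h1 hx
    have hρ := (rho_pos (by linarith) hx).ne'
    refine (((hH.sinh.const_mul e).fun_sub hH).div_const _).congr_deriv ?_
    rw [sqrt_pow_three (by nlinarith), show
      e * (cosh (hypAnomaly e x) * (√(e ^ 2 - 1) / rho e x)) - √(e ^ 2 - 1) / rho e x =
      √(e ^ 2 - 1) / rho e x * (e * cosh (hypAnomaly e x) - 1) by ring,
      mul_cosh_hypAnomaly_sub_one h1 hx, ← hq2, sqrt_sq hq.le]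
    field_simp
  · simp [meanLOfH, hypAnomaly]

/-! ### `J` is an antiderivative of the integrand -/

theorem kernelE_eccAnomaly {e : ℝ} (he : 0 ≤ e) (h1 : e < 1) (f : ℝ) :
    kernelE e (eccAnomaly e f) =
      (√(1 - e ^ 2) / (1 - e * cos (eccAnomaly e f))) • kernel e f := by
  rw [kernelE, kernel, fundAt, if_neg h1.ne, ← sin_eq_sinOfE he h1, ← cos_eq_cosOfE he h1,
    ← meanL_eq_meanLOfE he h1]

theorem kernelH_hypAnomaly {e f : ℝ} (h1 : 1 < e) (hf : f ∈ anomalyRange e) :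
    kernelH e (hypAnomaly e f) =
      (√(e ^ 2 - 1) / (e * cosh (hypAnomaly e f) - 1)) • kernel e f := by
  rw [kernelH, kernel, fundAt, if_neg h1.ne', ← sin_eq_sinOfH h1 hf, ← cos_eq_cosOfH h1 hf,
    ← meanL_eq_meanLOfH h1 hf]

theorem hasDerivAt_ellJ_kernelE {e : ℝ} (he : 0 ≤ e) (h1 : e < 1) (E : ℝ) (i j : Fin 6) :
    HasDerivAt (fun x => ellJ e x i j) (kernelE e E i j) E := by
  rw [kernelE_eq he h1]
  exact hasDerivAt_ellJ e E i j

theorem hasDerivAt_hypJ_kernelH {e : ℝ} (h1 : 1 < e) (H : ℝ) (i j : Fin 6) :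
    HasDerivAt (fun x => hypJ e x i j) (kernelH e H i j) H := by
  rw [kernelH_eq h1]
  exact hasDerivAt_hypJ e H i j

theorem matJ_of_lt {e : ℝ} (h1 : e < 1) (f : ℝ) : matJ e f = ellJ e (eccAnomaly e f) :=
  if_pos h1

theorem matJ_one (f : ℝ) : matJ 1 f = parJ f := by
  rw [matJ, if_neg (lt_irrefl 1), if_pos rfl]

theorem matJ_of_gt {e : ℝ} (h1 : 1 < e) (f : ℝ) : matJ e f = hypJ e (hypAnomaly e f) := by
  rw [matJ, if_neg h1.le.not_gt, if_neg h1.ne']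

/-- The chain rule: `dE/df` or `dH/df` cancels the Jacobian built into `kernelE` or `kernelH`. -/
theorem hasDerivAt_matJ {e f : ℝ} (he : 0 ≤ e) (hf : f ∈ anomalyRange e) (i j : Fin 6) :
    HasDerivAt (fun x => matJ e x i j) (kernel e f i j) f := by
  rcases lt_trichotomy e 1 with h1 | rfl | h1
  · simp only [matJ_of_lt h1]
    refine ((hasDerivAt_ellJ_kernelE he h1 _ i j).comp f
      (hasDerivAt_eccAnomaly he h1 f)).congr_deriv ?_
    have hw := (ellW_pos he h1 (eccAnomaly e f)).ne'
    have hq : √(1 - e ^ 2) ≠ 0 := (sqrt_pos.2 (by nlinarith)).ne'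
    unfold ellW at hw
    rw [kernelE_eccAnomaly he h1, Matrix.smul_apply, smul_eq_mul]
    field_simp
  · simp only [matJ_one]
    have := rho_pos zero_le_one hf
    rw [rho, one_mul] at this
    exact hasDerivAt_parJ this.ne' i j
  · simp only [matJ_of_gt h1]
    refine ((hasDerivAt_hypJ_kernelH h1 _ i j).comp f
      (hasDerivAt_hypAnomaly h1 hf)).congr_deriv ?_
    have hw := (hypW_pos h1 (hypAnomaly e f)).ne'
    have hq : √(e ^ 2 - 1) ≠ 0 := (sqrt_pos.2 (by nlinarith)).ne'
    unfold hypW at hw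
    rw [kernelH_hypAnomaly h1 hf, Matrix.smul_apply, smul_eq_mul]
    field_simp

/-! ### Symmetry and block structure of `J`. -/

theorem ellJ_isSymm (e E : ℝ) : (ellJ e E).IsSymm := by
  ext i j
  fin_cases i <;> fin_cases j <;> rfl

theorem parJ_isSymm (f : ℝ) : (parJ f).IsSymm := by
  ext i j
  fin_cases i <;> fin_cases j <;> rfl

theorem hypJ_isSymm (e H : ℝ) : (hypJ e H).IsSymm := by
  ext i j
  fin_cases i <;> fin_cases j <;> rfl

theorem matJ_isSymm (e f : ℝ) : (matJ e f).IsSymm := by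
  unfold matJ
  split_ifs
  exacts [ellJ_isSymm _ _, parJ_isSymm _, hypJ_isSymm _ _]

theorem matJ_apply_eq_zero (e f : ℝ) {i j : Fin 6} (hi : i < 4) (hj : 4 ≤ j) :
    matJ e f i j = 0 := by
  unfold matJ
  split_ifs <;> fin_cases i <;> fin_cases j <;>
    first
      | rfl
      | exact absurd hi (by decide)
      | exact absurd hj (by decide)

/-! ### Continuity and integrals -/

theorem continuousAt_invMat {e f : ℝ} (he : 0 ≤ e) (hf : f ∈ anomalyRange e) (i j : Fin 6) :
    ContinuousAt (fun x => (fundAt e x).invMat i j) f := by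
  obtain ⟨h₁, h₂, h₃, h₁', h₂', h₃', hS₁, hS₂, hS₃⟩ := hasDerivAt_fundAt he hf
  replace h₁ := h₁.continuousAt
  replace h₂ := h₂.continuousAt
  replace h₃ := h₃.continuousAt
  replace h₁' := h₁'.continuousAt
  replace h₂' := h₂'.continuousAt
  replace h₃' := h₃'.continuousAt
  replace hS₁ := hS₁.continuousAt
  replace hS₂ := hS₂.continuousAt
  replace hS₃ := hS₃.continuousAt
  fin_cases i <;> fin_cases j <;>
    simp only [FundData.invMat, Matrix.of_apply, Matrix.cons_val, Fin.reduceFinMk, Fin.zero_eta,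
      Fin.mk_one, fundAt_s he, fundAt_c he] <;>
    fun_prop

theorem continuousOn_kernel {e : ℝ} (he : 0 ≤ e) (i j : Fin 6) :
    ContinuousOn (fun x => kernel e x i j) (anomalyRange e) := by
  refine ContinuousOn.congr (f := fun x => ((fundAt e x).invMat i 3 * (fundAt e x).invMat j 3 +
    (fundAt e x).invMat i 4 * (fundAt e x).invMat j 4 +
    (fundAt e x).invMat i 5 * (fundAt e x).invMat j 5) / rho e x ^ 6) ?_ fun x hx => ?_
  · intro f hf
    have h := continuousAt_invMat he hf
    exact ((((h i 3).mul (h j 3)).add ((h i 4).mul (h j 4))).add ((h i 5).mul (h j 5))).div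
      ((continuous_rho e).continuousAt.pow 6) (pow_ne_zero 6 (rho_pos he hf).ne')
      |>.continuousWithinAt
  · rw [kernel, (fundAt_isFundamental he hx).kernelOf_apply, fundAt_c he]
    rfl

theorem intervalIntegrable_kernel {e a b : ℝ} (he : 0 ≤ e) (ha : a ∈ anomalyRange e)
    (hb : b ∈ anomalyRange e) (i j : Fin 6) :
    IntervalIntegrable (fun x => kernel e x i j) MeasureTheory.volume a b :=
  ((continuousOn_kernel he i j).mono (uIcc_subset_anomalyRange he ha hb)).intervalIntegrable

theorem matIntegral_eq_sub {a b : ℝ} {M G : ℝ → Mat6}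
    (hG : ∀ x ∈ Set.uIcc a b, ∀ i j, HasDerivAt (fun y => G y i j) (M x i j) x)
    (hM : ∀ i j, ContinuousOn (fun x => M x i j) (Set.uIcc a b)) :
    matIntegral a b M = G b - G a := by
  ext i j
  exact intervalIntegral.integral_eq_sub_of_hasDerivAt (fun x hx => hG x hx i j)
    (hM i j).intervalIntegrable

theorem matIntegral_kernel {e a b : ℝ} (he : 0 ≤ e) (ha : a ∈ anomalyRange e)
    (hb : b ∈ anomalyRange e) : matIntegral a b (kernel e) = matJ e b - matJ e a :=
  have hs := uIcc_subset_anomalyRange he ha hb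
  matIntegral_eq_sub (fun _ hx => hasDerivAt_matJ he (hs hx))
    fun i j => (continuousOn_kernel he i j).mono hs

theorem continuous_ellK (e : ℝ) (i j : Fin 6) : Continuous fun x => ellK e x i j := by
  fin_cases i <;> fin_cases j <;>
    simp only [ellK, ellA, ellB, ellC, ellX, ellY, ellW, Matrix.of_apply, Matrix.cons_val,
      Fin.reduceFinMk, Fin.zero_eta, Fin.mk_one] <;>
    fun_prop

theorem continuous_hypK (e : ℝ) (i j : Fin 6) : Continuous fun x => hypK e x i j := by
  fin_cases i <;> fin_cases j <;>
    simp only [hypK, hypA, hypB, hypC, hypX, hypY, hypW, Matrix.of_apply, Matrix.cons_val,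
      Fin.reduceFinMk, Fin.zero_eta, Fin.mk_one] <;>
    fun_prop

theorem matIntegral_kernelE {e : ℝ} (he : 0 ≤ e) (h1 : e < 1) (a b : ℝ) :
    matIntegral a b (kernelE e) = ellJ e b - ellJ e a := by
  refine matIntegral_eq_sub (fun x _ => hasDerivAt_ellJ_kernelE he h1 x) fun i j => ?_
  simp only [kernelE_eq he h1]
  exact (continuous_ellK e i j).continuousOn

theorem matIntegral_kernelH {e : ℝ} (h1 : 1 < e) (a b : ℝ) :
    matIntegral a b (kernelH e) = hypJ e b - hypJ e a := by
  refine matIntegral_eq_sub (fun x _ => hasDerivAt_hypJ_kernelH h1 x) fun i j => ?_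
  simp only [kernelH_eq h1]
  exact (continuous_hypK e i j).continuousOn

/-! ### Entrywise derivatives of matrix functions -/

/-- `M'` is the entrywise derivative of `M` at `x`. -/
def HasMatDerivAt (M : ℝ → Mat6) (M' : Mat6) (x : ℝ) : Prop :=
  ∀ i j, HasDerivAt (fun y => M y i j) (M' i j) x

namespace HasMatDerivAt

variable {M N : ℝ → Mat6} {M' N' : Mat6} {x : ℝ}

theorem const (C : Mat6) (x : ℝ) : HasMatDerivAt (fun _ => C) 0 x :=
  fun _ _ => hasDerivAt_const _ _

theorem mul (hM : HasMatDerivAt M M' x) (hN : HasMatDerivAt N N' x) :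
    HasMatDerivAt (fun y => M y * N y) (M' * N x + M x * N') x := by
  intro i j
  simp only [Matrix.add_apply, Matrix.mul_apply, ← Finset.sum_add_distrib]
  exact HasDerivAt.fun_sum fun k _ => (hM i k).mul (hN k j)

theorem sub (hM : HasMatDerivAt M M' x) (hN : HasMatDerivAt N N' x) :
    HasMatDerivAt (fun y => M y - N y) (M' - N') x :=
  fun i j => (hM i j).sub (hN i j)

theorem const_smul (c : ℝ) (hM : HasMatDerivAt M M' x) :
    HasMatDerivAt (fun y => c • M y) (c • M') x :=
  fun i j => (hM i j).const_mul c

theorem transpose (hM : HasMatDerivAt M M' x) :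
    HasMatDerivAt (fun y => (M y).transpose) M'.transpose x :=
  fun i j => hM j i

theorem const_mul (C : Mat6) (hM : HasMatDerivAt M M' x) :
    HasMatDerivAt (fun y => C * M y) (C * M') x := by
  simpa using (const C x).mul hM

theorem mul_const (C : Mat6) (hM : HasMatDerivAt M M' x) :
    HasMatDerivAt (fun y => M y * C) (M' * C) x := by
  simpa using hM.mul (const C x)

theorem congr (hM : HasMatDerivAt M M' x) (h : ∀ᶠ y in nhds x, N y = M y) (h' : M' = N') :
    HasMatDerivAt N N' x := by
  subst h'
  exact fun i j => (hM i j).congr_of_eventuallyEq (h.mono fun y hy => congrArg (· i j) hy)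

theorem unique (hM : HasMatDerivAt M M' x) (hN : HasMatDerivAt M N' x) : M' = N' := by
  ext i j
  exact (hM i j).unique (hN i j)

end HasMatDerivAt

theorem differentiableAt_det {M : ℝ → Mat6} {x : ℝ}
    (hM : ∀ i j, DifferentiableAt ℝ (fun y => M y i j) x) :
    DifferentiableAt ℝ (fun y => (M y).det) x := by
  simp only [Matrix.det_apply]
  exact DifferentiableAt.fun_sum fun σ _ =>
    (DifferentiableAt.fun_finsetProd fun i _ => hM (σ i) i).const_smul _

theorem differentiableAt_inv {M : ℝ → Mat6} {x : ℝ}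
    (hM : ∀ i j, DifferentiableAt ℝ (fun y => M y i j) x) (hx : IsUnit (M x).det) (i j : Fin 6) :
    DifferentiableAt ℝ (fun y => (M y)⁻¹ i j) x := by
  simp only [Matrix.inv_def, Ring.inverse_eq_inv', Matrix.smul_apply, smul_eq_mul,
    Matrix.adjugate_apply]
  refine ((differentiableAt_det hM).fun_inv hx.ne_zero).fun_mul (differentiableAt_det fun k l => ?_)
  by_cases h : k = j
  · subst h
    simp
  · simpa [Matrix.updateRow_ne h] using hM k l

/-- Cramer's rule gives differentiability of the entries of the inverse. Its derivative is then
forced by differentiating `M M⁻¹ = 1`, valid near `x` because the determinant is continuous. -/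
theorem HasMatDerivAt.inv {M : ℝ → Mat6} {M' : Mat6} {x : ℝ} (hM : HasMatDerivAt M M' x)
    (hx : IsUnit (M x).det) :
    HasMatDerivAt (fun y => (M y)⁻¹) (-((M x)⁻¹ * M' * (M x)⁻¹)) x := by
  have hd : ∀ i j, DifferentiableAt ℝ (fun y => M y i j) x := fun i j => (hM i j).differentiableAt
  have hI : HasMatDerivAt (fun y => (M y)⁻¹) (Matrix.of fun i j => deriv (fun y =>
      (M y)⁻¹ i j) x) x :=
    fun i j => (differentiableAt_inv hd hx i j).hasDerivAt
  generalize (Matrix.of fun i j => deriv (fun y => (M y)⁻¹ i j) x : Mat6) = I' at hI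
  have hev : ∀ᶠ y in nhds x, (1 : Mat6) = M y * (M y)⁻¹ :=
    ((differentiableAt_det hd).continuousAt.eventually_ne hx.ne_zero).mono fun y hy =>
      (Matrix.mul_nonsing_inv _ (isUnit_iff_ne_zero.2 hy)).symm
  have h0 := ((hM.mul hI).congr hev rfl).unique (HasMatDerivAt.const 1 x)
  refine hI.congr (Filter.Eventually.of_forall fun _ => rfl) ?_
  have h1 : (M x)⁻¹ * (M' * (M x)⁻¹ + M x * I') = 0 := by rw [h0, mul_zero]
  rw [mul_add, Matrix.nonsing_inv_mul_cancel_left _ _ hx, ← mul_assoc] at h1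
  exact eq_neg_of_add_eq_zero_right h1

/-! ### The game -/

theorem inv_smul_one_three (r : ℝ) (hr : r ≠ 0) :
    (r • (1 : Matrix (Fin 3) (Fin 3) ℝ))⁻¹ = r⁻¹ • 1 :=
  Matrix.inv_eq_right_inv (by simp [smul_smul, hr])

theorem gameQ_eq {rp re : ℝ} (n e f : ℝ) (hp : rp ≠ 0) (he : re ≠ 0) :
    gameQ n rp re e f = (1 / n ^ 4 * (1 / rp - 1 / re)) • Matrix.diagonal
      ![0, 0, 0, 1 / rho e f ^ 6, 1 / rho e f ^ 6, 1 / rho e f ^ 6] := by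
  rw [gameQ, inv_smul_one_three rp hp, inv_smul_one_three re he, ← sub_smul, sysB]
  ext i j
  fin_cases i <;> fin_cases j <;>
    simp [Matrix.mul_apply, Fin.sum_univ_three] <;> ring

variable {e : ℝ}

theorem isUnit_det_phi {f : ℝ} (he : 0 ≤ e) (hf : f ∈ anomalyRange e) :
    IsUnit (phi e f).det :=
  (fundAt_isFundamental he hf).isUnit_det

theorem kernel_eq {f : ℝ} (he : 0 ≤ e) : kernel e f = (phi e f)⁻¹ * Matrix.diagonal
    ![0, 0, 0, 1 / rho e f ^ 6, 1 / rho e f ^ 6, 1 / rho e f ^ 6] *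
      ((phi e f)⁻¹).transpose := by
  rw [kernel, kernelOf, fundAt_c he]
  rfl

theorem Omega22_eq {a b : ℝ} (he : 0 ≤ e) (hb : b ∈ anomalyRange e) :
    Omega22 e a b = ((phi e a)⁻¹).transpose * (phi e b).transpose := by
  rw [Omega22, Omega11, Matrix.mul_inv_rev, Matrix.nonsing_inv_nonsing_inv _
    (isUnit_det_phi he hb), Matrix.transpose_mul]

/-- All dependence on `θ` collects in `φ⁻¹(θ) diag(O, ρ⁻⁶ I) φ⁻ᵀ(θ)`, between constant matrices. The
minus sign before `Q` swaps the two reciprocals. -/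
theorem Omega12_integrand {rp re a b θ : ℝ} (n : ℝ) (he : 0 ≤ e) (hp : rp ≠ 0) (hr : re ≠ 0)
    (ha : a ∈ anomalyRange e) :
    Omega11 e b θ * (-gameQ n rp re e θ) * Omega22 e θ a =
      (1 / n ^ 4 * (1 / re - 1 / rp)) • (phi e b * kernel e θ * (phi e a).transpose) := by
  rw [Omega22_eq he ha, gameQ_eq n e θ hp hr, kernel_eq he, Omega11, ← neg_smul]
  simp only [Matrix.mul_smul, Matrix.smul_mul, mul_assoc]
  congr 1
  ring

theorem hasMatDerivAt_matJ {f : ℝ} (he : 0 ≤ e) (hf : f ∈ anomalyRange e) :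
    HasMatDerivAt (matJ e) (kernel e f) f := hasDerivAt_matJ he hf

theorem hasMatDerivAt_phi {f : ℝ} (he : 0 ≤ e) (hf : f ∈ anomalyRange e) :
    HasMatDerivAt (phi e) (sysA e f * phi e f) f := hasDerivAt_phi he hf

theorem Omega12_eq {rp re a b : ℝ} (n : ℝ) (he : 0 ≤ e) (hp : rp ≠ 0) (hr : re ≠ 0)
    (ha : a ∈ anomalyRange e) (hb : b ∈ anomalyRange e) :
    Omega12 n rp re e b a = (1 / n ^ 4 * (1 / re - 1 / rp)) •
      (phi e b * (matJ e b - matJ e a) * (phi e a).transpose) := by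
  have hs := uIcc_subset_anomalyRange he ha hb
  rw [Omega12]
  simp only [Omega12_integrand n he hp hr ha]
  rw [matIntegral_eq_sub (G := fun θ => (1 / n ^ 4 * (1 / re - 1 / rp)) •
    (phi e b * matJ e θ * (phi e a).transpose))]
  · rw [← smul_sub, ← sub_mul, ← mul_sub]
  · intro x hx
    exact (((hasMatDerivAt_matJ he (hs hx)).const_mul _).mul_const _).const_smul _
  · intro i j
    simp only [Matrix.smul_apply, Matrix.mul_apply, smul_eq_mul]
    exact continuousOn_const.mul (continuousOn_finsetSum _ fun k _ =>
      (continuousOn_finsetSum _ fun l _ => continuousOn_const.mul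
        ((continuousOn_kernel he l k).mono hs)).mul continuousOn_const)

/-! ### Derivatives in the initial anomaly and the Riccati equation. -/

variable {f ff rp re : ℝ}

theorem hasMatDerivAt_Omega11 (he : 0 ≤ e) (hf : f ∈ anomalyRange e) :
    HasMatDerivAt (Omega11 e ff) (-(Omega11 e ff f * sysA e f)) f := by
  refine (((hasMatDerivAt_phi he hf).inv (isUnit_det_phi he hf)).const_mul (phi e ff)).congr
    (Filter.Eventually.of_forall fun _ => rfl) ?_
  rw [Omega11, Matrix.mul_assoc (phi e f)⁻¹, Matrix.mul_nonsing_inv_cancel_right _ _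
    (isUnit_det_phi he hf), mul_neg, mul_assoc]

theorem hasMatDerivAt_Omega22 (he : 0 ≤ e) (hf : f ∈ anomalyRange e) :
    HasMatDerivAt (Omega22 e ff) (Omega22 e ff f * (sysA e f).transpose) f := by
  refine ((hasMatDerivAt_phi he hf).transpose.const_mul ((phi e ff)⁻¹).transpose).congr ?_ ?_
  · exact ((isOpen_anomalyRange e).eventually_mem hf).mono fun x hx => Omega22_eq he hx
  · rw [Omega22_eq he hf, Matrix.transpose_mul, mul_assoc]

/-- The initial anomaly occurs both in the limit of integration and in the integrand. The closed
form reduces this to the product rule: `J' = K` produces `Ω₁₁ Q` and `φ' = A φ` produces `Ω₁₂ Aᵀ`.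
-/
theorem hasMatDerivAt_Omega12 (n : ℝ) (he : 0 ≤ e) (hp : rp ≠ 0) (hr : re ≠ 0)
    (hff : ff ∈ anomalyRange e) (hf : f ∈ anomalyRange e) :
    HasMatDerivAt (Omega12 n rp re e ff)
      (Omega11 e ff f * gameQ n rp re e f + Omega12 n rp re e ff f * (sysA e f).transpose) f := by
  have hJ := ((HasMatDerivAt.const (matJ e ff) f).sub (hasMatDerivAt_matJ he hf)).const_mul
    (phi e ff)
  refine ((hJ.mul (hasMatDerivAt_phi he hf).transpose).const_smul
    (1 / n ^ 4 * (1 / re - 1 / rp))).congr ?_ ?_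
  · exact ((isOpen_anomalyRange e).eventually_mem hf).mono
      fun x hx => Omega12_eq n he hp hr hx hff
  · have h : ((phi e f)⁻¹).transpose * (phi e f).transpose = 1 := by
      rw [← Matrix.transpose_mul, Matrix.mul_nonsing_inv _ (isUnit_det_phi he hf),
        Matrix.transpose_one]
    rw [Omega12_eq n he hp hr hf hff, smul_add, Matrix.transpose_mul, Matrix.smul_mul, zero_sub,
      gameQ_eq n e f hp hr, kernel_eq he, Omega11]
    congr 1
    · rw [mul_neg, neg_mul, smul_neg, ← neg_smul]
      simp only [mul_assoc, h, mul_one, Matrix.mul_smul]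
      congr 1
      ring
    · simp only [mul_assoc]

/-- Let `N` be the matrix to be inverted. Then `N' = N Aᵀ - S Ω₁₁ Q` and `(S Ω₁₁)' = -S Ω₁₁ A`, so
differentiating `N⁻¹ (S Ω₁₁)` gives the three terms, the quadratic one from `N⁻¹ S Ω₁₁ Q N⁻¹ S Ω₁₁`.
-/
theorem hasMatDerivAt_gainP (n sr : ℝ) (he : 0 ≤ e) (hp : rp ≠ 0) (hr : re ≠ 0)
    (hff : ff ∈ anomalyRange e) (hf : f ∈ anomalyRange e)
    (hD : IsUnit (riccatiDen n rp re sr e ff f).det) :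
    HasMatDerivAt (gainP n rp re sr e ff)
      (-((sysA e f).transpose * gainP n rp re sr e ff f) - gainP n rp re sr e ff f * sysA e f +
        gainP n rp re sr e ff f * gameQ n rp re e f * gainP n rp re sr e ff f) f := by
  have hden : HasMatDerivAt (riccatiDen n rp re sr e ff)
      (riccatiDen n rp re sr e ff f * (sysA e f).transpose -
        termS sr * Omega11 e ff f * gameQ n rp re e f) f := by
    refine ((hasMatDerivAt_Omega22 he hf).sub
      ((hasMatDerivAt_Omega12 n he hp hr hff hf).const_mul (termS sr))).congr
      (Filter.Eventually.of_forall fun _ => rfl) ?_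
    rw [riccatiDen, sub_mul, mul_add]
    simp only [mul_assoc]
    abel
  refine ((hden.inv hD).mul ((hasMatDerivAt_Omega11 he hf).const_mul (termS sr))).congr
    (Filter.Eventually.of_forall fun _ => rfl) ?_
  rw [mul_sub, Matrix.nonsing_inv_mul_cancel_left _ _ hD, gainP, mul_neg]
  noncomm_ring

theorem gainP_self (n sr : ℝ) (he : 0 ≤ e) (hff : ff ∈ anomalyRange e) :
    gainP n rp re sr e ff ff = termS sr := by
  have h11 : Omega11 e ff ff = 1 := Matrix.mul_nonsing_inv _ (isUnit_det_phi he hff)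
  have h12 : Omega12 n rp re e ff ff = 0 := by
    ext i j
    exact intervalIntegral.integral_same
  rw [gainP, riccatiDen, Omega22, h11, h12]
  simp

end PursuitEvasion

end

theorem mainTheorem2 :
    -- `φ` is an invertible solution of `φ' = A φ` with the displayed inverse,
    -- and `J` is an antiderivative of `φ⁻¹ diag(O, ρ⁻⁶ I) φ⁻ᵀ`, in all three cases
    (∀ e : ℝ, 0 ≤ e → ∀ f ∈ anomalyRange e,
      IsUnit (phi e f).det ∧ (phi e f)⁻¹ = (fundAt e f).invMat ∧
      (∀ i j, HasDerivAt (fun x => phi e x i j) ((sysA e f * phi e f) i j) f) ∧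
      (∀ i j, HasDerivAt (fun x => matJ e x i j) (kernel e f i j) f) ∧
      (matJ e f).IsSymm ∧
      (∀ i j : Fin 6, i < 4 → 4 ≤ j → matJ e f i j = 0)) ∧
    -- the elliptic case, through the eccentric anomaly
    (∀ e : ℝ, 0 ≤ e → e < 1 →
      (∀ f : ℝ, |f - eccAnomaly e f| < 2 * π ∧
        sin f = sinOfE e (eccAnomaly e f) ∧ cos f = cosOfE e (eccAnomaly e f) ∧
        meanL e f = meanLOfE e (eccAnomaly e f) ∧
        HasDerivAt (eccAnomaly e) ((1 - e * cos (eccAnomaly e f)) / √(1 - e ^ 2)) f) ∧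
      (∀ (E : ℝ) (i j), HasDerivAt (fun x => ellJ e x i j) (kernelE e E i j) E) ∧
      (∀ f₁ f₂ : ℝ,
        matIntegral f₁ f₂ (kernel e) =
          matIntegral (eccAnomaly e f₁) (eccAnomaly e f₂) (kernelE e) ∧
        matIntegral (eccAnomaly e f₁) (eccAnomaly e f₂) (kernelE e) =
          ellJ e (eccAnomaly e f₂) - ellJ e (eccAnomaly e f₁))) ∧
    -- the parabolic case, directly in `f`
    (∀ f : ℝ, |f| < π → ∀ i j, HasDerivAt (fun x => parJ x i j) (kernel 1 f i j) f) ∧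
    -- the hyperbolic case, through the hyperbolic anomaly
    (∀ e : ℝ, 1 < e →
      (∀ f ∈ anomalyRange e,
        sin f = sinOfH e (hypAnomaly e f) ∧ cos f = cosOfH e (hypAnomaly e f) ∧
        meanL e f = meanLOfH e (hypAnomaly e f) ∧
        HasDerivAt (hypAnomaly e) ((e * cosh (hypAnomaly e f) - 1) / √(e ^ 2 - 1)) f) ∧
      (∀ (H : ℝ) (i j), HasDerivAt (fun x => hypJ e x i j) (kernelH e H i j) H) ∧
      (∀ f₁ ∈ anomalyRange e, ∀ f₂ ∈ anomalyRange e,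
        matIntegral f₁ f₂ (kernel e) =
          matIntegral (hypAnomaly e f₁) (hypAnomaly e f₂) (kernelH e) ∧
        matIntegral (hypAnomaly e f₁) (hypAnomaly e f₂) (kernelH e) =
          hypJ e (hypAnomaly e f₂) - hypJ e (hypAnomaly e f₁))) ∧
    -- closed form of `Ω₁₂`, and of the solution of the Riccati equation of the game
    (∀ e μ p rp re sr : ℝ, 0 ≤ e → 0 < μ → 0 < p → rp ≠ 0 → re ≠ 0 →
      (∀ f₁ ∈ anomalyRange e, ∀ f₂ ∈ anomalyRange e,
        (∀ i j, IntervalIntegrable (fun θ => kernel e θ i j) MeasureTheory.volume f₁ f₂) ∧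
        matIntegral f₁ f₂ (kernel e) = matJ e f₂ - matJ e f₁ ∧
        Omega12 (rate μ p) rp re e f₂ f₁ =
          (1 / rate μ p ^ 4 * (1 / re - 1 / rp)) •
            (phi e f₂ * (matJ e f₂ - matJ e f₁) * (phi e f₁).transpose)) ∧
      (∀ ff ∈ anomalyRange e,
        gainP (rate μ p) rp re sr e ff ff = termS sr ∧
        ∀ f ∈ anomalyRange e, IsUnit (riccatiDen (rate μ p) rp re sr e ff f).det →
          ∀ i j, HasDerivAt (fun x => gainP (rate μ p) rp re sr e ff x i j)
            ((-((sysA e f).transpose * gainP (rate μ p) rp re sr e ff f)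
              - gainP (rate μ p) rp re sr e ff f * sysA e f
              + gainP (rate μ p) rp re sr e ff f * gameQ (rate μ p) rp re e f *
                gainP (rate μ p) rp re sr e ff f) i j) f)) := by
  refine ⟨fun e he f hf => ?_, fun e he h1 => ?_, fun f hf => ?_, fun e h1 => ?_,
    fun e μ p rp re sr he _ _ hp hr => ?_⟩
  · have hd := fundAt_isFundamental he hf
    exact ⟨hd.isUnit_det, hd.inv_mat, hasDerivAt_phi he hf, hasDerivAt_matJ he hf,
      matJ_isSymm e f, fun i j hi hj => matJ_apply_eq_zero e f hi hj⟩
  · refine ⟨fun f => ⟨abs_sub_eccAnomaly_lt he h1 f, sin_eq_sinOfE he h1 f,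
      cos_eq_cosOfE he h1 f, meanL_eq_meanLOfE he h1 f, hasDerivAt_eccAnomaly he h1 f⟩,
      hasDerivAt_ellJ_kernelE he h1, fun f₁ f₂ => ⟨?_, matIntegral_kernelE he h1 _ _⟩⟩
    -- Both integrals are evaluated through their antiderivatives, which agree by the definition of
    -- `J`; no substitution rule is needed.
    rw [matIntegral_kernelE he h1, matIntegral_kernel he (Or.inl h1) (Or.inl h1), matJ_of_lt h1,
      matJ_of_lt h1]
  · refine hasDerivAt_parJ (ne_of_gt ?_)
    have := cos_lt_cos_of_nonneg_of_le_pi (abs_nonneg f) le_rfl hf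
    rw [cos_pi, cos_abs] at this
    linarith
  · refine ⟨fun f hf => ⟨sin_eq_sinOfH h1 hf, cos_eq_cosOfH h1 hf, meanL_eq_meanLOfH h1 hf,
      hasDerivAt_hypAnomaly h1 hf⟩, hasDerivAt_hypJ_kernelH h1,
      fun f₁ h₁ f₂ h₂ => ⟨?_, matIntegral_kernelH h1 _ _⟩⟩
    rw [matIntegral_kernelH h1, matIntegral_kernel (by linarith) h₁ h₂, matJ_of_gt h1,
      matJ_of_gt h1]
  · exact ⟨fun f₁ h₁ f₂ h₂ => ⟨intervalIntegrable_kernel he h₁ h₂, matIntegral_kernel he h₁ h₂,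
      Omega12_eq _ he hp hr h₁ h₂⟩,
      fun ff hff => ⟨gainP_self _ sr he hff,
        fun f hf hD => hasMatDerivAt_gainP _ sr he hp hr hff hf hD⟩⟩
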